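/- Let $\Bbbk$ be an algebraically closed field of characteristic zero and let $G$ be the simply connected semisimple group of type $\mathsf A_\ell$ ($\ell\ge 1$), $\mathsf B_\ell$ ($\ell\ge 2$) or $\mathsf C_\ell$ ($\ell\ge 1$, $\mathsf C_1=\mathsf A_1$), i.e. the universal cover of $\mathrm{SL}(\ell+1)$, $\mathrm{SO}(2\ell+1)$ or $\mathrm{Sp}(2\ell)$, with Lie algebra $\mathfrak g$, simple roots $\Delta=\{\alpha_1,\dots,\alpha_\ell\}$ and fundamental weights $\omega_1,\dots,\omega_\ell$ numbered as in Bourbaki. Put $\varepsilon_i=\omega_i$, except that $\varepsilon_\ell=2\omega_\ell$ in type $\mathsf B_\ell$, and let $V_\lambda$ be the irreducible $G$-module of highest weight $\lambda$. Let $\mathfrak k$ be the Kac–Moody algebra (with Cartan subalgebra $\mathfrak t_K$ given by a minimal realization, and defined by the Chevalley–Serre relations) whose Dynkin diagram is obtained from that of $G$ by adding two nodes $\alpha_0,\beta_0$, each joined by a simple edge to $\alpha_1$ and not joined to each other. Identify $\mathfrak g$ with the subalgebra of $\mathfrak k$ generated by the Chevalley generators $e_i,f_i$ attached to $\alpha_1,\dots,\alpha_\ell$,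 and let $G$ act on $\mathfrak k$ by integrating the adjoint action of $\mathfrak g$. Let $\mathfrak c=\{t\in\mathfrak t_K:\alpha_i(t)=0,\ 1\le i\le \ell\}$ (the Lie algebra of the identity component of the centralizer of $G$ in the maximal torus of $K$), and for $\eta\in\mathbb Z\alpha_0+\mathbb Z\beta_0$ put $\mathfrak k_\eta=\{x\in\mathfrak k: [t,x]=\eta(t)x\ \text{for all } t\in\mathfrak c\}$. Finally let $\mathfrak k^-=\bigoplus\mathfrak k_{-\eta}$, the sum over all $\eta=a\alpha_0+b\beta_0$ with $a,b\in\mathbb N$ and $(a,b)\neq(0,0)$. Then every $\mathfrak k_\eta$ is a finite dimensional $G$-module, and: 1. $\mathfrak k_0=\mathfrak g+\mathfrak t_K$; 2. $\mathfrak k^-$ is generated, as a Lie algebra, by $\mathfrak k_{-\alpha_0}$ and $\mathfrak k_{-\beta_0}$; 3. $\mathfrak k_{-\eta}\cong\mathfrak k_\eta^*$ as $G$-modules, for every $\eta\in\mathbb Z\alpha_0+\mathbb Z\beta_0$; 4. $\mathfrak k_{-\alpha_0}\cong\mathfrak k_{-\beta_0}\cong V_{\varepsilon_1}$ as $G$-modules;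 5. if $\ell\ge 2$, the $G$-module $V_{\varepsilon_2}$ occurs in $\mathfrak k_{-\alpha_0-\beta_0}$ with multiplicity one, i.e. $\dim\operatorname{Hom}_G(V_{\varepsilon_2},\mathfrak k_{-\alpha_0-\beta_0})=1$. -/

import Mathlib

/-! ### Kac-Moody algebras -/

/-- A (minimal) realization `(𝔥, Π, Π^∨)` over `k` of the generalized Cartan matrix
`A = (a_{ij})`, `a_{ij} = ⟨α_i^∨, α_j⟩`. -/
structure Realization (k : Type*) [Field k] {I : Type*} [Fintype I] [DecidableEq I]
    (A : Matrix I I ℤ) (𝔥 : Type*) [AddCommGroup 𝔥] [Module k 𝔥] where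
  /-- the simple roots -/
  root : I → Module.Dual k 𝔥
  /-- the simple coroots -/
  coroot : I → 𝔥
  root_coroot : ∀ i j, root j (coroot i) = (A i j : k)
  linearIndependent_root : LinearIndependent k root
  linearIndependent_coroot : LinearIndependent k coroot
  finrank_add_rank :
    Module.finrank k 𝔥 + (A.map (Int.cast : ℤ → k)).rank = 2 * Fintype.card I

/-- Generators of a Kac-Moody algebra: the elements of `𝔥`, the `e_i` and the `f_i`. -/
inductive KMGen (I 𝔥 : Type*) where
  | H : 𝔥 → KMGen I 𝔥
  | E : I → KMGen I 𝔥
  | F : I → KMGen I 𝔥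

section KacMoody

variable {k : Type*} [Field k] {I : Type*} [Fintype I] [DecidableEq I] {A : Matrix I I ℤ}
  {𝔥 : Type*} [AddCommGroup 𝔥] [Module k 𝔥]

/-- The element `h` of `𝔥` as a generator of the free Lie algebra. -/
noncomputable abbrev genH (k : Type*) [Field k] (I : Type*) {𝔥 : Type*} (h : 𝔥) :
    FreeLieAlgebra k (KMGen I 𝔥) := FreeLieAlgebra.of k (KMGen.H h)

/-- The generator `e_i` of the free Lie algebra. -/
noncomputable abbrev genE (k : Type*) [Field k] {I : Type*} (𝔥 : Type*) (i : I) :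
    FreeLieAlgebra k (KMGen I 𝔥) := FreeLieAlgebra.of k (KMGen.E i)

/-- The generator `f_i` of the free Lie algebra. -/
noncomputable abbrev genF (k : Type*) [Field k] {I : Type*} (𝔥 : Type*) (i : I) :
    FreeLieAlgebra k (KMGen I 𝔥) := FreeLieAlgebra.of k (KMGen.F i)

/-- The defining relators of the Kac-Moody algebra: the first two families make `𝔥` a linear
subspace, and the last two are the Serre relations. -/
inductive Realization.Relator (R : Realization k A 𝔥) : FreeLieAlgebra k (KMGen I 𝔥) → Prop
  | add (h h' : 𝔥) : R.Relator (genH k I (h + h') - genH k I h - genH k I h')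
  | smul (c : k) (h : 𝔥) : R.Relator (genH k I (c • h) - c • genH k I h)
  | HH (h h' : 𝔥) : R.Relator ⁅genH k I h, genH k I h'⁆
  | HE (h : 𝔥) (j : I) : R.Relator (⁅genH k I h, genE k 𝔥 j⁆ - R.root j h • genE k 𝔥 j)
  | HF (h : 𝔥) (j : I) : R.Relator (⁅genH k I h, genF k 𝔥 j⁆ + R.root j h • genF k 𝔥 j)
  | EF_same (i : I) : R.Relator (⁅genE k 𝔥 i, genF k 𝔥 i⁆ - genH k I (R.coroot i))
  | EF_ne (i j : I) : i ≠ j → R.Relator ⁅genE k 𝔥 i, genF k 𝔥 j⁆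
  | serreE (i j : I) : i ≠ j →
      R.Relator (((LieAlgebra.ad k _ (genE k 𝔥 i)) ^ (1 - A i j).toNat) (genE k 𝔥 j))
  | serreF (i j : I) : i ≠ j →
      R.Relator (((LieAlgebra.ad k _ (genF k 𝔥 i)) ^ (1 - A i j).toNat) (genF k 𝔥 j))

/-- The ideal generated by the relators. -/
noncomputable def Realization.relIdeal (R : Realization k A 𝔥) :
    LieIdeal k (FreeLieAlgebra k (KMGen I 𝔥)) :=
  LieSubmodule.lieSpan k _ {x | R.Relator x}

/-- The Kac-Moody algebra of the matrix `A` (with the chosen realization). -/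
def KacMoodyAlgebra (R : Realization k A 𝔥) : Type _ :=
  FreeLieAlgebra k (KMGen I 𝔥) ⧸ R.relIdeal

noncomputable instance (R : Realization k A 𝔥) : LieRing (KacMoodyAlgebra R) :=
  inferInstanceAs (LieRing (FreeLieAlgebra k (KMGen I 𝔥) ⧸ R.relIdeal))

noncomputable instance (R : Realization k A 𝔥) : LieAlgebra k (KacMoodyAlgebra R) :=
  inferInstanceAs (LieAlgebra k (FreeLieAlgebra k (KMGen I 𝔥) ⧸ R.relIdeal))

namespace KacMoodyAlgebra

/-- The quotient map from the free Lie algebra. -/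
noncomputable def mk (R : Realization k A 𝔥) :
    FreeLieAlgebra k (KMGen I 𝔥) →ₗ⁅k⁆ KacMoodyAlgebra R :=
  { ((LieSubmodule.Quotient.mk' R.relIdeal :
      FreeLieAlgebra k (KMGen I 𝔥) →ₗ⁅k, FreeLieAlgebra k (KMGen I 𝔥)⁆
        FreeLieAlgebra k (KMGen I 𝔥) ⧸ R.relIdeal) :
      FreeLieAlgebra k (KMGen I 𝔥) →ₗ[k] FreeLieAlgebra k (KMGen I 𝔥) ⧸ R.relIdeal) with
    map_lie' := fun {x y} => LieSubmodule.Quotient.mk_bracket (I := R.relIdeal) x y }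

theorem mk_relator (R : Realization k A 𝔥) {x : FreeLieAlgebra k (KMGen I 𝔥)}
    (hx : R.Relator x) : mk R x = 0 :=
  (LieSubmodule.Quotient.mk_eq_zero (N := R.relIdeal)).2 (LieSubmodule.subset_lieSpan hx)

/-- The Chevalley generator `e_i`. -/
noncomputable def e (R : Realization k A 𝔥) (i : I) : KacMoodyAlgebra R :=
  mk R (genE k 𝔥 i)

/-- The Chevalley generator `f_i`. -/
noncomputable def f (R : Realization k A 𝔥) (i : I) : KacMoodyAlgebra R :=
  mk R (genF k 𝔥 i)

/-- The canonical linear map `𝔥 → 𝔨`. -/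
noncomputable def h (R : Realization k A 𝔥) : 𝔥 →ₗ[k] KacMoodyAlgebra R where
  toFun t := mk R (genH k I t)
  map_add' t t' := by
    have := mk_relator R (.add t t')
    rw [map_sub, map_sub, sub_sub, sub_eq_zero] at this
    exact this
  map_smul' c t := by
    have := mk_relator R (.smul c t)
    rw [map_sub, map_smul, sub_eq_zero] at this
    exact this

/-- The Lie algebra `𝔱_K` of the maximal torus. -/
noncomputable def torus (R : Realization k A 𝔥) : Submodule k (KacMoodyAlgebra R) :=
  LinearMap.range (h R)

theorem h_e (R : Realization k A 𝔥) (t : 𝔥) (j : I) : ⁅h R t, e R j⁆ = R.root j t • e R j := by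
  have := mk_relator R (.HE t j)
  rw [map_sub, map_smul, LieHom.map_lie, sub_eq_zero] at this
  exact this

theorem h_f (R : Realization k A 𝔥) (t : 𝔥) (j : I) :
    ⁅h R t, f R j⁆ = -(R.root j t • f R j) := by
  have := mk_relator R (.HF t j)
  rw [map_add, map_smul, LieHom.map_lie, add_eq_zero_iff_eq_neg] at this
  exact this

end KacMoodyAlgebra

end KacMoody

attribute [local instance 100] LieRing.ofAssociativeRing

/-! ### The simply connected group attached to a semisimple Lie algebra, and its modules -/

section Group

variable {k : Type*} [Field k] [CharZero k]

/-- The exponential `∑ aⁿ / n!` of a nilpotent element. -/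
noncomputable def nilExp {B : Type*} [Ring B] [Algebra k B] (a : B) : B :=
  ∑ n ∈ Finset.range (nilpotencyClass a), ((n.factorial : k)⁻¹) • a ^ n

theorem nilExp_mul_neg {B : Type*} [Ring B] [Algebra k B] {a : B} (ha : IsNilpotent a) :
    nilExp (k := k) a * nilExp (k := k) (-a) = 1 := by
  let _ : Algebra ℚ B := Algebra.compHom B (algebraMap ℚ k)
  have key : ∀ b : B, nilExp (k := k) b = IsNilpotent.exp b := by
    intro b
    unfold nilExp IsNilpotent.exp
    refine Finset.sum_congr rfl fun n _ => ?_
    have : ((n.factorial : ℚ)⁻¹) • b ^ n = (algebraMap ℚ k ((n.factorial : ℚ)⁻¹)) • b ^ n := rfl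
    rw [this, map_inv₀, map_natCast]
  rw [key, key]
  exact IsNilpotent.exp_mul_exp_neg_self ha

/-- The exponential of a nilpotent element as a unit. -/
noncomputable def nilExpUnit {B : Type*} [Ring B] [Algebra k B] (a : B) (ha : IsNilpotent a) :
    Bˣ where
  val := nilExp (k := k) a
  inv := nilExp (k := k) (-a)
  val_inv := nilExp_mul_neg ha
  inv_val := by simpa using nilExp_mul_neg (k := k) ha.neg

variable {L : Type*} [LieRing L] [LieAlgebra k L] {J : Type*} (x : J → L)

/-- `ρ` is a finite dimensional representation in which the root vectors `x_j` act nilpotently. -/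
def IsIntegrable {M : Type*} [AddCommGroup M] [Module k M] (ρ : L →ₗ⁅k⁆ Module.End k M) : Prop :=
  Module.Finite k M ∧ ∀ j, IsNilpotent (ρ (x j))

/-- The word `∏ x_{j_r}(t_r)^{±1}` in the one-parameter groups acts on an integrable module by
`∏ exp(t_r ρ(x_{j_r}))^{±1}`. -/
noncomputable def wordAction {M : Type*} [AddCommGroup M] [Module k M]
    (ρ : L →ₗ⁅k⁆ Module.End k M) (hρ : IsIntegrable x ρ) :
    FreeGroup (J × k) →* (Module.End k M)ˣ :=
  FreeGroup.lift fun p =>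
    nilExpUnit (k := k) (p.2 • ρ (x p.1)) ((hρ.2 p.1).smul p.2)

/-- The words that act trivially in every integrable representation. (Every finite dimensional
space is isomorphic to some `kⁿ`.) -/
noncomputable def trivialWords : Subgroup (FreeGroup (J × k)) :=
  ⨅ (n : ℕ) (ρ : L →ₗ⁅k⁆ Module.End k (Fin n → k)) (hρ : IsIntegrable x ρ),
    (wordAction x ρ hρ).ker

instance : (trivialWords (k := k) x).Normal :=
  Subgroup.normal_iInf_normal fun _ => Subgroup.normal_iInf_normal fun _ =>
    Subgroup.normal_iInf_normal fun _ => inferInstance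

/-- The group with Lie algebra `L` generated by one-parameter subgroups `x_j(t) = exp(t x_j)`. When
`L` is semisimple and the `x_j` are root vectors for plus and minus the simple roots, this is the
group of `k`-points of the simply connected semisimple algebraic group with Lie algebra `L`. -/
def ChevalleyGroup : Type _ := FreeGroup (J × k) ⧸ trivialWords (k := k) x

noncomputable instance : Group (ChevalleyGroup (k := k) x) :=
  inferInstanceAs (Group (FreeGroup (J × k) ⧸ trivialWords (k := k) x))

theorem nilExp_map {B C : Type*} [Ring B] [Algebra k B] [Ring C] [Algebra k C] (φ : B ≃ₐ[k] C)
    (a : B) : φ (nilExp (k := k) a) = nilExp (k := k) (φ a) := by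
  have h : nilpotencyClass (φ a) = nilpotencyClass a := by
    unfold nilpotencyClass
    congr 1
    ext n
    simp only [Set.mem_ofPred_eq]
    rw [← map_pow, map_eq_zero_iff φ φ.injective]
  simp [nilExp, h]

theorem trivialWords_le_ker {M : Type*} [AddCommGroup M] [Module k M]
    (ρ : L →ₗ⁅k⁆ Module.End k M) (hρ : IsIntegrable x ρ) :
    trivialWords x ≤ (wordAction x ρ hρ).ker := by
  have := hρ.1
  let b := (Module.finBasis k M).equivFun
  let ρ' : L →ₗ⁅k⁆ Module.End k (Fin (Module.finrank k M) → k) :=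
    (b.lieConj : Module.End k M →ₗ⁅k⁆ _).comp ρ
  have hρ'eq : ∀ y, ρ' y = b.conjAlgEquiv k (ρ y) := fun y => rfl
  have hρ' : IsIntegrable x ρ' :=
    ⟨inferInstance, fun j => by rw [hρ'eq]; exact (hρ.2 j).map (b.conjAlgEquiv k)⟩
  intro w hw
  have h1 : wordAction x ρ' hρ' w = 1 := by
    simp only [trivialWords, Subgroup.mem_iInf] at hw
    exact hw _ ρ' hρ'
  have h2 : wordAction x ρ' hρ' =
      (Units.map (b.conjAlgEquiv k : Module.End k M →* _)).comp (wordAction x ρ hρ) := by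
    ext1 p
    apply Units.ext
    simp only [wordAction, FreeGroup.lift_apply_of, MonoidHom.comp_apply, Units.coe_map,
      nilExpUnit, hρ'eq, ← map_smul]
    exact (nilExp_map (b.conjAlgEquiv k) _).symm
  rw [MonoidHom.mem_ker]
  rw [h2, MonoidHom.comp_apply] at h1
  apply Units.ext
  apply (b.conjAlgEquiv k).injective
  have := congrArg Units.val h1
  simpa using this

open Classical in
/-- The action of the group on an integrable module of its Lie algebra (and, as a default value,
the trivial action on any other one): `x_j(t)` acts by `exp(t ρ(x_j))`. -/
noncomputable def integrate {M : Type*} [AddCommGroup M] [Module k M]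
    (ρ : L →ₗ⁅k⁆ Module.End k M) : Representation k (ChevalleyGroup (k := k) x) M :=
  if hρ : IsIntegrable x ρ then
    (Units.coeHom _).comp
      (QuotientGroup.lift (trivialWords x) (wordAction x ρ hρ) (trivialWords_le_ker x ρ hρ))
  else 1

end Group

/-! ### Irreducible highest weight modules -/

section HighestWeight

variable {k : Type*} [Field k] {L : Type*} [LieRing L] [LieAlgebra k L] {J : Type*}

/-- The left ideal of `U(L)` generated by the `e_i` and the `[e_i, f_i] - lam_i`; the quotient is
the Verma module of highest weight `lam` (given by its values on the simple coroots). -/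
def vermaIdeal (e f : J → L) (lam : J → k) : Ideal (UniversalEnvelopingAlgebra k L) :=
  Ideal.span
    (Set.range (fun i => UniversalEnvelopingAlgebra.ι k (e i)) ∪
      Set.range (fun i => UniversalEnvelopingAlgebra.ι k ⁅e i, f i⁆ -
        algebraMap k (UniversalEnvelopingAlgebra k L) (lam i)))

/-- The sum of all proper left ideals containing the Verma ideal, i.e. the preimage of the largest
proper submodule of the Verma module. -/
def maxIdeal (e f : J → L) (lam : J → k) : Ideal (UniversalEnvelopingAlgebra k L) :=
  sSup {N | vermaIdeal e f lam ≤ N ∧ N ≠ ⊤}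

/-- The irreducible module of highest weight `lam`: the irreducible quotient of the Verma module. -/
abbrev IrrModule (e f : J → L) (lam : J → k) : Type _ :=
  UniversalEnvelopingAlgebra k L ⧸ maxIdeal e f lam

/-- The action of `L` on the irreducible module of highest weight `lam`. -/
noncomputable def irrAction (e f : J → L) (lam : J → k) :
    L →ₗ⁅k⁆ Module.End k (IrrModule e f lam) :=
  ((Algebra.lsmul k k (IrrModule e f lam) :
      UniversalEnvelopingAlgebra k L →ₐ[k] Module.End k (IrrModule e f lam)) :
        UniversalEnvelopingAlgebra k L →ₗ⁅k⁆ Module.End k (IrrModule e f lam)).comp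
    (UniversalEnvelopingAlgebra.ι k)

end HighestWeight

/-! ### The group `K` of a model variety -/

/-- The types of the groups `SL(ℓ+1)`, `SO(2ℓ+1)` and `Sp(2ℓ)`. -/
inductive ModelType where
  | A
  | B
  | C

namespace ModelType

/-- The Cartan matrix `(⟨α_i^∨, α_j⟩)_{ij}`, in Bourbaki's numbering. Bourbaki's (and Mathlib's)
tables list `⟨α_i, α_j^∨⟩` in row `i` and column `j`, whence the transpose. -/
def cartan : ModelType → (ℓ : ℕ) → Matrix (Fin ℓ) (Fin ℓ) ℤ
  | A, ℓ => (CartanMatrix.A ℓ).transpose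
  | B, ℓ => (CartanMatrix.B ℓ).transpose
  | C, ℓ => (CartanMatrix.C ℓ).transpose

/-- The ranks considered: `ℓ ≥ 1`, and `ℓ ≥ 2` in type `B`. -/
def ValidRank : ModelType → ℕ → Prop
  | A, ℓ => 1 ≤ ℓ
  | B, ℓ => 2 ≤ ℓ
  | C, ℓ => 1 ≤ ℓ

/-- The generalized Cartan matrix obtained by adding two nodes `α_0 = inr 0` and `β_0 = inr 1`,
each joined by a simple edge to `α_1 = inl 0` (the index of `Fin ℓ` with value `0`). -/
def extendedCartan (X : ModelType) (ℓ : ℕ) : Matrix (Fin ℓ ⊕ Fin 2) (Fin ℓ ⊕ Fin 2) ℤ :=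
  Matrix.fromBlocks (X.cartan ℓ)
    (Matrix.of fun i _ => if i.val = 0 then -1 else 0)
    (Matrix.of fun _ j => if j.val = 0 then -1 else 0)
    2

/-- The weight `ε_{i+1}`, by its coordinates in the fundamental weights: `ω_{i+1}`, except that
`ε_ℓ = 2 ω_ℓ` in type `B`. -/
def eps (k : Type*) [Field k] (X : ModelType) {ℓ : ℕ} (i : Fin ℓ) : Fin ℓ → k :=
  match X with
  | A => Pi.single i 1
  | B => Pi.single i (if i.val + 1 = ℓ then 2 else 1)
  | C => Pi.single i 1

end ModelType

section Model

variable {k : Type*} [Field k] {X : ModelType} {ℓ : ℕ}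
  {𝔥 : Type*} [AddCommGroup 𝔥] [Module k 𝔥] (R : Realization k (X.extendedCartan ℓ) 𝔥)

/-- `𝔤`, the semisimple part of the Levi subalgebra with simple roots `α_1, …, α_ℓ`. -/
noncomputable def leviG : LieSubalgebra k (KacMoodyAlgebra R) :=
  LieSubalgebra.lieSpan k (KacMoodyAlgebra R)
    (Set.range (fun i : Fin ℓ => KacMoodyAlgebra.e R (.inl i)) ∪
      Set.range (fun i : Fin ℓ => KacMoodyAlgebra.f R (.inl i)))

/-- The generator `e_i` of `𝔤`. -/
noncomputable def leviE (i : Fin ℓ) : leviG R :=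
  ⟨KacMoodyAlgebra.e R (.inl i), LieSubalgebra.subset_lieSpan (.inl ⟨i, rfl⟩)⟩

/-- The generator `f_i` of `𝔤`. -/
noncomputable def leviF (i : Fin ℓ) : leviG R :=
  ⟨KacMoodyAlgebra.f R (.inl i), LieSubalgebra.subset_lieSpan (.inr ⟨i, rfl⟩)⟩

/-- The root vectors `e_i`, `f_i` of `𝔤`. -/
noncomputable def leviRootVectors : Fin ℓ ⊕ Fin ℓ → leviG R :=
  Sum.elim (leviE R) (leviF R)

/-- The Lie algebra of `C`, the identity component of the subgroup of the elements of the maximal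
torus of `K` that commute with `G`. -/
def centerC : Submodule k 𝔥 :=
  ⨅ i : Fin ℓ, LinearMap.ker (R.root (.inl i))

theorem h_leviG {t : 𝔥} (ht : t ∈ centerC R) {y : KacMoodyAlgebra R} (hy : y ∈ leviG R) :
    ⁅KacMoodyAlgebra.h R t, y⁆ = 0 := by
  have ht' : ∀ i : Fin ℓ, R.root (.inl i) t = 0 := by
    simpa [centerC, Submodule.mem_iInf] using ht
  induction hy using LieSubalgebra.lieSpan_induction with
  | mem y hy =>
    rcases hy with ⟨i, rfl⟩ | ⟨i, rfl⟩
    · simp [KacMoodyAlgebra.h_e, ht']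
    · simp [KacMoodyAlgebra.h_f, ht']
  | zero => simp
  | add y z _ _ hy hz => simp [hy, hz]
  | smul c y _ hy => simp [hy]
  | lie y z _ _ hy hz => rw [leibniz_lie, hy, hz]; simp

/-- `𝔨_η`, the eigenspace in `𝔨` for the action of `C` of weight `η = η_0 α_0 + η_1 β_0`, as a
`𝔤`-submodule of `𝔨`. -/
noncomputable def eigenspaceC (η : Fin 2 → ℤ) : LieSubmodule k (leviG R) (KacMoodyAlgebra R) where
  carrier := {y | ∀ t ∈ centerC R,
    ⁅KacMoodyAlgebra.h R t, y⁆ = (∑ j, (η j : k) * R.root (.inr j) t) • y}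
  zero_mem' := by simp
  add_mem' {y z} hy hz t ht := by rw [lie_add, hy t ht, hz t ht, smul_add]
  smul_mem' c y hy t ht := by rw [lie_smul, hy t ht, smul_comm]
  lie_mem {g y} hy t ht := by
    change ⁅KacMoodyAlgebra.h R t, ⁅(g : KacMoodyAlgebra R), y⁆⁆ = _ • ⁅(g : KacMoodyAlgebra R), y⁆
    rw [leibniz_lie, h_leviG R ht g.2, hy t ht]
    simp

variable [CharZero k]

/-- The simply connected group `G` with Lie algebra `𝔤`. -/
abbrev groupG : Type _ := ChevalleyGroup (k := k) (leviRootVectors R)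

/-- A `𝔤`-module is integrable if the action of `𝔤` integrates to one of `G`. -/
abbrev IsIntegrableG {M : Type*} [AddCommGroup M] [Module k M]
    (ρ : leviG R →ₗ⁅k⁆ Module.End k M) : Prop :=
  IsIntegrable (leviRootVectors R) ρ

/-- `𝔨_η` as a `G`-module. -/
noncomputable def kG (η : Fin 2 → ℤ) : Representation k (groupG R) (eigenspaceC R η) :=
  integrate (leviRootVectors R) (LieModule.toEnd k (leviG R) (eigenspaceC R η))

/-- `V_lam`, the irreducible `G`-module of highest weight `lam`. -/
noncomputable def VG (lam : Fin ℓ → k) :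
    Representation k (groupG R) (IrrModule (leviE R) (leviF R) lam) :=
  integrate (leviRootVectors R) (irrAction (leviE R) (leviF R) lam)

end Model

/-!
The proof makes the grading of `𝔨` by the centre `𝔠` of the Levi subalgebra `𝔤 + 𝔱_K` explicit, and
reads everything off from the two pieces `𝔨_{-α_0}` and `𝔨_{-β_0}`.

*The lowest pieces.* In each of the three types the weights of `V_{ε_1}` form a single chain
(`WeightChain`). Applying the `f_i` to `f_{α_0}` along this chain gives vectors `minusVec` on which
the Chevalley generators of `𝔤` act with explicit integral structure constants (`minusVec_e_f`); the
chain stops where it should because the `f_i` act locally nilpotently on `𝔨`. Their span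
`minusSpace` turns out to be `𝔨_{-α_0}`, and likewise for `β_0`.

*The graded pieces.* The sum of the iterated brackets of these two spaces, of the Levi subalgebra,
and of the images of the iterated brackets under the Chevalley involution is stable under the
generators of `𝔨`, so that it is all of `𝔨` (`minusSum_sup_levi_sup_eq_top`). Each summand is
homogeneous for `𝔠`, and the simultaneous eigenspaces of `𝔠` are independent, hence `𝔨_η` is exactly
the sum of the summands of degree `η` (`eigenspaceC_eq_gradedPiece`). This yields `𝔨_0 = 𝔤 + 𝔱_K`
and the generation of `𝔨^-`.

*Finiteness and complete reducibility.* The chains carry a positive definite rational form for which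
`e_i` and `f_i` are adjoint. The class of subspaces which are images of such representations
(`IsUnitarizable`) is closed under finite sums, brackets and the Chevalley involution. As `𝔤` lies
in `⁅𝔨_{α_0}, 𝔨_{-α_0}⁆`, the Levi subalgebra is the sum of these brackets and `𝔠`. It belongs to
this class as well (`isUnitarizable_levi`), and so does every `𝔨_η`. An image of a unitarizable
representation is completely reducible because the trace form of its associative envelope is
nondegenerate (`IsUnitarizable.exists_compl`); this replaces Weyl's theorem.

*Duality.* A completely reducible finite dimensional representation has a nondegenerate
contravariant form (`exists_contravariant`). Composed with the Chevalley involution, which exchanges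
`𝔨_η` and `𝔨_{-η}`, it becomes an invariant perfect pairing of these two spaces.

*Highest weight vectors.* The quotient of a Verma module by its largest proper submodule is a
`𝔨`-module on which `t ∈ 𝔱_K` acts by the highest weight on the highest weight vector, so the Cartan
subalgebra embeds into `𝔨` (`KacMoodyAlgebra.h_injective`) and the Chevalley generators do not
vanish. Hence `f_{α_0}` is a highest weight vector of weight `ε_1`, and `⁅f_{α_0}, ⁅f_{α_1},
f_{β_0}⁆⁆` is one of weight `ε_2`. By complete reducibility each of them generates an irreducible
module (`IsHighest.exists_irrModule_hom`). The piece `𝔨_{-α_0-β_0}` is spanned by the brackets of a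
vector of the first chain with one of the second. An element `t` with all `α_i(t) = 1` grades them
by their total depth, which is one only for `⁅f_{α_0}, ⁅f_{α_1}, f_{β_0}⁆⁆` and `⁅⁅f_{α_1},
f_{α_0}⁆, f_{β_0}⁆`. These two are opposite to each other because `⁅f_{α_0}, f_{β_0}⁆ = 0`, and so
the multiplicity of `V_{ε_2}` is one (`multiplicity_eps_two`).

Passing from `𝔤` to `G` costs nothing: a linear map between integrable modules commutes with `G` if
and only if it commutes with `𝔤` (`integrate_equivariant`, `equivariant_of_integrate`).
-/

/-! ### Highest weight vectors -/

section HighestWeightTheory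

variable {k : Type*} [Field k] {L : Type*} [LieRing L] [LieAlgebra k L]
  {J : Type*}

/-- Chevalley generators `e_i`, `f_i` of the Lie algebra `L` with Cartan matrix `A`, together with
coefficients `c` such that `∑ c_i ⁅e_i, f_i⁆` takes the value one on every simple root. -/
structure ChevalleySystem [Fintype J] (e f : J → L) (A : J → J → k) (c : J → k) : Prop where
  ef_ne : ∀ i j, i ≠ j → ⁅e i, f j⁆ = 0
  h_e : ∀ i j, ⁅⁅e i, f i⁆, e j⁆ = A i j • e j
  h_f : ∀ i j, ⁅⁅e i, f i⁆, f j⁆ = -(A i j • f j)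
  sum_c : ∀ j, ∑ i, c i * A i j = 1
  gen : LieSubalgebra.lieSpan k L (Set.range e ∪ Set.range f) = ⊤

/-- The element `∑ c_i ⁅e_i, f_i⁆`, which grades a highest weight module by depth. -/
def gradingElement [Fintype J] (e f : J → L) (c : J → k) : L := ∑ i, c i • ⁅e i, f i⁆

variable {e f : J → L} {A : J → J → k} {c : J → k}

theorem ChevalleySystem.d_e [Fintype J] (S : ChevalleySystem e f A c) (j : J) :
    ⁅gradingElement e f c, e j⁆ = e j := by
  simp only [gradingElement, sum_lie, smul_lie, S.h_e, smul_smul]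
  rw [← Finset.sum_smul, S.sum_c, one_smul]

theorem ChevalleySystem.d_f [Fintype J] (S : ChevalleySystem e f A c) (j : J) :
    ⁅gradingElement e f c, f j⁆ = -f j := by
  simp only [gradingElement, sum_lie, smul_lie, S.h_f, smul_smul, smul_neg]
  rw [Finset.sum_neg_distrib, ← Finset.sum_smul, S.sum_c, one_smul]

theorem ChevalleySystem.h_h [Fintype J] (S : ChevalleySystem e f A c) (i j : J) :
    ⁅⁅e i, f i⁆, ⁅e j, f j⁆⁆ = 0 := by
  rw [leibniz_lie, S.h_e, S.h_f]; simp

theorem ChevalleySystem.d_h [Fintype J] (S : ChevalleySystem e f A c) (j : J) :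
    ⁅gradingElement e f c, ⁅e j, f j⁆⁆ = 0 := by
  simp [gradingElement, sum_lie, S.h_h]

section Rep

variable {M : Type*} [AddCommGroup M] [Module k M] (ρ : L →ₗ⁅k⁆ Module.End k M)

theorem rep_lie (x y : L) (m : M) : ρ ⁅x, y⁆ m = ρ x (ρ y m) - ρ y (ρ x m) := by
  rw [LieHom.map_lie, LieRing.of_associative_ring_bracket]; rfl

theorem rep_swap (x y : L) (m : M) : ρ x (ρ y m) = ρ y (ρ x m) + ρ ⁅x, y⁆ m := by
  rw [rep_lie]; abel

/-- The subspace `N` is a subrepresentation. -/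
def IsStable (N : Submodule k M) : Prop := ∀ x, ∀ m ∈ N, ρ x m ∈ N

/-- The representation is irreducible. -/
def IsSimpleRep : Prop := Nontrivial M ∧ ∀ N : Submodule k M, IsStable ρ N → N = ⊥ ∨ N = ⊤

variable {ρ}

theorem isStable_of_gen (hgen : LieSubalgebra.lieSpan k L (Set.range e ∪ Set.range f) = ⊤)
    {N : Submodule k M} (he : ∀ i, ∀ m ∈ N, ρ (e i) m ∈ N) (hf : ∀ i, ∀ m ∈ N, ρ (f i) m ∈ N) :
    IsStable ρ N := by
  intro x
  have hx : x ∈ LieSubalgebra.lieSpan k L (Set.range e ∪ Set.range f) := by rw [hgen]; trivial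
  induction hx using LieSubalgebra.lieSpan_induction with
  | mem y hy =>
    rcases hy with ⟨i, rfl⟩ | ⟨i, rfl⟩
    · exact he i
    · exact hf i
  | zero => intro m _; simp
  | add y z _ _ hy hz => intro m hm; rw [map_add]; exact N.add_mem (hy m hm) (hz m hm)
  | smul a y _ hy => intro m hm; rw [map_smul]; exact N.smul_mem _ (hy m hm)
  | lie y z _ _ hy hz =>
    intro m hm; rw [rep_lie]
    exact N.sub_mem (hy _ (hz m hm)) (hz _ (hy m hm))

/-- A linear map commuting with the generators is equivariant. -/
theorem equivariant_of_gen (hgen : LieSubalgebra.lieSpan k L (Set.range e ∪ Set.range f) = ⊤)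
    {M' : Type*} [AddCommGroup M'] [Module k M'] {ρ' : L →ₗ⁅k⁆ Module.End k M'} (φ : M →ₗ[k] M')
    (he : ∀ i m, φ (ρ (e i) m) = ρ' (e i) (φ m)) (hf : ∀ i m, φ (ρ (f i) m) = ρ' (f i) (φ m)) :
    ∀ x m, φ (ρ x m) = ρ' x (φ m) := by
  intro x
  have hx : x ∈ LieSubalgebra.lieSpan k L (Set.range e ∪ Set.range f) := by rw [hgen]; trivial
  induction hx using LieSubalgebra.lieSpan_induction with
  | mem y hy =>
    rcases hy with ⟨i, rfl⟩ | ⟨i, rfl⟩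
    · exact he i
    · exact hf i
  | zero => intro m; simp
  | add y z _ _ hy hz => intro m; simp [hy, hz]
  | smul a y _ hy => intro m; simp [hy]
  | lie y z _ _ hy hz => intro m; rw [rep_lie, rep_lie, map_sub, hy, hz, hz, hy]

/-- `v` is a highest weight vector (or zero) of weight `lam`. -/
structure IsHighest (ρ : L →ₗ⁅k⁆ Module.End k M) (e f : J → L) (lam : J → k) (v : M) : Prop where
  e_zero : ∀ i, ρ (e i) v = 0
  h_eq : ∀ i, ρ ⁅e i, f i⁆ v = lam i • v

theorem IsHighest.d_eq [Fintype J] {lam : J → k} {v : M} (hv : IsHighest ρ e f lam v) (c : J → k) :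
    ρ (gradingElement e f c) v = (∑ i, c i * lam i) • v := by
  simp only [gradingElement, map_sum, map_smul, LinearMap.sum_apply, LinearMap.smul_apply, hv.h_eq,
    smul_smul, Finset.sum_smul]

/-- The span of the vectors obtained from `v` by applying exactly `n` lowering operators. -/
def depthSpan (ρ : L →ₗ⁅k⁆ Module.End k M) (f : J → L) (v : M) : ℕ → Submodule k M
  | 0 => Submodule.span k {v}
  | n + 1 => ⨆ i, (depthSpan ρ f v n).map (ρ (f i))

theorem depthSpan_f {v y : M} {n : ℕ} (i : J) (hy : y ∈ depthSpan ρ f v n) :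
    ρ (f i) y ∈ depthSpan ρ f v (n + 1) :=
  Submodule.mem_iSup_of_mem i (Submodule.mem_map_of_mem hy)

theorem depthSpan_induct {v : M} {n : ℕ} {N : Submodule k M}
    (h : ∀ i, ∀ y ∈ depthSpan ρ f v n, ρ (f i) y ∈ N) : depthSpan ρ f v (n + 1) ≤ N := by
  refine iSup_le fun i => ?_
  rintro _ ⟨y, hy, rfl⟩
  exact h i y hy

theorem depthSpan_h [Fintype J] (S : ChevalleySystem e f A c) {lam : J → k} {v : M}
    (hv : IsHighest ρ e f lam v) (n : ℕ) (i : J) :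
    ∀ y ∈ depthSpan ρ f v n, ρ ⁅e i, f i⁆ y ∈ depthSpan ρ f v n := by
  induction n with
  | zero =>
    intro y hy
    obtain ⟨a, rfl⟩ := Submodule.mem_span_singleton.1 hy
    rw [map_smul, hv.h_eq]
    exact Submodule.smul_mem _ _ (Submodule.smul_mem _ _ (Submodule.mem_span_singleton_self v))
  | succ n ih =>
    refine depthSpan_induct (N := (depthSpan ρ f v (n + 1)).comap (ρ ⁅e i, f i⁆)) fun j y hy => ?_
    rw [Submodule.mem_comap, rep_swap, S.h_f, map_neg, map_smul, LinearMap.neg_apply,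
      LinearMap.smul_apply]
    exact add_mem (depthSpan_f j (ih y hy)) (neg_mem (Submodule.smul_mem _ _ (depthSpan_f j hy)))

theorem depthSpan_d [Fintype J] (S : ChevalleySystem e f A c) {lam : J → k} {v : M}
    (hv : IsHighest ρ e f lam v) (n : ℕ) :
    depthSpan ρ f v n ≤
      Module.End.eigenspace (ρ (gradingElement e f c)) ((∑ i, c i * lam i) - n) := by
  induction n with
  | zero =>
    rw [depthSpan, Submodule.span_singleton_le_iff_mem, Module.End.mem_eigenspace_iff, hv.d_eq]
    simp
  | succ n ih =>
    refine depthSpan_induct fun j y hy => ?_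
    rw [Module.End.mem_eigenspace_iff, rep_swap, S.d_f,
      Module.End.mem_eigenspace_iff.1 (ih hy), map_neg, map_smul, LinearMap.neg_apply]
    push_cast
    module

theorem depthSpan_e [DecidableEq J] [Fintype J] (S : ChevalleySystem e f A c) {lam : J → k} {v : M}
    (hv : IsHighest ρ e f lam v) (n : ℕ) (i : J) :
    ∀ y ∈ depthSpan ρ f v n, ρ (e i) y ∈ depthSpan ρ f v (n - 1) := by
  induction n with
  | zero =>
    intro y hy
    obtain ⟨a, rfl⟩ := Submodule.mem_span_singleton.1 hy
    rw [map_smul, hv.e_zero, smul_zero]; exact zero_mem _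
  | succ n ih =>
    refine depthSpan_induct (N := (depthSpan ρ f v n).comap (ρ (e i))) fun j y hy => ?_
    rw [Submodule.mem_comap, rep_swap]
    refine add_mem ?_ ?_
    · rcases n with _ | n
      · obtain ⟨a, rfl⟩ := Submodule.mem_span_singleton.1 hy
        rw [map_smul, hv.e_zero]; simp
      · exact depthSpan_f j (ih y hy)
    · by_cases hij : i = j
      · subst hij; exact depthSpan_h S hv n i y hy
      · rw [S.ef_ne i j hij]; simp

/-- The structure of the submodule generated by a highest weight vector `v`: it is the sum of the
line through `v` and of a subspace `P` of elements of positive depth, and the eigenvalue of the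
grading element on `v` does not occur in `P`. -/
theorem IsHighest.exists_lower [CharZero k] [Fintype J] (S : ChevalleySystem e f A c)
    {lam : J → k} {v : M} (hv : IsHighest ρ e f lam v) :
    ∃ P : Submodule k M, IsStable ρ (Submodule.span k {v} ⊔ P) ∧
      (∀ i, ∀ y ∈ Submodule.span k {v} ⊔ P, ρ (f i) y ∈ P) ∧
      (∀ i, ∀ y ∈ P, ρ ⁅e i, f i⁆ y ∈ P) ∧
      (∀ N : Submodule k M, v ∈ N → (∀ i, ∀ y ∈ N, ρ (f i) y ∈ N) → P ≤ N) ∧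
      (∀ y ∈ Submodule.span k {v} ⊔ P,
        ρ (gradingElement e f c) y = (∑ i, c i * lam i) • y → y ∈ Submodule.span k {v}) ∧
      (∀ y ∈ P, ρ (gradingElement e f c) y = (∑ i, c i * lam i) • y → y = 0) := by
  classical
  let F := depthSpan ρ f v
  let P : Submodule k M := ⨆ n, F (n + 1)
  have hFP : ∀ n, F n ≤ Submodule.span k {v} ⊔ P := by
    rintro (_ | n)
    · exact le_sup_left
    · exact le_sup_of_le_right (le_iSup (fun n => F (n + 1)) n)
  have hle : ∀ {N : Submodule k M}, (∀ n, F n ≤ N) → Submodule.span k {v} ⊔ P ≤ N :=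
    fun h => sup_le (h 0) (iSup_le fun n => h (n + 1))
  have hf : ∀ i, ∀ y ∈ Submodule.span k {v} ⊔ P, ρ (f i) y ∈ P := fun i =>
    hle (N := P.comap (ρ (f i))) fun n y hy =>
      Submodule.mem_iSup_of_mem n (depthSpan_f i hy)
  have hP : ∀ p ∈ P, ρ (gradingElement e f c) p = (∑ i, c i * lam i) • p → p = 0 := by
    intro p hp hp1
    have hp2 : p ∈ ⨆ j, ⨆ (_ : j ≠ ∑ i, c i * lam i),
        Module.End.eigenspace (ρ (gradingElement e f c)) j := by
      have : P ≤ ⨆ j, ⨆ (_ : j ≠ ∑ i, c i * lam i),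
          Module.End.eigenspace (ρ (gradingElement e f c)) j := by
        refine iSup_le fun n => (depthSpan_d S hv (n + 1)).trans ?_
        refine le_iSup₂_of_le _ ?_ le_rfl
        intro h
        rw [sub_eq_self] at h
        exact Nat.cast_ne_zero.2 n.succ_ne_zero h
      exact this hp
    have := (Module.End.eigenspaces_iSupIndep (ρ (gradingElement e f c))
      (∑ i, c i * lam i)).le_bot ⟨Module.End.mem_eigenspace_iff.2 hp1, hp2⟩
    rwa [Submodule.mem_bot] at this
  refine ⟨P, ?_, hf, ?_, ?_, ?_, hP⟩
  · refine isStable_of_gen S.gen (fun i => ?_) fun i y hy =>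
      le_sup_right (a := Submodule.span k {v}) (hf i y hy)
    exact hle (N := (Submodule.span k {v} ⊔ P).comap (ρ (e i))) fun n y hy =>
      hFP _ (depthSpan_e S hv n i y hy)
  · intro i
    have : P ≤ P.comap (ρ ⁅e i, f i⁆) := iSup_le fun n y hy =>
      Submodule.mem_iSup_of_mem n (depthSpan_h S hv (n + 1) i y hy)
    exact this
  · intro N hvN hN
    have : ∀ n, F n ≤ N := by
      intro n
      induction n with
      | zero => exact (Submodule.span_singleton_le_iff_mem _ _).2 hvN
      | succ n ih => exact depthSpan_induct fun i y hy => hN i y (ih hy)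
    exact iSup_le fun n => this _
  · intro y hy hdy
    obtain ⟨w, hw, p, hp, rfl⟩ := Submodule.mem_sup.1 hy
    obtain ⟨a, rfl⟩ := Submodule.mem_span_singleton.1 hw
    rw [map_add, map_smul, hv.d_eq, smul_add, smul_comm] at hdy
    rw [hP p hp (add_left_cancel hdy), add_zero]
    exact hw

/-- A highest weight representation all of whose subrepresentations have complements is
irreducible. -/
theorem IsHighest.isSimpleRep [CharZero k] [Fintype J] (S : ChevalleySystem e f A c)
    {lam : J → k} {v : M} (hv : IsHighest ρ e f lam v) (hv0 : v ≠ 0)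
    (hgen : ∀ N : Submodule k M, IsStable ρ N → v ∈ N → N = ⊤)
    (hss : ∀ N : Submodule k M, IsStable ρ N → ∃ N', IsStable ρ N' ∧ IsCompl N N') :
    IsSimpleRep ρ := by
  refine ⟨⟨v, 0, hv0⟩, fun N hN => ?_⟩
  obtain ⟨N', hN', hc⟩ := hss N hN
  obtain ⟨P, hst, -, -, -, hP, -⟩ := hv.exists_lower S
  have htop := hgen _ hst
    (le_sup_left (a := Submodule.span k {v}) (Submodule.mem_span_singleton_self v))
  obtain ⟨n, hn, n', hn', hnn⟩ := Submodule.mem_sup.1 (hc.sup_eq_top ▸ Submodule.mem_top (x := v))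
  have hd := hv.d_eq c
  rw [← hnn, map_add, smul_add] at hd
  set κ := ∑ i, c i * lam i
  have hdn : ρ (gradingElement e f c) n = κ • n := by
    have h1 : ρ (gradingElement e f c) n - κ • n ∈ N := sub_mem (hN _ _ hn) (N.smul_mem _ hn)
    have h2 : ρ (gradingElement e f c) n - κ • n ∈ N' := by
      have : ρ (gradingElement e f c) n - κ • n = κ • n' - ρ (gradingElement e f c) n' := by
        rw [sub_eq_sub_iff_add_eq_add, hd]; abel
      rw [this]; exact sub_mem (N'.smul_mem _ hn') (hN' _ _ hn')
    have := hc.disjoint.le_bot ⟨h1, h2⟩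
    exact sub_eq_zero.1 this
  have hnv := hP n (by rw [htop]; trivial) hdn
  obtain ⟨a, rfl⟩ := Submodule.mem_span_singleton.1 hnv
  by_cases ha : a = 0
  · left
    subst ha
    rw [zero_smul, zero_add] at hnn
    have := hgen N' hN' (hnn ▸ hn')
    rw [this] at hc
    exact hc.disjoint.eq_bot_of_le le_top
  · right
    exact hgen N hN ((N.smul_mem_iff ha).1 hn)

end Rep

section Irr

variable {M : Type*} [AddCommGroup M] [Module k M]

/-- The direct sum of two representations. -/
def prodRep {M' : Type*} [AddCommGroup M'] [Module k M'] (ρ : L →ₗ⁅k⁆ Module.End k M)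
    (ρ' : L →ₗ⁅k⁆ Module.End k M') : L →ₗ⁅k⁆ Module.End k (M × M') where
  toFun x := (ρ x).prodMap (ρ' x)
  map_add' x y := by ext <;> simp
  map_smul' a x := by ext <;> simp
  map_lie' {x y} := by
    refine LinearMap.ext fun m => Prod.ext ?_ ?_ <;>
    simp [LieRing.of_associative_ring_bracket]

theorem prodRep_apply {M' : Type*} [AddCommGroup M'] [Module k M'] (ρ : L →ₗ⁅k⁆ Module.End k M)
    (ρ' : L →ₗ⁅k⁆ Module.End k M') (x : L) (m : M × M') :
    prodRep ρ ρ' x m = (ρ x m.1, ρ' x m.2) := rfl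

open UniversalEnvelopingAlgebra in
theorem lift_mem_of_isStable {ρ : L →ₗ⁅k⁆ Module.End k M} {N : Submodule k M} (hN : IsStable ρ N)
    (u : UniversalEnvelopingAlgebra k L) : ∀ m ∈ N, lift k ρ u m ∈ N := by
  let T : Subalgebra k (Module.End k M) :=
    { carrier := {a | ∀ m ∈ N, a m ∈ N}
      mul_mem' := fun {a b} ha hb m hm => ha _ (hb _ hm)
      add_mem' := fun {a b} ha hb m hm => N.add_mem (ha _ hm) (hb _ hm)
      algebraMap_mem' := fun r m hm => N.smul_mem _ hm }
  let ρT : L →ₗ⁅k⁆ T :=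
    { toFun := fun x => ⟨ρ x, hN x⟩
      map_add' := fun x y => Subtype.ext (map_add ρ x y)
      map_smul' := fun a x => Subtype.ext (map_smul ρ a x)
      map_lie' := fun {x y} => Subtype.ext (LieHom.map_lie ρ x y) }
  have : lift k ρ = T.val.comp (lift k ρT) := by
    apply hom_ext
    ext1 x
    simp [LieHom.comp_apply, ρT]
  rw [this]
  exact (lift k ρT u).2

open UniversalEnvelopingAlgebra in
theorem lift_equivariant {M' : Type*} [AddCommGroup M'] [Module k M']
    {ρ : L →ₗ⁅k⁆ Module.End k M} {ρ' : L →ₗ⁅k⁆ Module.End k M'} (φ : M →ₗ[k] M')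
    (hφ : ∀ x m, φ (ρ x m) = ρ' x (φ m)) (u : UniversalEnvelopingAlgebra k L) (m : M) :
    φ (lift k ρ u m) = lift k ρ' u (φ m) := by
  let T : Subalgebra k (Module.End k M × Module.End k M') :=
    { carrier := {a | ∀ m, φ (a.1 m) = a.2 (φ m)}
      mul_mem' := fun {a b} ha hb m => by
        rw [Prod.fst_mul, Prod.snd_mul, Module.End.mul_apply, Module.End.mul_apply, ha, hb]
      add_mem' := fun {a b} ha hb m => by
        rw [Prod.fst_add, Prod.snd_add, LinearMap.add_apply, LinearMap.add_apply, map_add, ha, hb]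
      algebraMap_mem' := fun r m => map_smul φ r m }
  let ρT : L →ₗ⁅k⁆ T :=
    { toFun := fun x => ⟨(ρ x, ρ' x), hφ x⟩
      map_add' := fun x y => Subtype.ext (Prod.ext (map_add ρ x y) (map_add ρ' x y))
      map_smul' := fun a x => Subtype.ext (Prod.ext (map_smul ρ a x) (map_smul ρ' a x))
      map_lie' := fun {x y} =>
        Subtype.ext (Prod.ext (LieHom.map_lie ρ x y) (LieHom.map_lie ρ' x y)) }
  have h1 : lift k ρ = ((AlgHom.fst k _ _).comp T.val).comp (lift k ρT) := by
    apply hom_ext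
    ext1 x
    simp [LieHom.comp_apply, ρT]
  have h2 : lift k ρ' = ((AlgHom.snd k _ _).comp T.val).comp (lift k ρT) := by
    apply hom_ext
    ext1 x
    simp [LieHom.comp_apply, ρT]
  rw [h1, h2]
  exact (lift k ρT u).2 m

theorem irrAction_mk (lam : J → k) (x : L) (u : UniversalEnvelopingAlgebra k L) :
    irrAction e f lam x (Submodule.Quotient.mk u) =
      Submodule.Quotient.mk (UniversalEnvelopingAlgebra.ι k x * u) := rfl

open UniversalEnvelopingAlgebra in
/-- An irreducible representation with a highest weight vector of weight `lam` is isomorphic to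
`IrrModule e f lam`: the annihilator of the highest weight vector is the largest proper left ideal
containing the Verma ideal. Indeed, if a proper left ideal `N` did not annihilate `v`, then some
`n ∈ N` would fix `v`, and in the submodule of `M × U / N` generated by `(v, 1)` the vectors
`(v, 1)` and `n (v, 1) = (v, 0)` would both have depth zero. -/
theorem IsHighest.exists_irrModule_equiv [Fintype J] [CharZero k] (S : ChevalleySystem e f A c)
    {ρ : L →ₗ⁅k⁆ Module.End k M} (hρ : IsSimpleRep ρ) {lam : J → k} {v : M}
    (hv : IsHighest ρ e f lam v) (hv0 : v ≠ 0) :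
    ∃ φ : IrrModule e f lam ≃ₗ[k] M, (∀ x m, φ (irrAction e f lam x m) = ρ x (φ m)) ∧
      φ (Submodule.Quotient.mk 1) = v := by
  let K : Ideal (UniversalEnvelopingAlgebra k L) :=
    { carrier := {u | lift k ρ u v = 0}
      add_mem' := fun {a b} ha hb => by
        change lift k ρ (a + b) v = 0
        rw [map_add, LinearMap.add_apply, ha, hb, add_zero]
      zero_mem' := by simp
      smul_mem' := fun a b hb => by
        change lift k ρ (a * b) v = 0
        rw [map_mul, Module.End.mul_apply, hb, map_zero] }
  have hKv : ∀ u, u ∈ K ↔ lift k ρ u v = 0 := fun u => Iff.rfl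
  have hverma : vermaIdeal e f lam ≤ K := by
    refine Ideal.span_le.2 ?_
    rintro _ (⟨i, rfl⟩ | ⟨i, rfl⟩)
    · change lift k ρ _ v = 0
      rw [lift_ι_apply, hv.e_zero]
    · change lift k ρ _ v = 0
      rw [map_sub, lift_ι_apply, AlgHom.commutes, LinearMap.sub_apply, hv.h_eq,
        Module.algebraMap_end_apply, sub_self]
  have hKtop : K ≠ ⊤ := by
    intro h
    have : (1 : UniversalEnvelopingAlgebra k L) ∈ K := by rw [h]; trivial
    rw [hKv, map_one] at this
    exact hv0 this
  have hmax : maxIdeal e f lam = K := by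
    refine le_antisymm (sSup_le ?_) (le_sSup ⟨hverma, hKtop⟩)
    rintro N ⟨hN, hNtop⟩
    let Nv : Submodule k M :=
      (N.restrictScalars k).map ((LinearMap.applyₗ v).comp (lift k ρ).toLinearMap)
    have hmem : ∀ {m}, m ∈ Nv ↔ ∃ n ∈ N, lift k ρ n v = m := Iff.rfl
    have hst : IsStable ρ Nv := by
      rintro x _ ⟨n, hn, rfl⟩
      refine hmem.2 ⟨ι k x * n, N.mul_mem_left _ hn, ?_⟩
      rw [map_mul, lift_ι_apply]; rfl
    rcases hρ.2 Nv hst with h | h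
    · intro n hn
      have : lift k ρ n v ∈ Nv := hmem.2 ⟨n, hn, rfl⟩
      rwa [h, Submodule.mem_bot] at this
    · exfalso
      obtain ⟨n, hn, hnv⟩ := hmem.1 (h ▸ Submodule.mem_top : v ∈ Nv)
      let σ : L →ₗ⁅k⁆ Module.End k (UniversalEnvelopingAlgebra k L ⧸ N) :=
        ((Algebra.lsmul k k (UniversalEnvelopingAlgebra k L ⧸ N) :
          UniversalEnvelopingAlgebra k L →ₐ[k] _) :
          UniversalEnvelopingAlgebra k L →ₗ⁅k⁆ _).comp (ι k)
      let q : UniversalEnvelopingAlgebra k L ⧸ N := Submodule.Quotient.mk 1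
      have hσ : ∀ x (u : UniversalEnvelopingAlgebra k L),
        σ x (Submodule.Quotient.mk u) = Submodule.Quotient.mk (ι k x * u) := fun _ _ => rfl
      have hq : IsHighest (prodRep ρ σ) e f lam (v, q) := by
        constructor
        · intro i
          rw [prodRep_apply, hv.e_zero, hσ, mul_one,
            (Submodule.Quotient.mk_eq_zero N).2 (hN (Ideal.subset_span (.inl ⟨i, rfl⟩)))]
          rfl
        · intro i
          rw [prodRep_apply, hv.h_eq, hσ, mul_one, Prod.smul_mk]
          refine congrArg (Prod.mk _) ?_
          have : ι k ⁅e i, f i⁆ - algebraMap k _ (lam i) ∈ N :=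
            hN (Ideal.subset_span (.inr ⟨i, rfl⟩))
          rw [(Submodule.Quotient.eq N).2 this, Algebra.algebraMap_eq_smul_one]
          rfl
      obtain ⟨P, hst, -, -, -, hP, -⟩ := hq.exists_lower S
      have hlift : ∀ u,
          lift k (prodRep ρ σ) u (v, q) = (lift k ρ u v, Submodule.Quotient.mk u) := by
        have h2 : ∀ (u : UniversalEnvelopingAlgebra k L) (w : UniversalEnvelopingAlgebra k L ⧸ N),
            lift k σ u w = u • w := by
          intro u w
          have : lift k σ = Algebra.lsmul k k (UniversalEnvelopingAlgebra k L ⧸ N) := by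
            apply hom_ext; ext1 x; simp [σ]
          rw [this]; rfl
        have h1 : ∀ u (m : M × (UniversalEnvelopingAlgebra k L ⧸ N)),
            lift k (prodRep ρ σ) u m = (lift k ρ u m.1, lift k σ u m.2) := fun u m =>
          Prod.ext (lift_equivariant (LinearMap.fst k _ _) (fun _ _ => rfl) u m)
            (lift_equivariant (LinearMap.snd k _ _) (fun _ _ => rfl) u m)
        intro u
        rw [h1, h2]
        refine congrArg (Prod.mk _) ?_
        change (Submodule.Quotient.mk (u * 1) : UniversalEnvelopingAlgebra k L ⧸ N) = _
        rw [mul_one]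
      have hmemW : (v, (0 : UniversalEnvelopingAlgebra k L ⧸ N)) ∈
          Submodule.span k {(v, q)} ⊔ P := by
        have := lift_mem_of_isStable hst n (v, q)
          (le_sup_left (a := Submodule.span k {(v, q)}) (Submodule.mem_span_singleton_self _))
        rwa [hlift, hnv, (Submodule.Quotient.mk_eq_zero N).2 hn] at this
      have hspan := hP _ hmemW (by
        rw [prodRep_apply, hv.d_eq, map_zero, Prod.smul_mk, smul_zero])
      obtain ⟨a, ha⟩ := Submodule.mem_span_singleton.1 hspan
      have h1 : a • v = v := congrArg Prod.fst ha
      have h2 : a • q = 0 := congrArg Prod.snd ha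
      have ha0 : a ≠ 0 := by
        rintro rfl
        rw [zero_smul] at h1
        exact hv0 h1.symm
      have hq0 : q = 0 := (smul_eq_zero.1 h2).resolve_left ha0
      exact hNtop ((Ideal.eq_top_iff_one N).2 ((Submodule.Quotient.mk_eq_zero N).1 hq0))
  let g : UniversalEnvelopingAlgebra k L →ₗ[k] M := (LinearMap.applyₗ v).comp (lift k ρ).toLinearMap
  have hg : ∀ u, g u = lift k ρ u v := fun _ => rfl
  let φ₀ : IrrModule e f lam →ₗ[k] M :=
    { toFun := Quotient.lift g fun a b hab => by
        have : a - b ∈ K := hmax ▸ (Submodule.quotientRel_def _).1 hab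
        rw [hKv, map_sub, LinearMap.sub_apply, sub_eq_zero] at this
        exact this
      map_add' := by
        rintro ⟨a⟩ ⟨b⟩; exact map_add g a b
      map_smul' := by
        rintro r ⟨a⟩; exact map_smul g r a }
  have hφ₀ : ∀ u, φ₀ (Submodule.Quotient.mk u) = lift k ρ u v := fun _ => rfl
  have hinj : Function.Injective φ₀ := by
    rw [← LinearMap.ker_eq_bot, LinearMap.ker_eq_bot']
    intro m hm
    obtain ⟨u, rfl⟩ := Submodule.Quotient.mk_surjective _ m
    rw [Submodule.Quotient.mk_eq_zero, hmax]
    exact hm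
  have heq : ∀ x m, φ₀ (irrAction e f lam x m) = ρ x (φ₀ m) := by
    intro x m
    obtain ⟨u, rfl⟩ := Submodule.Quotient.mk_surjective _ m
    rw [irrAction_mk, hφ₀, hφ₀, map_mul, lift_ι_apply]; rfl
  have hsurj : Function.Surjective φ₀ := by
    rw [← LinearMap.range_eq_top]
    have hv1 : φ₀ (Submodule.Quotient.mk 1) = v := by rw [hφ₀, map_one]; rfl
    refine (hρ.2 _ ?_).resolve_left fun h => hv0 ?_
    · rintro x _ ⟨m, rfl⟩
      exact ⟨_, heq x m⟩
    · have : v ∈ LinearMap.range φ₀ := ⟨_, hv1⟩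
      rwa [h] at this
  refine ⟨LinearEquiv.ofBijective φ₀ ⟨hinj, hsurj⟩, heq, ?_⟩
  change φ₀ _ = v
  rw [hφ₀, map_one]; rfl

end Irr

end HighestWeightTheory

/-! ### Contravariant forms -/

section Contravariant

variable {k : Type*} [Field k] {L : Type*} [LieRing L] [LieAlgebra k L]
  {J : Type*} {e f : J → L} {A : J → J → k} {c : J → k}
  {M : Type*} [AddCommGroup M] [Module k M] {ρ : L →ₗ⁅k⁆ Module.End k M}

/-- A nonzero finite dimensional representation has a highest weight vector: an eigenspace of the
grading element for an eigenvalue `κ` such that `κ + 1` is not an eigenvalue is killed by the `e_i`,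
and the commuting operators `⁅e_i, f_i⁆` have a common eigenvector in it. -/
theorem exists_isHighest [Fintype J] [IsAlgClosed k] [CharZero k] [FiniteDimensional k M]
    [Nontrivial M] (S : ChevalleySystem e f A c) (ρ : L →ₗ⁅k⁆ Module.End k M) :
    ∃ (lam : J → k) (v : M), v ≠ 0 ∧ IsHighest ρ e f lam v := by
  set D := ρ (gradingElement e f c)
  obtain ⟨κ, hκ, hκ1⟩ : ∃ κ, D.HasEigenvalue κ ∧ ¬ D.HasEigenvalue (κ + 1) := by
    by_contra! h
    obtain ⟨κ, hκ⟩ := Module.End.exists_eigenvalue D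
    have hn : ∀ n : ℕ, D.HasEigenvalue (κ + n) := by
      intro n
      induction n with
      | zero => simpa using hκ
      | succ n ih => push_cast; rw [← add_assoc]; exact h _ ih
    exact Set.infinite_of_injective_forall_mem (f := fun n : ℕ => κ + n)
      (fun a b hab => by simpa using hab) hn (Module.End.finite_hasEigenvalue D)
  let 𝒩 : Set (Submodule k M) := {N | N ≠ ⊥ ∧ N ≤ D.eigenspace κ ∧
    ∀ i, ∀ m ∈ N, ρ ⁅e i, f i⁆ m ∈ N}
  have hne : 𝒩.Nonempty := by
    refine ⟨D.eigenspace κ, hκ, le_rfl, fun i m hm => ?_⟩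
    rw [Module.End.mem_eigenspace_iff] at hm ⊢
    change ρ _ _ = _
    rw [rep_swap, S.d_h, map_zero, LinearMap.zero_apply, add_zero]
    change ρ _ (D m) = _
    rw [hm, map_smul]
  obtain ⟨N, ⟨hN0, hNκ, hNh⟩, hmin⟩ := WellFounded.has_min wellFounded_lt 𝒩 hne
  have hscal : ∀ i, ∃ μ : k, ∀ m ∈ N, ρ ⁅e i, f i⁆ m = μ • m := by
    intro i
    have : Nontrivial N := Submodule.nontrivial_iff_ne_bot.2 hN0
    obtain ⟨μ, hμ⟩ := Module.End.exists_eigenvalue ((ρ ⁅e i, f i⁆).restrict (hNh i))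
    obtain ⟨w, hw⟩ := hμ.exists_hasEigenvector
    refine ⟨μ, ?_⟩
    have hw1 : ρ ⁅e i, f i⁆ w = μ • (w : M) := congrArg Subtype.val hw.apply_eq_smul
    have hmem : N ⊓ (ρ ⁅e i, f i⁆).eigenspace μ ∈ 𝒩 := by
      refine ⟨?_, inf_le_left.trans hNκ, fun j m hm => ⟨hNh j m hm.1, ?_⟩⟩
      · intro h
        have : (w : M) ∈ N ⊓ (ρ ⁅e i, f i⁆).eigenspace μ :=
          ⟨w.2, Module.End.mem_eigenspace_iff.2 hw1⟩
        rw [h, Submodule.mem_bot] at this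
        exact hw.2 (Subtype.ext this)
      · have := Module.End.mem_eigenspace_iff.1 hm.2
        refine Module.End.mem_eigenspace_iff.2 ?_
        rw [rep_swap, S.h_h, map_zero, LinearMap.zero_apply, add_zero, this, map_smul]
    have heq : N ⊓ (ρ ⁅e i, f i⁆).eigenspace μ = N := by
      by_contra h
      exact hmin _ hmem (lt_of_le_of_ne inf_le_left h)
    intro m hm
    rw [← heq] at hm
    exact Module.End.mem_eigenspace_iff.1 hm.2
  choose lam hlam using hscal
  obtain ⟨v, hvN, hv0⟩ := N.ne_bot_iff.1 hN0
  refine ⟨lam, v, hv0, fun i => ?_, fun i => hlam i v hvN⟩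
  by_contra h
  refine hκ1 (Module.End.hasEigenvalue_of_hasEigenvector (x := ρ (e i) v)
    (Module.End.hasEigenvector_iff.2 ⟨Module.End.mem_eigenspace_iff.2 ?_, h⟩))
  change ρ _ _ = _
  rw [rep_swap, S.d_e]
  change ρ (e i) (D v) + _ = _
  rw [Module.End.mem_eigenspace_iff.1 (hNκ hvN), map_smul, add_smul, one_smul]

/-- The dual of a representation, twisted by an endomorphism `ω` of the Lie algebra. -/
def dualTwist (ρ : L →ₗ⁅k⁆ Module.End k M) (ω : L →ₗ⁅k⁆ L) :
    L →ₗ⁅k⁆ Module.End k (Module.Dual k M) where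
  toFun x := -(ρ (ω x)).dualMap
  map_add' x y := by ext; simp [add_comm]
  map_smul' a x := by ext; simp
  map_lie' {x y} := by
    refine LinearMap.ext fun ξ => LinearMap.ext fun m => ?_
    simp [LieRing.of_associative_ring_bracket]

theorem dualTwist_apply (ω : L →ₗ⁅k⁆ L) (x : L) (ξ : Module.Dual k M) (m : M) :
    dualTwist ρ ω x ξ m = -ξ (ρ (ω x) m) := rfl

variable {ω : L →ₗ⁅k⁆ L}

/-- For the Chevalley involution `ω`, the twisted dual of an irreducible representation is
irreducible. -/
theorem IsSimpleRep.dualTwist [FiniteDimensional k M] (hρ : IsSimpleRep ρ)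
    (hgen : LieSubalgebra.lieSpan k L (Set.range e ∪ Set.range f) = ⊤)
    (hωe : ∀ i, ω (e i) = -f i) (hωf : ∀ i, ω (f i) = -e i) : IsSimpleRep (dualTwist ρ ω) := by
  have := hρ.1
  refine ⟨inferInstance, fun T hT => ?_⟩
  have hst : IsStable ρ T.dualCoannihilator := by
    refine isStable_of_gen hgen (fun i m hm => ?_) fun i m hm => ?_ <;>
    rw [Submodule.mem_dualCoannihilator] at hm ⊢ <;> intro ξ hξ
    · have := hm _ (hT (f i) ξ hξ)
      rwa [dualTwist_apply, hωf, map_neg, LinearMap.neg_apply, map_neg, neg_neg] at this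
    · have := hm _ (hT (e i) ξ hξ)
      rwa [dualTwist_apply, hωe, map_neg, LinearMap.neg_apply, map_neg, neg_neg] at this
  have hT' : T.dualCoannihilator.dualAnnihilator = T :=
    Subspace.dualCoannihilator_dualAnnihilator_eq
  rcases hρ.2 _ hst with h | h
  · right
    rw [← hT', h, Submodule.dualAnnihilator_bot]
  · left
    rw [← hT', h, Submodule.dualAnnihilator_top]

/-- An irreducible finite dimensional representation carries a nondegenerate symmetric
contravariant form: it is isomorphic to its twisted dual, which is irreducible of the same highest
weight. -/
theorem IsSimpleRep.exists_contravariant [Fintype J] [IsAlgClosed k] [CharZero k]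
    [FiniteDimensional k M] (S : ChevalleySystem e f A c)
    (hωe : ∀ i, ω (e i) = -f i) (hωf : ∀ i, ω (f i) = -e i) (hρ : IsSimpleRep ρ) :
    ∃ B : M →ₗ[k] M →ₗ[k] k, (∀ x y, B x y = B y x) ∧
      (∀ i x y, B (ρ (e i) x) y = B x (ρ (f i) y)) ∧ LinearMap.ker B = ⊥ := by
  have := hρ.1
  obtain ⟨lam, v, hv0, hv⟩ := exists_isHighest S ρ
  obtain ⟨P, hst, hPf, hPh, -, -, hP⟩ := hv.exists_lower S
  have hvmem : v ∈ Submodule.span k {v} ⊔ P :=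
    le_sup_left (a := Submodule.span k {v}) (Submodule.mem_span_singleton_self v)
  have htop : Submodule.span k {v} ⊔ P = ⊤ := (hρ.2 _ hst).resolve_left fun h => hv0 <| by
    rwa [h, Submodule.mem_bot] at hvmem
  have hvP : v ∉ P := fun h => hv0 (hP v h (hv.d_eq c))
  obtain ⟨ξ, hξv, hξP⟩ := Submodule.exists_le_ker_of_notMem hvP
  have hωh : ∀ i, ω ⁅e i, f i⁆ = -⁅e i, f i⁆ := by
    intro i; rw [LieHom.map_lie, hωe, hωf, neg_lie, lie_neg, neg_neg, ← lie_skew]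
  have hξ : IsHighest (_root_.dualTwist ρ ω) e f lam ξ := by
    constructor
    · intro i
      ext m
      rw [dualTwist_apply, hωe, map_neg, LinearMap.neg_apply, map_neg, neg_neg]
      exact hξP (hPf i m (by rw [htop]; trivial))
    · intro i
      ext m
      rw [dualTwist_apply, hωh, map_neg, LinearMap.neg_apply, map_neg, neg_neg]
      obtain ⟨w, hw, p, hp, rfl⟩ := Submodule.mem_sup.1 (htop ▸ Submodule.mem_top (x := m))
      obtain ⟨a, rfl⟩ := Submodule.mem_span_singleton.1 hw
      have h1 : ξ p = 0 := hξP hp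
      have h2 : ξ (ρ ⁅e i, f i⁆ p) = 0 := hξP (hPh i p hp)
      rw [map_add, map_smul, map_add, h2, hv.h_eq]
      simp [h1, mul_left_comm]
  have hξ0 : ξ ≠ 0 := by rintro rfl; exact hξv rfl
  obtain ⟨φ, hφ, hφ1⟩ := hv.exists_irrModule_equiv S hρ hv0
  obtain ⟨ψ, hψ, hψ1⟩ := hξ.exists_irrModule_equiv S (hρ.dualTwist S.gen hωe hωf) hξ0
  let Φ : M →ₗ[k] Module.Dual k M := (φ.symm.trans ψ).toLinearMap
  have hΦ : ∀ x m, Φ (ρ x m) = _root_.dualTwist ρ ω x (Φ m) := by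
    intro x m
    change ψ (φ.symm _) = _root_.dualTwist ρ ω x (ψ (φ.symm _))
    rw [← hψ]
    congr 1
    rw [LinearEquiv.symm_apply_eq, hφ, LinearEquiv.apply_symm_apply]
  have hΦe : ∀ i x y, Φ (ρ (e i) x) y = Φ x (ρ (f i) y) := by
    intro i x y
    rw [hΦ, dualTwist_apply, hωe, map_neg, LinearMap.neg_apply, map_neg, neg_neg]
  have hΦf : ∀ i x y, Φ (ρ (f i) x) y = Φ x (ρ (e i) y) := by
    intro i x y
    rw [hΦ, dualTwist_apply, hωf, map_neg, LinearMap.neg_apply, map_neg, neg_neg]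
  have hΦv : Φ v = ξ := by
    change ψ (φ.symm v) = ξ
    rw [← hφ1, LinearEquiv.symm_apply_apply, hψ1]
  let B : M →ₗ[k] M →ₗ[k] k := Φ + LinearMap.flip Φ
  have hB : ∀ x y, B x y = Φ x y + Φ y x := fun _ _ => rfl
  refine ⟨B, fun x y => by rw [hB, hB, add_comm], fun i x y => by rw [hB, hB, hΦe, hΦf], ?_⟩
  refine (hρ.2 _ (isStable_of_gen S.gen (fun i x hx => ?_) fun i x hx => ?_)).resolve_right
    fun h => ?_
  · rw [LinearMap.mem_ker] at hx ⊢
    ext y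
    rw [hB, hΦe, ← hΦf, ← hB, hx]; rfl
  · rw [LinearMap.mem_ker] at hx ⊢
    ext y
    rw [hB, hΦf, ← hΦe, ← hB, hx]; rfl
  · have h1 : v ∈ LinearMap.ker B := by rw [h]; trivial
    have h2 : B v v = 0 := by rw [LinearMap.mem_ker.1 h1]; rfl
    rw [hB, hΦv, ← two_mul] at h2
    exact hξv ((mul_eq_zero.1 h2).resolve_left two_ne_zero)

/-- The restriction of a representation to a stable subspace. -/
def subRep (ρ : L →ₗ⁅k⁆ Module.End k M) (N : Submodule k M) (hN : IsStable ρ N) :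
    L →ₗ⁅k⁆ Module.End k N where
  toFun x := (ρ x).restrict (hN x)
  map_add' x y := by ext; simp
  map_smul' a x := by ext; simp
  map_lie' {x y} := by
    refine LinearMap.ext fun m => Subtype.ext ?_
    simp [LieRing.of_associative_ring_bracket]

theorem isStable_map_subRep {N : Submodule k M} {hN : IsStable ρ N} {N' : Submodule k N}
    (h : IsStable (subRep ρ N hN) N') : IsStable ρ (N'.map N.subtype) := by
  rintro x _ ⟨m, hm, rfl⟩
  exact ⟨_, h x m hm, rfl⟩

theorem isSimpleRep_subRep {N : Submodule k M} (hN : IsStable ρ N) (hN0 : N ≠ ⊥)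
    (hmin : ∀ N', IsStable ρ N' → N' ≤ N → N' ≠ ⊥ → N' = N) : IsSimpleRep (subRep ρ N hN) := by
  refine ⟨Submodule.nontrivial_iff_ne_bot.2 hN0, fun N' h => ?_⟩
  by_cases h0 : N'.map N.subtype = ⊥
  · left
    exact Submodule.map_injective_of_injective N.injective_subtype
      (h0.trans (Submodule.map_bot _).symm)
  · right
    have := hmin _ (isStable_map_subRep h) (Submodule.map_subtype_le N N') h0
    rw [← Submodule.comap_map_eq_of_injective N.injective_subtype N', this,
      Submodule.comap_subtype_self]

/-- A semisimple finite dimensional representation carries a nondegenerate symmetric contravariant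
form. -/
theorem exists_contravariant [Fintype J] [IsAlgClosed k] [CharZero k]
    [FiniteDimensional k M] (S : ChevalleySystem e f A c)
    (hωe : ∀ i, ω (e i) = -f i) (hωf : ∀ i, ω (f i) = -e i)
    (hss : ∀ N : Submodule k M, IsStable ρ N → ∃ N', IsStable ρ N' ∧ IsCompl N N') :
    ∃ B : M →ₗ[k] M →ₗ[k] k, (∀ x y, B x y = B y x) ∧
      (∀ i x y, B (ρ (e i) x) y = B x (ρ (f i) y)) ∧ LinearMap.ker B = ⊥ := by
  -- among the symmetric contravariant forms, one with the smallest kernel is nondegenerate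
  let 𝒦 : Set (Submodule k M) := {K | ∃ B : M →ₗ[k] M →ₗ[k] k, (∀ x y, B x y = B y x) ∧
      (∀ i x y, B (ρ (e i) x) y = B x (ρ (f i) y)) ∧ LinearMap.ker B = K}
  obtain ⟨K, ⟨B, hsymm, hB, rfl⟩, hKmin⟩ := WellFounded.has_min wellFounded_lt 𝒦
    ⟨⊤, 0, by simp, by simp, LinearMap.ker_zero⟩
  refine ⟨B, hsymm, hB, ?_⟩
  by_contra hker
  have hB' : ∀ i x y, B (ρ (f i) x) y = B x (ρ (e i) y) := fun i x y => by
    rw [hsymm, ← hB, hsymm]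
  have hst : IsStable ρ (LinearMap.ker B) := by
    refine isStable_of_gen S.gen (fun i x hx => ?_) fun i x hx => ?_ <;>
    rw [LinearMap.mem_ker] at hx ⊢ <;> ext y
    · rw [hB, hx]; rfl
    · rw [hB', hx]; rfl
  obtain ⟨N, ⟨hN, hNker, hN0⟩, hmin⟩ := WellFounded.has_min wellFounded_lt
    {N : Submodule k M | IsStable ρ N ∧ N ≤ LinearMap.ker B ∧ N ≠ ⊥}
    ⟨_, hst, le_rfl, hker⟩
  have hsimple : IsSimpleRep (subRep ρ N hN) := isSimpleRep_subRep hN hN0 fun N' h1 h2 h3 => by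
    by_contra h
    exact hmin N' ⟨h1, h2.trans hNker, h3⟩ (lt_of_le_of_ne h2 h)
  obtain ⟨C, hC, hcompl⟩ := hss N hN
  obtain ⟨B₁, hsymm₁, hB₁, hker₁⟩ := hsimple.exists_contravariant S hωe hωf
  let p : M →ₗ[k] N := Submodule.projectionOnto N C hcompl
  have hpN : ∀ n : N, p n = n := Submodule.projectionOnto_apply_left hcompl
  have hpC : ∀ x, p x = 0 ↔ x ∈ C := fun x => Submodule.projectionOnto_apply_eq_zero_iff hcompl
  have hp : ∀ x m, p (ρ x m) = subRep ρ N hN x (p m) := by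
    intro x m
    obtain ⟨n, hn, y, hy, rfl⟩ :=
      Submodule.mem_sup.1 (hcompl.sup_eq_top ▸ Submodule.mem_top (x := m))
    have h1 := hpN ⟨n, hn⟩
    have h2 := hpN ⟨_, hN x n hn⟩
    simp only at h1 h2
    rw [map_add, map_add, map_add, h1, h2, (hpC y).2 hy, (hpC _).2 (hC x y hy), add_zero, add_zero]
    rfl
  refine hKmin (LinearMap.ker (B + B₁.compl₁₂ p p)) ⟨_, fun x y => ?_, fun i x y => ?_, rfl⟩
    (lt_of_le_of_ne ?_ ?_)
  · simp [hsymm x y, hsymm₁ (p x)]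
  · simp [hB, hp, hB₁]
  · intro x hx
    have hx' : ∀ y, B x y + B₁ (p x) (p y) = 0 := fun y => LinearMap.congr_fun hx y
    have hpx : p x = 0 := by
      have : B₁ (p x) = 0 := by
        ext y
        have h1 := hx' y
        rw [hsymm, show B y = 0 from hNker y.2, hpN] at h1
        simpa using h1
      have h2 : p x ∈ LinearMap.ker B₁ := this
      rwa [hker₁, Submodule.mem_bot] at h2
    rw [LinearMap.mem_ker]
    ext y
    have := hx' y
    rw [hpx] at this
    simpa using this
  · intro heq
    obtain ⟨n, hn, hn0⟩ := N.ne_bot_iff.1 hN0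
    have hnk : n ∈ LinearMap.ker (B + B₁.compl₁₂ p p) := heq ▸ hNker hn
    have h1 : B₁ ⟨n, hn⟩ = 0 := by
      ext y
      have := LinearMap.congr_fun hnk (y : M)
      have h2 := hpN ⟨n, hn⟩
      simp only at h2
      rw [LinearMap.add_apply, LinearMap.add_apply, show B n = 0 from hNker hn,
        LinearMap.compl₁₂_apply, h2, hpN] at this
      simpa using this
    have h2 : (⟨n, hn⟩ : N) ∈ LinearMap.ker B₁ := h1
    rw [hker₁, Submodule.mem_bot] at h2
    exact hn0 (congrArg Subtype.val h2)

end Contravariant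

/-! ### Unitarizable subspaces -/

section Unitarizable

variable {k : Type*} [Field k] {M : Type*} [AddCommGroup M] [Module k M] {J : Type*}

/-- The finite dimensional subspace `W`, stable under the operators `E_j` and `F_j`, is the image
of a representation with a rational structure, on which the `E_j` and the `F_j` are adjoint to each
other for a positive definite diagonal form. This is expressed by a finite spanning family `w` of
`W`, structure constants `a`, `b` of the `E_j`, `F_j`, and the entries `D` of the form. -/
def IsUnitarizable (E F : J → Module.End k M) (W : Submodule k M) : Prop :=
  ∃ (ι : Type) (_ : Fintype ι) (w : ι → M) (a b : J → ι → ι → ℚ) (D : ι → ℚ),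
    (∀ i, 0 < D i) ∧ (∀ j n m, D n * a j n m = D m * b j m n) ∧
    (∀ j m, E j (w m) = ∑ n, (a j n m : k) • w n) ∧
    (∀ j m, F j (w m) = ∑ n, (b j n m : k) • w n) ∧ Submodule.span k (Set.range w) = W

variable {E F : J → Module.End k M} {W W' : Submodule k M}

theorem IsUnitarizable.finite (h : IsUnitarizable E F W) : Module.Finite k W := by
  obtain ⟨ι, _, w, a, b, D, -, -, -, -, rfl⟩ := h
  exact Module.Finite.span_of_finite k (Set.finite_range w)

theorem IsUnitarizable.stable (h : IsUnitarizable E F W) (j : J) :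
    (∀ y ∈ W, E j y ∈ W) ∧ ∀ y ∈ W, F j y ∈ W := by
  obtain ⟨ι, _, w, a, b, D, -, -, hE, hF, rfl⟩ := h
  have key : ∀ (T : Module.End k M), (∀ m, T (w m) ∈ Submodule.span k (Set.range w)) →
      ∀ y ∈ Submodule.span k (Set.range w), T y ∈ Submodule.span k (Set.range w) := by
    intro T hT
    have : Submodule.span k (Set.range w) ≤ (Submodule.span k (Set.range w)).comap T := by
      rw [Submodule.span_le]
      rintro _ ⟨m, rfl⟩
      exact hT m
    exact this
  refine ⟨key _ fun m => ?_, key _ fun m => ?_⟩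
  · rw [hE]
    exact sum_mem fun n _ => Submodule.smul_mem _ _ (Submodule.subset_span ⟨n, rfl⟩)
  · rw [hF]
    exact sum_mem fun n _ => Submodule.smul_mem _ _ (Submodule.subset_span ⟨n, rfl⟩)

theorem IsUnitarizable.sup (h : IsUnitarizable E F W) (h' : IsUnitarizable E F W') :
    IsUnitarizable E F (W ⊔ W') := by
  obtain ⟨ι, _, w, a, b, D, hD, hab, hE, hF, rfl⟩ := h
  obtain ⟨ι', _, w', a', b', D', hD', hab', hE', hF', rfl⟩ := h'
  refine ⟨ι ⊕ ι', inferInstance, Sum.elim w w',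
    fun j => Sum.elim (fun n => Sum.elim (a j n) 0) (fun n => Sum.elim 0 (a' j n)),
    fun j => Sum.elim (fun n => Sum.elim (b j n) 0) (fun n => Sum.elim 0 (b' j n)),
    Sum.elim D D', ?_, ?_, ?_, ?_, ?_⟩
  · rintro (i | i)
    · exact hD i
    · exact hD' i
  · rintro j (n | n) (m | m) <;> simp [hab, hab']
  · rintro j (m | m) <;> simp [hE, hE']
  · rintro j (m | m) <;> simp [hF, hF']
  · rw [Set.Sum.elim_range, Submodule.span_union]

/-- The tensor product of unitarizable representations is unitarizable, and so is its image under
an equivariant map. -/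
theorem IsUnitarizable.map₂ [CharZero k] {M' M'' : Type*} [AddCommGroup M'] [Module k M']
    [AddCommGroup M''] [Module k M''] {E' F' : J → Module.End k M'} {E'' F'' : J → Module.End k M''}
    {W' : Submodule k M'} (β : M →ₗ[k] M' →ₗ[k] M'')
    (hβE : ∀ j x y, E'' j (β x y) = β (E j x) y + β x (E' j y))
    (hβF : ∀ j x y, F'' j (β x y) = β (F j x) y + β x (F' j y))
    (h : IsUnitarizable E F W) (h' : IsUnitarizable E' F' W') :
    IsUnitarizable E'' F'' (Submodule.map₂ β W W') := by
  classical
  obtain ⟨ι, _, w, a, b, D, hD, hab, hE, hF, rfl⟩ := h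
  obtain ⟨ι', _, w', a', b', D', hD', hab', hE', hF', rfl⟩ := h'
  have key : ∀ (p : ι → ι → ℚ) (p' : ι' → ι' → ℚ) (m : ι × ι'),
      ∑ n : ι × ι', (((if n.2 = m.2 then p n.1 m.1 else 0) +
        (if n.1 = m.1 then p' n.2 m.2 else 0) : ℚ) : k) • β (w n.1) (w' n.2) =
      β (∑ n, (p n m.1 : k) • w n) (w' m.2) + β (w m.1) (∑ n, (p' n m.2 : k) • w' n) := by
    rintro p p' ⟨m, m'⟩
    simp only [Rat.cast_add, add_smul, Finset.sum_add_distrib, apply_ite (Rat.cast : ℚ → k),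
      Rat.cast_zero, ite_smul, zero_smul]
    congr 1
    · rw [Fintype.sum_prod_type]
      simp [map_sum, LinearMap.sum_apply]
    · rw [Fintype.sum_prod_type_right]
      simp [map_sum]
  refine ⟨ι × ι', inferInstance, fun p => β (w p.1) (w' p.2),
    fun j n m => (if n.2 = m.2 then a j n.1 m.1 else 0) + (if n.1 = m.1 then a' j n.2 m.2 else 0),
    fun j n m => (if n.2 = m.2 then b j n.1 m.1 else 0) + (if n.1 = m.1 then b' j n.2 m.2 else 0),
    fun p => D p.1 * D' p.2, fun p => mul_pos (hD _) (hD' _), ?_, ?_, ?_, ?_⟩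
  · rintro j ⟨n, n'⟩ ⟨m, m'⟩
    have h1 := hab j n m
    have h2 := hab' j n' m'
    simp only [eq_comm (a := m'), eq_comm (a := m)]
    by_cases hn : n = m <;> by_cases hn' : n' = m' <;> simp only [hn, hn', if_true, if_false]
    · subst hn; subst hn'; linear_combination (D' n') * h1 + D n * h2
    · subst hn; linear_combination D n * h2
    · subst hn'; linear_combination D' n' * h1
    · simp
  · intro j m
    rw [key, hβE, hE, hE']
  · intro j m
    rw [key, hβF, hF, hF']
  · rw [Submodule.map₂_span_span]
    congr 1
    ext y
    simp [Set.mem_image2]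

/-- A subspace spanned by finitely many vectors killed by all operators is unitarizable. -/
theorem isUnitarizable_of_trivial [Module.Finite k W] (hE : ∀ j, ∀ y ∈ W, E j y = 0)
    (hF : ∀ j, ∀ y ∈ W, F j y = 0) : IsUnitarizable E F W := by
  let b := Module.finBasis k W
  refine ⟨_, inferInstance, fun i => (b i : M), fun _ _ _ => 0, fun _ _ _ => 0, fun _ => 1,
    fun _ => one_pos, by simp, fun j m => ?_, fun j m => ?_, ?_⟩
  · simp [hE j _ (b m).2]
  · simp [hF j _ (b m).2]
  · have := congrArg (Submodule.map W.subtype) b.span_eq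
    rwa [Submodule.map_span, ← Set.range_comp, Submodule.map_top, Submodule.range_subtype] at this

open Matrix in
/-- Let `S` be a set of rational matrices stable under taking adjoints for a positive definite
diagonal form `D`. Then the trace form of the `k`-algebra generated by `S` is nondegenerate, since
`trace (x x^*) > 0` for every nonzero rational matrix `x`. -/
theorem eq_zero_of_trace_mul_eq_zero [CharZero k] {ι : Type*} [Fintype ι] [DecidableEq ι]
    {S : Set (Matrix ι ι ℚ)} {D : ι → ℚ} (hD : ∀ i, 0 < D i)
    (hS : ∀ x ∈ S, diagonal D⁻¹ * xᵀ * diagonal D ∈ S) {x : Matrix ι ι k}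
    (hx : x ∈ Algebra.adjoin k ((fun y : Matrix ι ι ℚ => y.map (Rat.castHom k)) '' S))
    (htr : ∀ y ∈ Algebra.adjoin k ((fun y : Matrix ι ι ℚ => y.map (Rat.castHom k)) '' S),
      (x * y).trace = 0) : x = 0 := by
  have hDD : diagonal D * diagonal D⁻¹ = (1 : Matrix ι ι ℚ) := by
    rw [diagonal_mul_diagonal, ← diagonal_one]
    congr 1
    ext i
    simp [(hD i).ne']
  set 𝒬 := Algebra.adjoin ℚ S with h𝒬
  have hadj : ∀ y ∈ 𝒬, diagonal D⁻¹ * yᵀ * diagonal D ∈ 𝒬 := by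
    intro y hy
    induction hy using Algebra.adjoin_induction with
    | mem y hy => exact Algebra.subset_adjoin (hS y hy)
    | algebraMap r =>
      rw [Algebra.algebraMap_eq_smul_one]
      simp only [transpose_smul, transpose_one, Matrix.mul_smul, Matrix.smul_mul, mul_one]
      rw [diagonal_mul_diagonal]
      have : diagonal (fun i => D⁻¹ i * D i) = (1 : Matrix ι ι ℚ) := by
        rw [← diagonal_one]; congr 1; ext i; simp [(hD i).ne']
      rw [this]
      exact 𝒬.smul_mem (one_mem _) r
    | add y z _ _ hy hz =>
      rw [transpose_add, mul_add, add_mul]; exact add_mem hy hz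
    | mul y z _ _ hy hz =>
      have : diagonal D⁻¹ * (y * z)ᵀ * diagonal D =
          (diagonal D⁻¹ * zᵀ * diagonal D) * (diagonal D⁻¹ * yᵀ * diagonal D) := by
        rw [transpose_mul]
        calc _ = diagonal D⁻¹ * zᵀ * 1 * yᵀ * diagonal D := by simp only [mul_one, mul_assoc]
          _ = _ := by rw [← hDD]; simp only [mul_assoc]
      rw [this]; exact mul_mem hz hy
  have hspan : ∀ y ∈ Algebra.adjoin k ((fun y : Matrix ι ι ℚ => y.map (Rat.castHom k)) '' S),
      y ∈ Submodule.span k ((fun y : Matrix ι ι ℚ => y.map (Rat.castHom k)) '' (𝒬 : Set _)) := by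
    intro y hy
    rw [← Subalgebra.mem_toSubmodule, Algebra.adjoin_eq_span] at hy
    refine Submodule.span_mono ?_ hy
    let Q' : Submonoid (Matrix ι ι k) :=
      𝒬.toSubsemiring.toSubmonoid.map ((Rat.castHom k).mapMatrix : Matrix ι ι ℚ →+* Matrix ι ι k)
    have : Submonoid.closure ((fun y : Matrix ι ι ℚ => y.map (Rat.castHom k)) '' S) ≤ Q' := by
      rw [Submonoid.closure_le]
      rintro _ ⟨y, hy, rfl⟩
      exact ⟨y, Algebra.subset_adjoin hy, rfl⟩
    exact this
  have hcast : ∀ y ∈ 𝒬, y.map (Rat.castHom k) ∈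
      Algebra.adjoin k ((fun y : Matrix ι ι ℚ => y.map (Rat.castHom k)) '' S) := by
    intro y hy
    induction hy using Algebra.adjoin_induction with
    | mem y hy => exact Algebra.subset_adjoin ⟨y, hy, rfl⟩
    | algebraMap r =>
      have : (algebraMap ℚ (Matrix ι ι ℚ) r).map (Rat.castHom k) =
          algebraMap k (Matrix ι ι k) (r : k) := by
        ext i j
        simp only [Matrix.algebraMap_eq_diagonal, map_apply, diagonal_apply]
        split_ifs <;> simp
      rw [this]
      exact Subalgebra.algebraMap_mem _ _
    | add y z _ _ hy hz =>
      rw [Matrix.map_add _ (map_add _)]; exact add_mem hy hz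
    | mul y z _ _ hy hz =>
      rw [Matrix.map_mul]; exact mul_mem hy hz
  -- the coordinates of `x` with respect to a rational basis of `k` lie in the rational algebra
  have hφ : ∀ φ : k →ₗ[ℚ] ℚ, x.map φ ∈ 𝒬 := by
    intro φ
    refine Submodule.span_induction (p := fun x _ => ∀ φ : k →ₗ[ℚ] ℚ, x.map φ ∈ 𝒬)
      ?_ ?_ ?_ ?_ (hspan x hx) φ
    · rintro _ ⟨y, hy, rfl⟩ φ
      have : (y.map (Rat.castHom k)).map φ = φ 1 • y := by
        ext i j
        have := φ.map_smul (y i j) 1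
        rw [Rat.smul_one_eq_cast] at this
        simp [this, mul_comm]
      rw [this]; exact 𝒬.smul_mem hy _
    · intro φ
      rw [Matrix.map_zero _ (map_zero _)]; exact zero_mem _
    · intro y z _ _ hy hz φ
      rw [Matrix.map_add _ (map_add _)]; exact add_mem (hy φ) (hz φ)
    · intro r y _ hy φ
      exact hy (φ.comp (LinearMap.mulLeft ℚ r))
  have hφ0 : ∀ φ : k →ₗ[ℚ] ℚ, x.map φ = 0 := by
    intro φ
    have h1 : ∀ y ∈ 𝒬, (x.map φ * y).trace = 0 := by
      intro y hy
      have h2 := congrArg φ (htr _ (hcast y hy))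
      rw [map_zero] at h2
      rw [← h2]
      simp only [trace, diag_apply, mul_apply, map_sum, map_apply]
      refine Finset.sum_congr rfl fun i _ => Finset.sum_congr rfl fun j _ => ?_
      have := φ.map_smul (y j i) (x i j)
      rw [Rat.smul_def] at this
      rw [mul_comm (y j i : k), smul_eq_mul, mul_comm (y j i)] at this
      exact this.symm
    have h2 := h1 _ (hadj _ (hφ φ))
    have h3 : ∑ i, ∑ j, (x.map φ i j) ^ 2 * (D i / D j) = 0 := by
      rw [← h2]
      simp only [trace, diag_apply, mul_apply (M := x.map φ), Matrix.mul_diagonal,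
        Matrix.diagonal_mul, transpose_apply, Pi.inv_apply]
      refine Finset.sum_congr rfl fun i _ => Finset.sum_congr rfl fun j _ => ?_
      rw [div_eq_mul_inv]; ring
    have hnn : ∀ i j, 0 ≤ (x.map φ i j) ^ 2 * (D i / D j) := fun i j =>
      mul_nonneg (sq_nonneg _) (div_pos (hD i) (hD j)).le
    rw [Finset.sum_eq_zero_iff_of_nonneg fun i _ => Finset.sum_nonneg fun j _ => hnn i j] at h3
    ext i j
    have h4 := h3 i (Finset.mem_univ i)
    rw [Finset.sum_eq_zero_iff_of_nonneg fun j _ => hnn i j] at h4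
    have h5 := h4 j (Finset.mem_univ j)
    exact pow_eq_zero_iff two_ne_zero |>.1
      ((mul_eq_zero.1 h5).resolve_right (div_pos (hD i) (hD j)).ne')
  ext i j
  refine (Module.forall_dual_apply_eq_zero_iff ℚ (x i j)).1 fun φ => ?_
  exact congrFun (congrFun (hφ0 φ) i) j

open Matrix in
/-- The `k`-algebra generated by a set of rational matrices stable under taking adjoints for a
positive definite diagonal form is semisimple: an element of its radical is orthogonal to the whole
algebra for the trace form. -/
theorem isSemisimpleRing_adjoin [CharZero k] {ι : Type*} [Fintype ι] [DecidableEq ι]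
    {S : Set (Matrix ι ι ℚ)} {D : ι → ℚ} (hD : ∀ i, 0 < D i)
    (hS : ∀ x ∈ S, diagonal D⁻¹ * xᵀ * diagonal D ∈ S) :
    IsSemisimpleRing
      (Algebra.adjoin k ((fun y : Matrix ι ι ℚ => y.map (Rat.castHom k)) '' S)) := by
  set 𝒜 := Algebra.adjoin k ((fun y : Matrix ι ι ℚ => y.map (Rat.castHom k)) '' S)
  have : IsArtinianRing 𝒜 := IsArtinianRing.of_finite k 𝒜
  rw [IsArtinianRing.isSemisimpleRing_iff_jacobson, eq_bot_iff]
  intro x hx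
  obtain ⟨n, hn⟩ := IsSemiprimaryRing.isNilpotent (R := 𝒜)
  refine Subtype.ext (eq_zero_of_trace_mul_eq_zero hD hS x.2 fun y hy => ?_)
  have h1 : x * ⟨y, hy⟩ ∈ Ring.jacobson 𝒜 := Ideal.mul_mem_right _ _ hx
  have h2 : (x * ⟨y, hy⟩) ^ n = 0 := by
    have := Ideal.pow_mem_pow h1 n
    rwa [hn] at this
  have h3 : IsNilpotent ((x : Matrix ι ι k) * y) := ⟨n, congrArg Subtype.val h2⟩
  exact (Matrix.isNilpotent_trace_of_isNilpotent h3).eq_zero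

/-- In a unitarizable subspace every stable subspace has a stable complement. -/
theorem IsUnitarizable.exists_compl [CharZero k] (h : IsUnitarizable E F W) {N : Submodule k M}
    (hNW : N ≤ W) (hNE : ∀ j, ∀ y ∈ N, E j y ∈ N) (hNF : ∀ j, ∀ y ∈ N, F j y ∈ N) :
    ∃ N' ≤ W, (∀ j, ∀ y ∈ N', E j y ∈ N') ∧ (∀ j, ∀ y ∈ N', F j y ∈ N') ∧
      N ⊓ N' = ⊥ ∧ N ⊔ N' = W := by
  classical
  obtain ⟨ι, _, w, a, b, D, hD, hab, hE, hF, rfl⟩ := h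
  let S : Set (Matrix ι ι ℚ) :=
    Set.range (fun j => Matrix.of (a j)) ∪ Set.range (fun j => Matrix.of (b j))
  have hS : ∀ x ∈ S, Matrix.diagonal D⁻¹ * x.transpose * Matrix.diagonal D ∈ S := by
    rintro _ (⟨j, rfl⟩ | ⟨j, rfl⟩)
    · refine .inr ⟨j, ?_⟩
      ext n m
      have := hab j m n
      have := (hD n).ne'
      simp only [Matrix.mul_diagonal, Matrix.diagonal_mul, Matrix.transpose_apply, Matrix.of_apply,
        Pi.inv_apply]
      field_simp
      linarith
    · refine .inl ⟨j, ?_⟩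
      ext n m
      have := hab j n m
      have := (hD n).ne'
      simp only [Matrix.mul_diagonal, Matrix.diagonal_mul, Matrix.transpose_apply, Matrix.of_apply,
        Pi.inv_apply]
      field_simp
      linarith
  have hss := isSemisimpleRing_adjoin (k := k) hD hS
  set 𝒜 := Algebra.adjoin k ((fun y : Matrix ι ι ℚ => y.map (Rat.castHom k)) '' S)
  let _ : Module 𝒜 (ι → k) := Module.compHom (ι → k)
    ((Matrix.toLinAlgEquiv' : Matrix ι ι k ≃ₐ[k] _).toAlgHom.comp 𝒜.val).toRingHom
  have hsmul : ∀ (x : 𝒜) (t : ι → k), x • t = Matrix.mulVec (x : Matrix ι ι k) t := fun _ _ => rfl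
  let π : (ι → k) →ₗ[k] M := Fintype.linearCombination k w
  have hπ : ∀ t, π t = ∑ i, t i • w i := fun t => Fintype.linearCombination_apply k w t
  have hπr : LinearMap.range π = Submodule.span k (Set.range w) :=
    Fintype.range_linearCombination k w
  have hint : ∀ (p : ι → ι → ℚ) (T : Module.End k M),
      (∀ m, T (w m) = ∑ n, (p n m : k) • w n) → ∀ t,
      π (Matrix.mulVec ((Matrix.of p).map (Rat.castHom k)) t) = T (π t) := by
    intro p T hT t
    rw [hπ, hπ, map_sum]
    simp only [map_smul, hT, Finset.smul_sum, smul_smul]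
    rw [Finset.sum_comm]
    refine Finset.sum_congr rfl fun n _ => ?_
    rw [← Finset.sum_smul]
    congr 1
    simp [Matrix.mulVec, dotProduct, mul_comm]
  let Eop : J → 𝒜 := fun j => ⟨(Matrix.of (a j)).map (Rat.castHom k),
    Algebra.subset_adjoin ⟨_, .inl ⟨j, rfl⟩, rfl⟩⟩
  let Fop : J → 𝒜 := fun j => ⟨(Matrix.of (b j)).map (Rat.castHom k),
    Algebra.subset_adjoin ⟨_, .inr ⟨j, rfl⟩, rfl⟩⟩
  have hEop : ∀ j t, π (Eop j • t) = E j (π t) := fun j t => hint _ _ (hE j) t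
  have hFop : ∀ j t, π (Fop j • t) = F j (π t) := fun j t => hint _ _ (hF j) t
  have hk : ∀ (r : k) (t : ι → k), algebraMap k 𝒜 r • t = r • t := by
    intro r t
    rw [hsmul]
    change Matrix.mulVec (algebraMap k (Matrix ι ι k) r) t = _
    rw [Algebra.algebraMap_eq_smul_one, Matrix.smul_mulVec, Matrix.one_mulVec]
  let N₁ : Submodule 𝒜 (ι → k) :=
    { carrier := {t | π t ∈ N}
      add_mem' := fun {s t} hs ht => by
        change π _ ∈ N
        rw [map_add]; exact add_mem hs ht
      zero_mem' := by simp
      smul_mem' := by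
        rintro ⟨x, hx⟩ t ht
        induction hx using Algebra.adjoin_induction generalizing t with
        | mem y hy =>
          rcases hy with ⟨_, (⟨j, rfl⟩ | ⟨j, rfl⟩), rfl⟩
          · change π (Eop j • t) ∈ N
            rw [hEop]; exact hNE j _ ht
          · change π (Fop j • t) ∈ N
            rw [hFop]; exact hNF j _ ht
        | algebraMap r =>
          change π (algebraMap k 𝒜 r • t) ∈ N
          rw [hk, map_smul]; exact N.smul_mem _ ht
        | add y z hy hz ihy ihz =>
          change π (Matrix.mulVec (y + z) t) ∈ N
          rw [Matrix.add_mulVec, map_add]; exact add_mem (ihy ht) (ihz ht)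
        | mul y z hy hz ihy ihz =>
          change π (Matrix.mulVec (y * z) t) ∈ N
          rw [← Matrix.mulVec_mulVec]; exact ihy (ihz ht) }
  have hN₁ : ∀ t, t ∈ N₁ ↔ π t ∈ N := fun _ => Iff.rfl
  obtain ⟨C, hC⟩ := exists_isCompl N₁
  let C' : Submodule k (ι → k) :=
    { carrier := C
      add_mem' := C.add_mem
      zero_mem' := C.zero_mem
      smul_mem' := fun r t ht => by rw [← hk]; exact C.smul_mem _ ht }
  refine ⟨C'.map π, ?_, ?_, ?_, ?_, ?_⟩
  · rw [← hπr]; exact LinearMap.map_le_range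
  · rintro j _ ⟨t, ht, rfl⟩
    exact ⟨Eop j • t, C.smul_mem _ ht, hEop j t⟩
  · rintro j _ ⟨t, ht, rfl⟩
    exact ⟨Fop j • t, C.smul_mem _ ht, hFop j t⟩
  · rw [eq_bot_iff]
    rintro _ ⟨h1, t, ht, rfl⟩
    have : t ∈ N₁ ⊓ C := ⟨h1, ht⟩
    rw [hC.inf_eq_bot, Submodule.mem_bot] at this
    rw [this, map_zero]; exact zero_mem _
  · refine le_antisymm (sup_le hNW ?_) ?_
    · rw [← hπr]; exact LinearMap.map_le_range
    · rw [← hπr]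
      rintro _ ⟨t, rfl⟩
      obtain ⟨n, hn, s, hs, rfl⟩ := Submodule.mem_sup.1 (hC.sup_eq_top ▸ Submodule.mem_top (x := t))
      rw [map_add]
      exact add_mem (Submodule.mem_sup_left hn) (Submodule.mem_sup_right ⟨s, hs, rfl⟩)

end Unitarizable

/-! ### Integration of equivariant maps and of invariant pairings -/

section Integration

variable {k : Type*} [Field k]

theorem nilExp_eq_sum {B : Type*} [Ring B] [Algebra k B] {a : B} (ha : IsNilpotent a) {N : ℕ}
    (hN : nilpotencyClass a ≤ N) :
    nilExp (k := k) a = ∑ n ∈ Finset.range N, ((n.factorial : k)⁻¹) • a ^ n := by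
  refine Finset.sum_subset (Finset.range_mono hN) fun n _ hn => ?_
  rw [pow_eq_zero_of_le (by simpa using hn) (pow_nilpotencyClass ha), smul_zero]

theorem nilExp_smul_apply {V : Type*} [AddCommGroup V] [Module k V] {T : Module.End k V} {n N : ℕ}
    (hT : T ^ n = 0) (hn : n ≤ N) (t : k) (v : V) : nilExp (k := k) (t • T) v =
      ∑ i ∈ Finset.range N, t ^ i • ((i.factorial : k)⁻¹ • (T ^ i) v) := by
  have h0 : (t • T) ^ n = 0 := by rw [smul_pow, hT, smul_zero]
  rw [nilExp_eq_sum ⟨n, h0⟩ ((Nat.sInf_le h0).trans hn), LinearMap.sum_apply]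
  refine Finset.sum_congr rfl fun i _ => ?_
  rw [smul_pow, LinearMap.smul_apply, LinearMap.smul_apply, smul_comm]

/-- A vector valued polynomial function over an infinite field vanishes only if its coefficients
do. -/
theorem eq_zero_of_forall_sum_pow_smul_eq_zero [Infinite k] {M : Type*} [AddCommGroup M]
    [Module k M] {N : ℕ} {v : ℕ → M}
    (h : ∀ t : k, ∑ n ∈ Finset.range N, t ^ n • v n = 0) {n : ℕ} (hn : n < N) : v n = 0 := by
  refine (Module.forall_dual_apply_eq_zero_iff k (v n)).1 fun ξ => ?_
  let p : Polynomial k := ∑ n ∈ Finset.range N, Polynomial.monomial n (ξ (v n))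
  have hp : p = 0 := by
    refine Polynomial.funext fun t => ?_
    have := congrArg ξ (h t)
    simp only [map_sum, map_smul, smul_eq_mul, map_zero] at this
    simp only [p, Polynomial.eval_finsetSum, Polynomial.eval_monomial, Polynomial.eval_zero]
    rw [← this]
    exact Finset.sum_congr rfl fun n _ => mul_comm _ _
  have := congrArg (fun q => Polynomial.coeff q n) hp
  simpa [p, Polynomial.finsetSum_coeff, Polynomial.coeff_monomial, hn] using this

variable [CharZero k] {L : Type*} [LieRing L] [LieAlgebra k L] {J : Type*} {x : J → L}
  {M M' : Type*} [AddCommGroup M] [Module k M] [AddCommGroup M'] [Module k M']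
  {ρ : L →ₗ⁅k⁆ Module.End k M} {ρ' : L →ₗ⁅k⁆ Module.End k M'}

theorem integrate_mk (hρ : IsIntegrable x ρ) (w : FreeGroup (J × k)) :
    integrate x ρ (QuotientGroup.mk w : FreeGroup (J × k) ⧸ trivialWords (k := k) x) =
      (wordAction x ρ hρ w : Module.End k M) := by
  unfold integrate
  rw [dif_pos hρ]
  rfl

theorem wordAction_of (hρ : IsIntegrable x ρ) (j : J) (t : k) :
    (wordAction x ρ hρ (FreeGroup.of (j, t)) : Module.End k M) = nilExp (k := k) (t • ρ (x j)) := by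
  simp [wordAction, nilExpUnit]

omit [CharZero k] in
theorem nilExp_intertwine {φ : M →ₗ[k] M'} {a : Module.End k M} {b : Module.End k M'}
    (ha : IsNilpotent a) (hb : IsNilpotent b) (h : ∀ m, φ (a m) = b (φ m)) (m : M) :
    φ (nilExp (k := k) a m) = nilExp (k := k) b (φ m) := by
  have hpow : ∀ n m, φ ((a ^ n) m) = (b ^ n) (φ m) := by
    intro n
    induction n with
    | zero => intro m; rfl
    | succ n ih => intro m; rw [pow_succ, pow_succ, Module.End.mul_apply, ih, h]; rfl
  rw [nilExp_eq_sum ha (le_max_left _ (nilpotencyClass b)),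
    nilExp_eq_sum hb (le_max_right (nilpotencyClass a) _)]
  simp [LinearMap.sum_apply, hpow]

/-- An equivariant map for the Lie algebra is equivariant for the group. -/
theorem integrate_equivariant (hρ : IsIntegrable x ρ) (hρ' : IsIntegrable x ρ') {φ : M →ₗ[k] M'}
    (h : ∀ j m, φ (ρ (x j) m) = ρ' (x j) (φ m)) (g : ChevalleyGroup (k := k) x) (m : M) :
    φ (integrate x ρ g m) = integrate x ρ' g (φ m) := by
  obtain ⟨w, rfl⟩ := QuotientGroup.mk_surjective g
  rw [integrate_mk hρ, integrate_mk hρ']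
  induction w using FreeGroup.induction_on generalizing m with
  | C1 => simp
  | of p =>
    obtain ⟨j, t⟩ := p
    rw [wordAction_of, wordAction_of]
    exact nilExp_intertwine ((hρ.2 j).smul t) ((hρ'.2 j).smul t) (by simp [h]) m
  | inv_of p ih =>
    have h1 := ih ((wordAction x ρ hρ (FreeGroup.of p)⁻¹ : Module.End k M) m)
    rw [map_inv, ← Module.End.mul_apply, Units.mul_inv, Module.End.one_apply] at h1
    rw [h1, map_inv, map_inv, ← Module.End.mul_apply, Units.inv_mul, Module.End.one_apply]
  | mul w₁ w₂ ih₁ ih₂ =>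
    rw [map_mul, map_mul, Units.val_mul, Units.val_mul, Module.End.mul_apply, Module.End.mul_apply,
      ih₁, ih₂]

/-- An equivariant map for the group is equivariant for the root vectors: the one-parameter groups
act by polynomials in the parameter, whose linear coefficients are the root vectors. -/
theorem equivariant_of_integrate (hρ : IsIntegrable x ρ) (hρ' : IsIntegrable x ρ')
    {φ : M →ₗ[k] M'}
    (h : ∀ (g : ChevalleyGroup (k := k) x) m, φ (integrate x ρ g m) = integrate x ρ' g (φ m))
    (j : J) (m : M) : φ (ρ (x j) m) = ρ' (x j) (φ m) := by
  set a := ρ (x j)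
  set b := ρ' (x j)
  obtain ⟨na, hna⟩ := hρ.2 j
  obtain ⟨nb, hnb⟩ := hρ'.2 j
  let N := max (max na nb) 2
  have key := eq_zero_of_forall_sum_pow_smul_eq_zero (k := k) (N := N)
    (v := fun i => φ ((i.factorial : k)⁻¹ • (a ^ i) m) - (i.factorial : k)⁻¹ • (b ^ i) (φ m))
    (fun t => by
      have := h (QuotientGroup.mk (FreeGroup.of (j, t)) :
        FreeGroup (J × k) ⧸ trivialWords (k := k) x) m
      rw [integrate_mk hρ, integrate_mk hρ', wordAction_of, wordAction_of,
        nilExp_smul_apply hna (N := N) (by omega),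
        nilExp_smul_apply hnb (N := N) (by omega), ← sub_eq_zero] at this
      rw [← this, map_sum, ← Finset.sum_sub_distrib]
      exact Finset.sum_congr rfl fun i _ => by rw [map_smul φ (t ^ i), smul_sub])
    (n := 1) (by omega)
  simpa [sub_eq_zero] using key

/-- A pairing invariant under the Lie algebra is invariant under the group. -/
theorem integrate_invariant (hρ : IsIntegrable x ρ) (hρ' : IsIntegrable x ρ')
    {β : M →ₗ[k] M' →ₗ[k] k} (h : ∀ j m y, β (ρ (x j) m) y = -β m (ρ' (x j) y))
    (g : ChevalleyGroup (k := k) x) (m : M) (y : M') :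
    β (integrate x ρ g m) (integrate x ρ' g y) = β m y := by
  obtain ⟨w, rfl⟩ := QuotientGroup.mk_surjective g
  rw [integrate_mk hρ, integrate_mk hρ']
  induction w using FreeGroup.induction_on generalizing m y with
  | C1 => simp
  | of p =>
    obtain ⟨j, t⟩ := p
    have ha : IsNilpotent (t • ρ (x j)) := (hρ.2 j).smul t
    have hb : IsNilpotent (t • ρ' (x j)) := (hρ'.2 j).smul t
    have hpow : ∀ n m y, β (((t • ρ (x j)) ^ n) m) y = β m (((-(t • ρ' (x j))) ^ n) y) := by
      intro n
      induction n with
      | zero => intro m y; rfl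
      | succ n ih =>
        intro m y
        rw [pow_succ, pow_succ', Module.End.mul_apply, ih, Module.End.mul_apply,
          LinearMap.smul_apply, map_smul, LinearMap.smul_apply, h]
        simp
    have hexp : ∀ m y, β (nilExp (k := k) (t • ρ (x j)) m) y =
        β m (nilExp (k := k) (-(t • ρ' (x j))) y) := by
      intro m y
      rw [nilExp_eq_sum ha (le_max_left _ (nilpotencyClass (-(t • ρ' (x j))))),
        nilExp_eq_sum hb.neg (le_max_right (nilpotencyClass (t • ρ (x j))) _)]
      simp only [LinearMap.sum_apply, map_sum, LinearMap.smul_apply, map_smul, hpow]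
    rw [wordAction_of, wordAction_of, hexp, ← Module.End.mul_apply]
    have := (nilExpUnit (k := k) _ hb).inv_val
    change nilExp (k := k) _ * nilExp (k := k) _ = 1 at this
    rw [this, Module.End.one_apply]
  | inv_of p ih =>
    rw [← ih, map_inv, map_inv, ← Module.End.mul_apply, ← Module.End.mul_apply, Units.mul_inv,
      Units.mul_inv, Module.End.one_apply, Module.End.one_apply]
  | mul w₁ w₂ ih₁ ih₂ =>
    rw [map_mul, map_mul, Units.val_mul, Units.val_mul, Module.End.mul_apply, Module.End.mul_apply,
      ih₁, ih₂]

/-- A perfect invariant pairing identifies the first group representation with the dual of the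
second. -/
theorem nonempty_equiv_dual (hρ : IsIntegrable x ρ) (hρ' : IsIntegrable x ρ')
    (β : M ≃ₗ[k] Module.Dual k M') (h : ∀ j m y, β (ρ (x j) m) y = -β m (ρ' (x j) y)) :
    Nonempty ((integrate x ρ).Equiv (integrate x ρ').dual) := by
  refine ⟨Representation.Equiv.mk β fun g => ?_⟩
  refine LinearMap.ext fun m => LinearMap.ext fun y => ?_
  have := integrate_invariant (β := β.toLinearMap) hρ hρ' h g m (integrate x ρ' g⁻¹ y)
  rw [← Module.End.mul_apply, ← map_mul, mul_inv_cancel, map_one, Module.End.one_apply] at this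
  exact this

/-- An isomorphism of Lie algebra representations is one of group representations. -/
theorem nonempty_equiv_of_linearEquiv (hρ : IsIntegrable x ρ) (hρ' : IsIntegrable x ρ')
    (φ : M ≃ₗ[k] M') (h : ∀ j m, φ (ρ (x j) m) = ρ' (x j) (φ m)) :
    Nonempty ((integrate x ρ).Equiv (integrate x ρ')) :=
  ⟨Representation.Equiv.mk φ fun g => LinearMap.ext fun m =>
    integrate_equivariant (φ := φ.toLinearMap) hρ hρ' h g m⟩

end Integration

/-! ### Serre relations in a Lie algebra -/

section Serre

variable {k : Type*} [Field k] {L : Type*} [LieRing L] [LieAlgebra k L]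

open LieAlgebra in
theorem ad_pow_succ_apply (x y : L) (n : ℕ) :
    ((ad k L x) ^ (n + 1)) y = ⁅x, ((ad k L x) ^ n) y⁆ := by
  rw [pow_succ']; rfl

open LieAlgebra in
theorem lie_ad_pow_of_eigenvectors {f h y : L} {a b : k} (hhf : ⁅h, f⁆ = a • f)
    (hhy : ⁅h, y⁆ = b • y) (n : ℕ) :
    ⁅h, ((ad k L f) ^ n) y⁆ = (n * a + b) • ((ad k L f) ^ n) y := by
  induction n with
  | zero => simp [hhy]
  | succ n ih =>
    rw [ad_pow_succ_apply, leibniz_lie, hhf, ih, smul_lie, lie_smul, ← add_smul]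
    congr 1
    push_cast
    ring

open LieAlgebra in
/-- The `sl₂`-computation for a vector `y` killed by `e`: the operator `ad e` maps `(ad f)ⁿ⁺¹ y` to
a multiple of `(ad f)ⁿ y`. -/
theorem lie_ad_pow_succ_of_primitive {e f h y : L} {m : k} (hef : ⁅e, f⁆ = h)
    (hhf : ⁅h, f⁆ = (-2 : k) • f) (hey : ⁅e, y⁆ = 0) (hhy : ⁅h, y⁆ = m • y) (n : ℕ) :
    ⁅e, ((ad k L f) ^ (n + 1)) y⁆ = ((n + 1) * (m - n)) • ((ad k L f) ^ n) y := by
  induction n with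
  | zero =>
    rw [ad_pow_succ_apply, leibniz_lie, hef]
    simp [hhy, hey]
  | succ n ih =>
    rw [ad_pow_succ_apply (n := n + 1), leibniz_lie, hef, lie_ad_pow_of_eigenvectors hhf hhy, ih,
      lie_smul, ← ad_pow_succ_apply, ← add_smul]
    congr 1
    push_cast
    ring

open LieAlgebra in
/-- The Serre element `(ad y_i)^(1 - a_ij) y_j` commutes with all the `x_l`. -/
theorem lie_serre_eq_zero {I : Type*} {A : I → I → ℤ} {x y z : I → L}
    (hxy : ∀ i j, i ≠ j → ⁅x i, y j⁆ = 0) (hxyz : ∀ i, ⁅x i, y i⁆ = z i)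
    (hzy : ∀ i j, ⁅z i, y j⁆ = -((A i j : k) • y j)) (hdiag : ∀ i, A i i = 2)
    (hneg : ∀ i j, i ≠ j → A i j ≤ 0) (hzero : ∀ i j, A i j = 0 → A j i = 0)
    {i j : I} (hij : i ≠ j) (l : I) : ⁅x l, ((ad k L (y i)) ^ (1 - A i j).toNat) (y j)⁆ = 0 := by
  obtain ⟨n, hn⟩ : ∃ n : ℕ, (1 - A i j).toNat = n + 1 :=
    ⟨(-A i j).toNat, by have := hneg i j hij; omega⟩
  have hA : (A i j : k) = -(n : k) := by
    have h1 : A i j = -(n : ℤ) := by have := hneg i j hij; omega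
    rw [h1]; push_cast; rfl
  rw [hn]
  by_cases hl : l = i
  · subst hl
    have := (lie_ad_pow_succ_of_primitive (k := k) (e := x l) (f := y l) (h := z l) (y := y j)
      (m := n) (hxyz l) (by rw [hzy, hdiag]; simp) (hxy l j hij)
      (by rw [hzy, hA]; simp) n)
    rw [this]; simp
  · have hcomm : ∀ n w, ⁅x l, ((ad k L (y i)) ^ n) w⁆ = ((ad k L (y i)) ^ n) ⁅x l, w⁆ := by
      intro n
      induction n with
      | zero => intro w; rfl
      | succ n ih =>
        intro w
        rw [ad_pow_succ_apply, leibniz_lie, hxy l i hl, zero_lie, zero_add, ih, ad_pow_succ_apply]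
    rw [hcomm]
    by_cases hlj : l = j
    · subst hlj
      rw [hxyz, pow_succ, Module.End.mul_apply, ad_apply, ← lie_skew, hzy, neg_neg]
      rcases n with _ | n
      · have : A i l = 0 := by have := hneg i l hij; omega
        rw [hzero i l this]; simp
      · rw [pow_succ, Module.End.mul_apply, map_smul, ad_apply, lie_self]; simp
    · rw [hxy l j hlj, map_zero]

end Serre

/-! ### Homomorphisms and automorphisms of a Kac-Moody algebra -/

namespace KacMoodyAlgebra

variable {k : Type*} [Field k] {I : Type*} [Fintype I] [DecidableEq I] {A : Matrix I I ℤ}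
  {𝔥 : Type*} [AddCommGroup 𝔥] [Module k 𝔥] (R : Realization k A 𝔥)

theorem mk_surjective : Function.Surjective (mk R) :=
  LieSubmodule.Quotient.surjective_mk' R.relIdeal

theorem lie_e_f_same (i : I) : ⁅e R i, f R i⁆ = h R (R.coroot i) := by
  have := mk_relator R (.EF_same i)
  rwa [map_sub, LieHom.map_lie, sub_eq_zero] at this

theorem lie_e_f_ne {i j : I} (hij : i ≠ j) : ⁅e R i, f R j⁆ = 0 := by
  have := mk_relator R (.EF_ne i j hij)
  rwa [LieHom.map_lie] at this

theorem lie_h_h (s t : 𝔥) : ⁅h R s, h R t⁆ = 0 := by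
  have := mk_relator R (.HH s t)
  rwa [LieHom.map_lie] at this

theorem mk_ad_pow (x y : FreeLieAlgebra k (KMGen I 𝔥)) (n : ℕ) :
    mk R (((LieAlgebra.ad k _ x) ^ n) y) = ((LieAlgebra.ad k _ (mk R x)) ^ n) (mk R y) := by
  induction n with
  | zero => rfl
  | succ n ih => rw [ad_pow_succ_apply, LieHom.map_lie, ih, ad_pow_succ_apply]

theorem serre_e {i j : I} (hij : i ≠ j) :
    ((LieAlgebra.ad k _ (e R i)) ^ (1 - A i j).toNat) (e R j) = 0 := by
  have := mk_relator R (.serreE i j hij)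
  rwa [mk_ad_pow] at this

theorem serre_f {i j : I} (hij : i ≠ j) :
    ((LieAlgebra.ad k _ (f R i)) ^ (1 - A i j).toNat) (f R j) = 0 := by
  have := mk_relator R (.serreF i j hij)
  rwa [mk_ad_pow] at this

variable {R}

/-- The universal property of the Kac-Moody algebra. -/
theorem exists_lift {L : Type*} [LieRing L] [LieAlgebra k L] (E F : I → L) (H : 𝔥 →ₗ[k] L)
    (hHH : ∀ s t, ⁅H s, H t⁆ = 0) (hHE : ∀ t j, ⁅H t, E j⁆ = R.root j t • E j)
    (hHF : ∀ t j, ⁅H t, F j⁆ = -(R.root j t • F j))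
    (hEF : ∀ i, ⁅E i, F i⁆ = H (R.coroot i)) (hEF' : ∀ i j, i ≠ j → ⁅E i, F j⁆ = 0)
    (hE : ∀ i j, i ≠ j → ((LieAlgebra.ad k _ (E i)) ^ (1 - A i j).toNat) (E j) = 0)
    (hF : ∀ i j, i ≠ j → ((LieAlgebra.ad k _ (F i)) ^ (1 - A i j).toNat) (F j) = 0) :
    ∃ φ : KacMoodyAlgebra R →ₗ⁅k⁆ L, (∀ i, φ (e R i) = E i) ∧ (∀ i, φ (f R i) = F i) ∧
      ∀ t, φ (h R t) = H t := by
  let g : KMGen I 𝔥 → L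
    | .H t => H t
    | .E i => E i
    | .F i => F i
  let ψ : FreeLieAlgebra k (KMGen I 𝔥) →ₗ⁅k⁆ L := FreeLieAlgebra.lift k g
  have hψH : ∀ t, ψ (genH k I t) = H t := fun t => FreeLieAlgebra.lift_of_apply g _
  have hψE : ∀ i, ψ (genE k 𝔥 i) = E i := fun i => FreeLieAlgebra.lift_of_apply g _
  have hψF : ∀ i, ψ (genF k 𝔥 i) = F i := fun i => FreeLieAlgebra.lift_of_apply g _
  have hpow : ∀ x y n, ψ (((LieAlgebra.ad k _ x) ^ n) y) =
      ((LieAlgebra.ad k _ (ψ x)) ^ n) (ψ y) := by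
    intro x y n
    induction n with
    | zero => rfl
    | succ n ih => rw [ad_pow_succ_apply, LieHom.map_lie, ih, ad_pow_succ_apply]
  have hker : R.relIdeal ≤ ψ.ker := by
    refine LieSubmodule.lieSpan_le.2 ?_
    intro x hx
    rw [SetLike.mem_coe, LieHom.mem_ker]
    cases hx with
    | add s t => rw [map_sub, map_sub, hψH, hψH, hψH, map_add]; abel
    | smul c t => rw [map_sub, map_smul, hψH, hψH, map_smul, sub_self]
    | HH s t => rw [LieHom.map_lie, hψH, hψH, hHH]
    | HE t j => rw [map_sub, map_smul, LieHom.map_lie, hψH, hψE, hHE, sub_self]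
    | HF t j => rw [map_add, map_smul, LieHom.map_lie, hψH, hψF, hHF, neg_add_cancel]
    | EF_same i => rw [map_sub, LieHom.map_lie, hψE, hψF, hψH, hEF, sub_self]
    | EF_ne i j hij => rw [LieHom.map_lie, hψE, hψF, hEF' i j hij]
    | serreE i j hij => rw [hpow, hψE, hψE, hE i j hij]
    | serreF i j hij => rw [hpow, hψF, hψF, hF i j hij]
  let φ₀ : KacMoodyAlgebra R →ₗ[k] L :=
    Submodule.liftQ R.relIdeal.toSubmodule (ψ : FreeLieAlgebra k (KMGen I 𝔥) →ₗ[k] L)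
      fun x hx => LieHom.mem_ker.1 (hker hx)
  have hφ₀ : ∀ x, φ₀ (mk R x) = ψ x := fun x => rfl
  refine ⟨{ φ₀ with
    map_lie' := fun {x y} => ?_ }, fun i => hψE i, fun i => hψF i, fun t => hψH t⟩
  obtain ⟨x, rfl⟩ := mk_surjective R x
  obtain ⟨y, rfl⟩ := mk_surjective R y
  change φ₀ ⁅mk R x, mk R y⁆ = ⁅φ₀ (mk R x), φ₀ (mk R y)⁆
  rw [← LieHom.map_lie, hφ₀, hφ₀, hφ₀, LieHom.map_lie]

theorem eq_top_of_generators {K : LieSubalgebra k (KacMoodyAlgebra R)} (he : ∀ i, e R i ∈ K)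
    (hf : ∀ i, f R i ∈ K) (hh : ∀ t, h R t ∈ K) : K = ⊤ := by
  let g : KMGen I 𝔥 → K
    | .H t => ⟨_, hh t⟩
    | .E i => ⟨_, he i⟩
    | .F i => ⟨_, hf i⟩
  have : mk R = K.incl.comp (FreeLieAlgebra.lift k g) := by
    apply FreeLieAlgebra.hom_ext
    intro x
    rw [LieHom.comp_apply, FreeLieAlgebra.lift_of_apply]
    cases x <;> rfl
  rw [eq_top_iff]
  intro y _
  obtain ⟨x, rfl⟩ := mk_surjective R y
  rw [this]
  exact (FreeLieAlgebra.lift k g x).2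

theorem hom_ext {L : Type*} [LieRing L] [LieAlgebra k L] {φ ψ : KacMoodyAlgebra R →ₗ⁅k⁆ L}
    (he : ∀ i, φ (e R i) = ψ (e R i)) (hf : ∀ i, φ (f R i) = ψ (f R i))
    (hh : ∀ t, φ (h R t) = ψ (h R t)) (x : KacMoodyAlgebra R) : φ x = ψ x := by
  let K : LieSubalgebra k (KacMoodyAlgebra R) :=
    { carrier := {x | φ x = ψ x}
      add_mem' := fun {x y} hx hy => by
        change φ (x + y) = ψ (x + y)
        rw [map_add, map_add, hx, hy]
      zero_mem' := by simp
      smul_mem' := fun c x hx => by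
        change φ (c • x) = ψ (c • x)
        rw [map_smul, map_smul, hx]
      lie_mem' := fun {x y} hx hy => by
        change φ ⁅x, y⁆ = ψ ⁅x, y⁆
        rw [LieHom.map_lie, LieHom.map_lie, hx, hy] }
  have : x ∈ K := by rw [eq_top_of_generators (K := K) he hf hh]; trivial
  exact this

theorem ad_neg_pow_neg {L : Type*} [LieRing L] [LieAlgebra k L] {x y : L} {n : ℕ}
    (hxy : ((LieAlgebra.ad k L x) ^ n) y = 0) : ((LieAlgebra.ad k L (-x)) ^ n) (-y) = 0 := by
  have h1 : LieAlgebra.ad k L (-x) = -LieAlgebra.ad k L x := map_neg _ x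
  rw [h1, neg_pow, Module.End.mul_apply, map_neg, hxy, neg_zero, map_zero]

variable (R)

theorem exists_chevalleyInvolution : ∃ ω : KacMoodyAlgebra R →ₗ⁅k⁆ KacMoodyAlgebra R,
    (∀ i, ω (e R i) = -f R i) ∧ (∀ i, ω (f R i) = -e R i) ∧ ∀ t, ω (h R t) = -h R t := by
  refine exists_lift (fun i => -f R i) (fun i => -e R i) (-h R) ?_ ?_ ?_ ?_ ?_ ?_ ?_
  · intro s t; simp [lie_h_h]
  · intro t j; simp [h_f]
  · intro t j; simp [h_e]
  · intro i; rw [neg_lie, lie_neg, neg_neg, ← lie_skew, lie_e_f_same]; rfl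
  · intro i j hij; rw [neg_lie, lie_neg, neg_neg, ← lie_skew, lie_e_f_ne R hij.symm, neg_zero]
  · intro i j hij; exact ad_neg_pow_neg (serre_f R hij)
  · intro i j hij; exact ad_neg_pow_neg (serre_e R hij)

/-- The Chevalley involution, with `e_i ↦ -f_i`, `f_i ↦ -e_i` and `t ↦ -t` for `t` in the Cartan
subalgebra. -/
noncomputable def omega : KacMoodyAlgebra R →ₗ⁅k⁆ KacMoodyAlgebra R :=
  (exists_chevalleyInvolution R).choose

@[simp] theorem omega_e (i : I) : omega R (e R i) = -f R i :=
  (exists_chevalleyInvolution R).choose_spec.1 i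

@[simp] theorem omega_f (i : I) : omega R (f R i) = -e R i :=
  (exists_chevalleyInvolution R).choose_spec.2.1 i

@[simp] theorem omega_h (t : 𝔥) : omega R (h R t) = -h R t :=
  (exists_chevalleyInvolution R).choose_spec.2.2 t

@[simp] theorem omega_omega (x : KacMoodyAlgebra R) : omega R (omega R x) = x :=
  hom_ext (φ := (omega R).comp (omega R)) (ψ := LieHom.id) (by simp) (by simp) (by simp) x

/-- The `f_i` act locally nilpotently. -/
theorem exists_ad_f_pow (i : I) (x : KacMoodyAlgebra R) :
    ∃ n : ℕ, ((LieAlgebra.ad k _ (f R i)) ^ n) x = 0 := by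
  rw [← LieSubalgebra.mem_engel_iff]
  have : LieSubalgebra.engel k (f R i) = ⊤ := by
    refine eq_top_of_generators (fun j => ?_) (fun j => ?_) fun t => ?_ <;>
      rw [LieSubalgebra.mem_engel_iff]
    · by_cases hij : j = i
      · subst hij
        refine ⟨3, ?_⟩
        simp only [ad_pow_succ_apply, pow_zero, Module.End.one_apply]
        rw [← lie_skew (f R j) (e R j), lie_e_f_same, lie_neg, ← lie_skew (f R j) (h R _), h_f]
        simp
      · refine ⟨1, ?_⟩
        rw [pow_one, LieAlgebra.ad_apply, ← lie_skew, lie_e_f_ne R hij, neg_zero]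
    · by_cases hij : i = j
      · exact ⟨1, by rw [hij, pow_one, LieAlgebra.ad_apply, lie_self]⟩
      · exact ⟨_, serre_f R hij⟩
    · refine ⟨2, ?_⟩
      simp only [ad_pow_succ_apply, pow_zero, Module.End.one_apply]
      rw [← lie_skew (f R i) (h R _), h_f]
      simp
  rw [this]; trivial

theorem omega_ad_pow (x y : KacMoodyAlgebra R) (n : ℕ) :
    omega R (((LieAlgebra.ad k _ x) ^ n) y) =
      ((LieAlgebra.ad k _ (omega R x)) ^ n) (omega R y) := by
  induction n with
  | zero => rfl
  | succ n ih => rw [ad_pow_succ_apply, LieHom.map_lie, ih, ad_pow_succ_apply]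

/-- The `e_i` act locally nilpotently. -/
theorem exists_ad_e_pow (i : I) (x : KacMoodyAlgebra R) :
    ∃ n : ℕ, ((LieAlgebra.ad k _ (e R i)) ^ n) x = 0 := by
  obtain ⟨n, hn⟩ := exists_ad_f_pow R i (-omega R x)
  refine ⟨n, ?_⟩
  have := congrArg (omega R) (ad_neg_pow_neg hn)
  rwa [omega_ad_pow, map_neg, omega_f, neg_neg, neg_neg, omega_omega, map_zero] at this

end KacMoodyAlgebra

/-! ### The Cartan subalgebra embeds into the Kac-Moody algebra -/

namespace Verma

variable {k : Type*} [Field k] {I : Type*} [Fintype I] [DecidableEq I] {A : Matrix I I ℤ}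
  {𝔥 : Type*} [AddCommGroup 𝔥] [Module k 𝔥] (R : Realization k A 𝔥) (lam : Module.Dual k 𝔥)

/-- The weight of the monomial `f_{w_1} f_{w_2} ⋯ v` of a Verma module of highest weight `lam`. -/
def wt (w : List I) : Module.Dual k 𝔥 := lam - (w.map R.root).sum

/-- The operator `f_i` on the Verma module with basis the words in the `f_i` (for the algebra
without Serre relations). -/
noncomputable def F (k : Type*) [Field k] {I : Type*} (i : I) :
    Module.End k (List I →₀ k) :=
  Finsupp.lmapDomain k k (List.cons i)

/-- The action of the Cartan subalgebra on the Verma module. -/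
noncomputable def H : 𝔥 →ₗ[k] Module.End k (List I →₀ k) where
  toFun t := Finsupp.linearCombination k fun w => wt R lam w t • Finsupp.single w 1
  map_add' s t := by ext; simp [add_smul]
  map_smul' c t := by ext; simp [mul_smul]

/-- The action of `e_i` on the basis of the Verma module. -/
noncomputable def eBasis (i : I) : List I → (List I →₀ k)
  | [] => 0
  | j :: w => F k j (eBasis i w) + if i = j then H R lam (R.coroot i) (Finsupp.single w 1) else 0

/-- The operator `e_i` on the Verma module. -/
noncomputable def E (i : I) : Module.End k (List I →₀ k) :=
  Finsupp.linearCombination k (eBasis R lam i)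

omit [Fintype I] [DecidableEq I] in
theorem F_single (i : I) (w : List I) :
    F k i (Finsupp.single w (1 : k)) = Finsupp.single (i :: w) 1 := by
  simp [F]

theorem H_single (t : 𝔥) (w : List I) : H R lam t (Finsupp.single w (1 : k)) =
    wt R lam w t • Finsupp.single w 1 := by
  simp [H]

theorem E_nil (i : I) : E R lam i (Finsupp.single [] (1 : k)) = 0 := by simp [E, eBasis]

omit [Fintype I] [DecidableEq I] in
theorem end_ext {S T : Module.End k (List I →₀ k)}
    (h : ∀ w, S (Finsupp.single w 1) = T (Finsupp.single w 1)) : S = T :=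
  Finsupp.lhom_ext' fun w => LinearMap.ext_ring (h w)

theorem commutator_E_F (i j : I) :
    E R lam i * F k j - F k j * E R lam i = if i = j then H R lam (R.coroot i) else 0 := by
  refine end_ext fun w => ?_
  rw [LinearMap.sub_apply, Module.End.mul_apply,
    Module.End.mul_apply, F_single]
  simp only [E, Finsupp.linearCombination_single, one_smul, eBasis]
  split_ifs <;> simp

theorem commutator_H_F (t : 𝔥) (j : I) :
    H R lam t * F k j - F k j * H R lam t = -(R.root j t • F k j) := by
  refine end_ext fun w => ?_
  rw [LinearMap.sub_apply, Module.End.mul_apply,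
    Module.End.mul_apply, F_single, H_single, H_single, map_smul, F_single, LinearMap.neg_apply,
    LinearMap.smul_apply, F_single, ← sub_smul, ← neg_smul]
  congr 1
  simp [wt]

theorem commutator_H_H (s t : 𝔥) : H R lam s * H R lam t - H R lam t * H R lam s = 0 := by
  refine end_ext fun w => ?_
  rw [LinearMap.sub_apply, Module.End.mul_apply,
    Module.End.mul_apply, H_single, H_single, map_smul, map_smul, H_single, H_single, smul_comm,
    sub_self, LinearMap.zero_apply]

theorem E_F_apply (i j : I) (x : List I →₀ k) : E R lam i (F k j x) =
    F k j (E R lam i x) + if i = j then H R lam (R.coroot i) x else 0 := by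
  have := LinearMap.congr_fun (commutator_E_F R lam i j) x
  rw [LinearMap.sub_apply, sub_eq_iff_eq_add] at this
  rw [← Module.End.mul_apply, this, add_comm]
  split_ifs <;> rfl

theorem H_F_apply (t : 𝔥) (j : I) (x : List I →₀ k) : H R lam t (F k j x) =
    F k j (H R lam t x) - R.root j t • F k j x := by
  have := LinearMap.congr_fun (commutator_H_F R lam t j) x
  rw [LinearMap.sub_apply, sub_eq_iff_eq_add] at this
  rw [← Module.End.mul_apply, this, LinearMap.neg_apply, LinearMap.smul_apply, Module.End.mul_apply]
  abel

theorem H_H_apply (s t : 𝔥) (x : List I →₀ k) :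
    H R lam s (H R lam t x) = H R lam t (H R lam s x) := by
  have := LinearMap.congr_fun (commutator_H_H R lam s t) x
  rwa [LinearMap.sub_apply, LinearMap.zero_apply, sub_eq_zero] at this

theorem commutator_H_E (t : 𝔥) (i : I) :
    H R lam t * E R lam i - E R lam i * H R lam t = R.root i t • E R lam i := by
  refine end_ext fun w => ?_
  rw [LinearMap.sub_apply, Module.End.mul_apply, Module.End.mul_apply, LinearMap.smul_apply]
  induction w with
  | nil => rw [H_single, map_smul, E_nil]; simp
  | cons j w ih =>
    rw [sub_eq_iff_eq_add] at ih
    rw [← F_single, H_F_apply, E_F_apply, map_add, H_F_apply, map_sub, map_smul, E_F_apply,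
      E_F_apply, ih]
    split_ifs with hij
    · subst hij
      rw [H_H_apply]
      simp only [map_add, map_smul, smul_add]
      abel
    · simp only [map_add, map_smul, map_zero, add_zero]
      abel

/-- The largest subspace without constant terms which is stable under the `e_i` and the Cartan
subalgebra. It is the largest proper submodule of the Verma module. -/
noncomputable def radical : Submodule k (List I →₀ k) :=
  sSup {N | (∀ x ∈ N, x [] = 0) ∧ (∀ i, ∀ x ∈ N, E R lam i x ∈ N) ∧
    ∀ t, ∀ x ∈ N, H R lam t x ∈ N}

theorem le_radical {N : Submodule k (List I →₀ k)} (h0 : ∀ x ∈ N, x [] = 0)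
    (hE : ∀ i, ∀ x ∈ N, E R lam i x ∈ N) (hH : ∀ t, ∀ x ∈ N, H R lam t x ∈ N) :
    N ≤ radical R lam :=
  le_sSup ⟨h0, hE, hH⟩

theorem radical_nil : ∀ x ∈ radical R lam, x [] = 0 := by
  have : radical R lam ≤ LinearMap.ker (Finsupp.lapply (R := k) ([] : List I)) :=
    sSup_le fun N hN x hx => hN.1 x hx
  exact this

theorem radical_E (i : I) : ∀ x ∈ radical R lam, E R lam i x ∈ radical R lam := by
  have : radical R lam ≤ (radical R lam).comap (E R lam i) := sSup_le fun N hN x hx =>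
    le_sSup (a := N) hN (hN.2.1 i x hx)
  exact this

theorem radical_H (t : 𝔥) : ∀ x ∈ radical R lam, H R lam t x ∈ radical R lam := by
  have : radical R lam ≤ (radical R lam).comap (H R lam t) := sSup_le fun N hN x hx =>
    le_sSup (a := N) hN (hN.2.2 t x hx)
  exact this

omit [Fintype I] [DecidableEq I] in
theorem F_nil (i : I) (x : List I →₀ k) : F k i x [] = 0 := by
  have : (Finsupp.lapply (R := k) ([] : List I)).comp (F k i) = 0 := by
    refine Finsupp.lhom_ext' fun w => LinearMap.ext_ring ?_
    simp [F_single]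
  exact LinearMap.congr_fun this x

theorem radical_F (j : I) : ∀ x ∈ radical R lam, F k j x ∈ radical R lam := by
  intro x hx
  have : (radical R lam) ⊔ (radical R lam).map (F k j) ≤ radical R lam := by
    refine le_radical R lam ?_ ?_ ?_
    · intro y hy
      obtain ⟨a, ha, _, ⟨b, hb, rfl⟩, rfl⟩ := Submodule.mem_sup.1 hy
      rw [Finsupp.add_apply, radical_nil R lam a ha, F_nil, add_zero]
    · intro i y hy
      obtain ⟨a, ha, _, ⟨b, hb, rfl⟩, rfl⟩ := Submodule.mem_sup.1 hy
      rw [map_add, E_F_apply]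
      refine add_mem (Submodule.mem_sup_left (radical_E R lam i a ha)) (add_mem
        (Submodule.mem_sup_right ⟨_, radical_E R lam i b hb, rfl⟩) (Submodule.mem_sup_left ?_))
      split_ifs
      · exact radical_H R lam _ b hb
      · exact zero_mem _
    · intro t y hy
      obtain ⟨a, ha, _, ⟨b, hb, rfl⟩, rfl⟩ := Submodule.mem_sup.1 hy
      rw [map_add, H_F_apply]
      exact add_mem (Submodule.mem_sup_left (radical_H R lam t a ha)) (sub_mem
        (Submodule.mem_sup_right ⟨_, radical_H R lam t b hb, rfl⟩)
        (Submodule.smul_mem _ _ (Submodule.mem_sup_right ⟨b, hb, rfl⟩)))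
  exact this (Submodule.mem_sup_right ⟨x, hx, rfl⟩)

variable (hdiag : ∀ i, A i i = 2) (hneg : ∀ i j, i ≠ j → A i j ≤ 0)
  (hzero : ∀ i j, A i j = 0 → A j i = 0)

omit [Fintype I] [DecidableEq I] in
theorem ad_F_pow_nil (i j : I) (n : ℕ) (x : List I →₀ k) :
    ((LieAlgebra.ad k _ (F k i)) ^ n) (F k j) x [] = 0 := by
  induction n generalizing x with
  | zero => exact F_nil j x
  | succ n ih =>
    rw [ad_pow_succ_apply, LieRing.of_associative_ring_bracket, LinearMap.sub_apply,
      Finsupp.sub_apply, Module.End.mul_apply, Module.End.mul_apply, F_nil, ih, sub_zero]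

theorem commutator_H_ad_F_pow (t : 𝔥) (i j : I) (n : ℕ) :
    H R lam t * ((LieAlgebra.ad k _ (F k i)) ^ n) (F k j) -
      ((LieAlgebra.ad k _ (F k i)) ^ n) (F k j) * H R lam t =
      (n * -R.root i t + -R.root j t) • ((LieAlgebra.ad k _ (F k i)) ^ n) (F k j) := by
  refine (LieRing.of_associative_ring_bracket (H R lam t) _).symm.trans
    (lie_ad_pow_of_eigenvectors ?_ ?_ n) <;>
    rw [LieRing.of_associative_ring_bracket, commutator_H_F, neg_smul]

include hdiag hneg hzero

/-- The Serre elements in the `f_i` map the Verma module to its largest proper submodule, because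
they commute with the `e_i`. -/
theorem serre_F_mem {i j : I} (hij : i ≠ j) (x : List I →₀ k) :
    ((LieAlgebra.ad k _ (F k i)) ^ (1 - A i j).toNat) (F k j) x ∈ radical R lam := by
  set θ := ((LieAlgebra.ad k _ (F k i)) ^ (1 - A i j).toNat) (F k j) with hθ
  have hcomm : ∀ l, E R lam l * θ - θ * E R lam l = 0 := fun l =>
    (LieRing.of_associative_ring_bracket _ _).symm.trans <|
    lie_serre_eq_zero (k := k) (A := A) (x := E R lam) (y := F k)
      (z := fun i => H R lam (R.coroot i))
      (fun i j h => by rw [LieRing.of_associative_ring_bracket, commutator_E_F, if_neg h])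
      (fun i => by rw [LieRing.of_associative_ring_bracket, commutator_E_F, if_pos rfl])
      (fun i j => by rw [LieRing.of_associative_ring_bracket, commutator_H_F, R.root_coroot])
      hdiag hneg hzero hij l
  have : LinearMap.range θ ≤ radical R lam := by
    refine le_radical R lam ?_ ?_ ?_
    · rintro _ ⟨y, rfl⟩
      exact ad_F_pow_nil i j _ y
    · rintro l _ ⟨y, rfl⟩
      have := LinearMap.congr_fun (hcomm l) y
      rw [LinearMap.sub_apply, LinearMap.zero_apply,
        sub_eq_zero] at this
      exact ⟨_, this.symm⟩
    · rintro t _ ⟨y, rfl⟩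
      have := LinearMap.congr_fun (commutator_H_ad_F_pow R lam t i j (1 - A i j).toNat) y
      rw [← hθ, LinearMap.sub_apply, LinearMap.smul_apply,
        sub_eq_iff_eq_add] at this
      rw [← Module.End.mul_apply, this]
      exact add_mem (Submodule.smul_mem _ _ ⟨y, rfl⟩) ⟨_, rfl⟩
  exact this ⟨x, rfl⟩

/-- The Serre elements in the `e_i` vanish on the Verma module: they commute with the `f_i` and kill
the highest weight vector. -/
theorem serre_E_eq_zero {i j : I} (hij : i ≠ j) :
    ((LieAlgebra.ad k _ (E R lam i)) ^ (1 - A i j).toNat) (E R lam j) = 0 := by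
  set θ := ((LieAlgebra.ad k _ (E R lam i)) ^ (1 - A i j).toNat) (E R lam j) with hθ
  have hcomm : ∀ l, F k l * θ - θ * F k l = 0 := fun l =>
    (LieRing.of_associative_ring_bracket _ _).symm.trans <|
    lie_serre_eq_zero (k := k) (A := A) (x := F k) (y := E R lam)
      (z := fun i => -H R lam (R.coroot i))
      (fun i j h => by
        rw [← lie_skew, LieRing.of_associative_ring_bracket, commutator_E_F, if_neg h.symm]
        exact LinearMap.ext fun _ => neg_zero)
      (fun i => by rw [← lie_skew, LieRing.of_associative_ring_bracket, commutator_E_F, if_pos rfl])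
      (fun i j => by
        rw [LieRing.of_associative_ring_bracket, ← R.root_coroot]
        refine LinearMap.ext fun x => ?_
        have := LinearMap.congr_fun (commutator_H_E R lam (R.coroot i) j) x
        simp only [LinearMap.sub_apply, LinearMap.neg_apply, LinearMap.smul_apply,
          Module.End.mul_apply, map_neg] at this ⊢
        rw [← this]
        abel) hdiag hneg hzero hij l
  have hnil : ∀ n, ((LieAlgebra.ad k _ (E R lam i)) ^ n) (E R lam j)
      (Finsupp.single ([] : List I) (1 : k)) = 0 := by
    intro n
    induction n with
    | zero => exact E_nil R lam j
    | succ n ih =>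
      rw [ad_pow_succ_apply, LieRing.of_associative_ring_bracket, LinearMap.sub_apply,
        Module.End.mul_apply, Module.End.mul_apply, ih, E_nil, map_zero, map_zero, sub_zero]
  refine end_ext fun w => ?_
  rw [LinearMap.zero_apply]
  induction w with
  | nil => exact hnil _
  | cons l w ih =>
    have := LinearMap.congr_fun (hcomm l) (Finsupp.single w (1 : k))
    rw [LinearMap.sub_apply, LinearMap.zero_apply,
      sub_eq_zero, Module.End.mul_apply, Module.End.mul_apply, ih, map_zero, F_single] at this
    exact this.symm

end Verma

namespace KacMoodyAlgebra

variable {k : Type*} [Field k] {I : Type*} [Fintype I] [DecidableEq I] {A : Matrix I I ℤ}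
  {𝔥 : Type*} [AddCommGroup 𝔥] [Module k 𝔥] (R : Realization k A 𝔥)

open Verma in
/-- The Cartan subalgebra embeds into the Kac-Moody algebra of a generalized Cartan matrix: an
irreducible highest weight module of highest weight `lam` is a module over the Kac-Moody algebra,
and `t` acts by `lam t` on its highest weight vector. -/
theorem h_injective (hdiag : ∀ i, A i i = 2) (hneg : ∀ i j, i ≠ j → A i j ≤ 0)
    (hzero : ∀ i j, A i j = 0 → A j i = 0) : Function.Injective (h R) := by
  rw [← LinearMap.ker_eq_bot, LinearMap.ker_eq_bot']
  intro t ht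
  refine (Module.forall_dual_apply_eq_zero_iff k t).1 fun lam => ?_
  let N := radical R lam
  let E' : I → Module.End k (_ ⧸ N) := fun i => N.mapQ N (E R lam i) (radical_E R lam i)
  let F' : I → Module.End k (_ ⧸ N) := fun i => N.mapQ N (F k i) (radical_F R lam i)
  let H' : 𝔥 →ₗ[k] Module.End k (_ ⧸ N) :=
    { toFun := fun t => N.mapQ N (H R lam t) (radical_H R lam t)
      map_add' := fun s t => by ext; simp
      map_smul' := fun c t => by ext; simp }
  have hE' : ∀ i x, E' i (N.mkQ x) = N.mkQ (E R lam i x) := fun _ _ => rfl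
  have hF' : ∀ i x, F' i (N.mkQ x) = N.mkQ (F k i x) := fun _ _ => rfl
  have hH' : ∀ t x, H' t (N.mkQ x) = N.mkQ (H R lam t x) := fun _ _ => rfl
  have hlie : ∀ {S T : Module.End k (List I →₀ k)} {S' T' : Module.End k (_ ⧸ N)},
      (∀ x, S' (N.mkQ x) = N.mkQ (S x)) → (∀ x, T' (N.mkQ x) = N.mkQ (T x)) →
      ∀ x, (S' * T' - T' * S') (N.mkQ x) = N.mkQ ((S * T - T * S) x) := by
    intro S T S' T' hS hT x
    rw [LinearMap.sub_apply, LinearMap.sub_apply, Module.End.mul_apply, Module.End.mul_apply,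
      Module.End.mul_apply, Module.End.mul_apply, hT, hS, hS, hT, map_sub]
  have hpow : ∀ {S T : Module.End k (List I →₀ k)} {S' T' : Module.End k (_ ⧸ N)},
      (∀ x, S' (N.mkQ x) = N.mkQ (S x)) → (∀ x, T' (N.mkQ x) = N.mkQ (T x)) →
      ∀ n x, ((LieAlgebra.ad k _ S') ^ n) T' (N.mkQ x) =
        N.mkQ (((LieAlgebra.ad k _ S) ^ n) T x) := by
    intro S T S' T' hS hT n
    induction n with
    | zero => exact hT
    | succ n ih =>
      rw [ad_pow_succ_apply, ad_pow_succ_apply, LieRing.of_associative_ring_bracket,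
        LieRing.of_associative_ring_bracket]
      exact hlie hS ih
  have hext : ∀ {S' T' : Module.End k (_ ⧸ N)}, (∀ x, S' (N.mkQ x) = T' (N.mkQ x)) → S' = T' := by
    intro S' T' h
    refine LinearMap.ext fun y => ?_
    obtain ⟨x, rfl⟩ := N.mkQ_surjective y
    exact h x
  obtain ⟨φ, -, -, hφ⟩ := exists_lift (R := R) E' F' H'
    (fun s t => hext fun x => by
      rw [LieRing.of_associative_ring_bracket, hlie (hH' s) (hH' t), commutator_H_H]; simp)
    (fun t j => hext fun x => by
      rw [LieRing.of_associative_ring_bracket, hlie (hH' t) (hE' j), commutator_H_E,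
        LinearMap.smul_apply,
        LinearMap.smul_apply, map_smul, hE'])
    (fun t j => hext fun x => by
      rw [LieRing.of_associative_ring_bracket, hlie (hH' t) (hF' j), commutator_H_F,
        LinearMap.neg_apply,
        LinearMap.neg_apply, LinearMap.smul_apply, LinearMap.smul_apply, map_neg, map_smul, hF'])
    (fun i => hext fun x => by
      rw [LieRing.of_associative_ring_bracket, hlie (hE' i) (hF' i), commutator_E_F, if_pos rfl,
        hH'])
    (fun i j hij => hext fun x => by
      rw [LieRing.of_associative_ring_bracket, hlie (hE' i) (hF' j), commutator_E_F, if_neg hij]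
      simp)
    (fun i j hij => hext fun x => by
      rw [hpow (hE' i) (hE' j), serre_E_eq_zero R lam hdiag hneg hzero hij]; simp)
    (fun i j hij => hext fun x => by
      rw [hpow (hF' i) (hF' j), LinearMap.zero_apply]
      exact (Submodule.Quotient.mk_eq_zero N).2 (serre_F_mem R lam hdiag hneg hzero hij x))
  have h1 : H' t = 0 := by rw [← hφ, ht, map_zero]
  have h2 := hH' t (Finsupp.single [] 1)
  rw [h1, LinearMap.zero_apply, H_single, eq_comm] at h2
  have h3 := radical_nil R lam _ ((Submodule.Quotient.mk_eq_zero N).1 h2)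
  simpa [wt] using h3

end KacMoodyAlgebra

/-! ### The weights of the module of highest weight `ε_1` -/

/-- A combinatorial description of the weight diagram of an irreducible module of highest weight
`ω_1` all of whose weights form a single chain `μ_0, …, μ_N`, where `μ_{m+1} = μ_m - α_{c m}`: the
generator `f_i` maps the `m`-th basis vector to the next one if `i = c m`, and to zero otherwise,
and `e_{c m}` maps the `(m+1)`-st basis vector to `x m` times the `m`-th one. -/
structure WeightChain {ℓ : ℕ} (A : Matrix (Fin ℓ) (Fin ℓ) ℤ) where
  /-- the index of the last weight -/
  N : ℕ
  /-- the simple roots along the chain -/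
  c : ℕ → Fin ℓ
  /-- the structure constants -/
  x : ℕ → ℕ
  x_pos : ∀ m, 0 < x m
  surj : ∀ i, ∃ m < N, c m = i
  weight_zero : ∀ i, (if 0 < N ∧ c 0 = i then (x 0 : ℤ) else 0) = if i.val = 0 then 1 else 0
  weight_sub : ∀ m < N, ∀ i,
    ((if m < N ∧ c m = i then (x m : ℤ) else 0) -
        if 0 < m ∧ c (m - 1) = i then (x (m - 1) : ℤ) else 0) -
      ((if m + 1 < N ∧ c (m + 1) = i then (x (m + 1) : ℤ) else 0) -
        if c m = i then (x m : ℤ) else 0) = A i (c m)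

namespace ModelType

/-- The weights `ε_1, …, ε_{ℓ+1}` in type `A`. -/
def weightChainA {ℓ : ℕ} (h : 1 ≤ ℓ) : WeightChain (ModelType.A.cartan ℓ) where
  N := ℓ
  c m := ⟨if m < ℓ then m else 0, by split_ifs <;> omega⟩
  x _ := 1
  x_pos _ := one_pos
  surj i := ⟨i, i.2, by ext; simp⟩
  weight_zero i := by
    simp only [Fin.ext_iff]
    split_ifs <;> simp <;> omega
  weight_sub m hm i := by
    have := i.2
    simp only [cartan, CartanMatrix.A, Matrix.transpose_apply, Matrix.of_apply, Fin.ext_iff]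
    split_ifs <;> simp <;> omega

/-- The weights `ε_1, …, ε_ℓ, 0, -ε_ℓ, …, -ε_1` in type `B`. -/
def weightChainB {ℓ : ℕ} (h : 2 ≤ ℓ) : WeightChain (ModelType.B.cartan ℓ) where
  N := 2 * ℓ
  c m := ⟨if m < ℓ then m else 2 * ℓ - 1 - m, by split_ifs <;> omega⟩
  x m := if m + 1 = ℓ ∨ m = ℓ then 2 else 1
  x_pos _ := by split_ifs <;> omega
  surj i := ⟨i, by omega, by ext; simp⟩
  weight_zero i := by
    simp only [Fin.ext_iff]
    split_ifs <;> simp <;> omega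
  weight_sub m hm i := by
    have := i.2
    simp only [cartan, CartanMatrix.B, Matrix.transpose_apply, Matrix.of_apply, Fin.ext_iff]
    rcases lt_or_ge (m + 1) ℓ with h1 | h1
    · grind
    · rcases h1.lt_or_eq with h2 | h2 <;> grind

/-- The weights `ε_1, …, ε_ℓ, -ε_ℓ, …, -ε_1` in type `C`. -/
def weightChainC {ℓ : ℕ} (h : 1 ≤ ℓ) : WeightChain (ModelType.C.cartan ℓ) where
  N := 2 * ℓ - 1
  c m := ⟨if m < ℓ then m else 2 * ℓ - 2 - m, by split_ifs <;> omega⟩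
  x _ := 1
  x_pos _ := one_pos
  surj i := ⟨i, by omega, by ext; simp⟩
  weight_zero i := by
    simp only [Fin.ext_iff]
    split_ifs <;> simp <;> omega
  weight_sub m hm i := by
    have := i.2
    simp only [cartan, CartanMatrix.C, Matrix.transpose_apply, Matrix.of_apply, Fin.ext_iff]
    rcases lt_or_ge (m + 1) ℓ with h1 | h1
    · grind
    · rcases h1.lt_or_eq with h2 | h2 <;> grind

/-- The weights of the module of highest weight `ε_1`. -/
def weightChain : (X : ModelType) → (ℓ : ℕ) → X.ValidRank ℓ → WeightChain (X.cartan ℓ)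
  | A, _, h => weightChainA h
  | B, _, h => weightChainB h
  | C, _, h => weightChainC h

end ModelType

namespace WeightChain

variable {ℓ : ℕ} {A : Matrix (Fin ℓ) (Fin ℓ) ℤ} (C : WeightChain A)

/-- The coordinate `⟨α_i^∨, μ_m⟩` of the weight `μ_m`. -/
def weight (m : ℕ) (i : Fin ℓ) : ℤ :=
  (if m < C.N ∧ C.c m = i then (C.x m : ℤ) else 0) -
    if 0 < m ∧ C.c (m - 1) = i then (C.x (m - 1) : ℤ) else 0

theorem weight_zero_eq (i : Fin ℓ) : C.weight 0 i = if i.val = 0 then 1 else 0 := by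
  simp [weight, C.weight_zero]

theorem weight_succ {m : ℕ} (hm : m < C.N) (i : Fin ℓ) :
    C.weight (m + 1) i = C.weight m i - A i (C.c m) := by
  rw [← C.weight_sub m hm i]
  simp [weight]

theorem start (h : 0 < ℓ) : 0 < C.N ∧ C.c 0 = ⟨0, h⟩ ∧ C.x 0 = 1 := by
  have := C.weight_zero ⟨0, h⟩
  rw [if_pos rfl] at this
  split_ifs at this with h1
  swap
  · exact absurd this zero_ne_one
  exact ⟨h1.1, h1.2, by exact_mod_cast this⟩

section

variable {k : Type*} [Field k] [CharZero k]

include C in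
/-- The Cartan matrix is nondegenerate: a linear form on the weights which kills the roots is
constant along the chain, and the weights of the chain add up to zero. -/
theorem eq_zero_of_sum_mul_eq_zero {z : Fin ℓ → k} (hz : ∀ j, ∑ i, z i * (A i j : k) = 0) :
    z = 0 := by
  rcases Nat.eq_zero_or_pos ℓ with rfl | hℓ
  · exact Subsingleton.elim _ _
  obtain ⟨hN, -, -⟩ := C.start hℓ
  let y : ℕ → k := fun m => z (C.c m) * C.x m
  have hw : ∀ m, ∑ i, z i * (C.weight m i : k) =
      (if m < C.N then y m else 0) - if 0 < m then y (m - 1) else 0 := by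
    intro m
    have h1 : ∀ (P : Prop) [Decidable P] (j : Fin ℓ) (n : ℕ),
        ∑ i, z i * ((if P ∧ j = i then (n : ℤ) else 0 : ℤ) : k) = if P then z j * n else 0 := by
      intro P _ j n
      by_cases hP : P
      · simp [hP]
      · simp [hP]
    simp only [weight, Int.cast_sub, mul_sub, Finset.sum_sub_distrib, h1, y]
  have hconst : ∀ m ≤ C.N, ∑ i, z i * (C.weight m i : k) = y 0 := by
    intro m
    induction m with
    | zero => intro _; rw [hw]; simp [hN]
    | succ m ih =>
      intro hm
      rw [← ih (by omega)]
      simp only [C.weight_succ (show m < C.N by omega), Int.cast_sub, mul_sub,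
        Finset.sum_sub_distrib, hz, sub_zero]
  have hy : ∀ m < C.N, y m = (m + 1) * y 0 := by
    intro m
    induction m with
    | zero => simp
    | succ m ih =>
      intro hm
      have h1 := hconst (m + 1) hm.le
      rw [hw, if_pos hm, if_pos (Nat.succ_pos m), Nat.add_sub_cancel, ih (by omega),
        sub_eq_iff_eq_add] at h1
      rw [h1]
      push_cast
      ring
  have h0 : y 0 = 0 := by
    have h1 := hconst C.N le_rfl
    rw [hw, if_neg (lt_irrefl _), if_pos hN, hy _ (by omega), zero_sub] at h1
    have h2 : ((C.N : k) + 1) * y 0 = 0 := by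
      have h3 : ((C.N - 1 : ℕ) : k) + 1 = C.N := by
        rw [← Nat.cast_add_one, Nat.sub_add_cancel hN]
      rw [h3] at h1
      linear_combination -h1
    exact (mul_eq_zero.1 h2).resolve_left (by exact_mod_cast Nat.succ_ne_zero C.N)
  funext i
  obtain ⟨m, hm, rfl⟩ := C.surj i
  have h1 : y m = 0 := by rw [hy m hm, h0, mul_zero]
  exact (mul_eq_zero.1 h1).resolve_right (by exact_mod_cast (C.x_pos m).ne')

include C in
theorem exists_sum_mul_eq (b : Fin ℓ → k) :
    ∃ c : Fin ℓ → k, ∀ j, ∑ i, c i * (A i j : k) = b j := by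
  let T : (Fin ℓ → k) →ₗ[k] (Fin ℓ → k) := (A.map (Int.cast : ℤ → k)).vecMulLinear
  have hT : ∀ z j, T z j = ∑ i, z i * (A i j : k) := fun z j => rfl
  have hinj : Function.Injective T := by
    rw [← LinearMap.ker_eq_bot, LinearMap.ker_eq_bot']
    intro z hz
    exact C.eq_zero_of_sum_mul_eq_zero fun j => by rw [← hT, hz]; rfl
  obtain ⟨c, hc⟩ := (LinearMap.injective_iff_surjective.1 hinj) b
  exact ⟨c, fun j => by rw [← hT, hc]⟩

end

end WeightChain

namespace ModelType

variable (X : ModelType) {ℓ : ℕ}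

theorem cartan_diag (i : Fin ℓ) : X.cartan ℓ i i = 2 := by
  cases X <;> simp [cartan, CartanMatrix.A, CartanMatrix.B, CartanMatrix.C]

theorem cartan_nonpos {i j : Fin ℓ} (h : i ≠ j) : X.cartan ℓ i j ≤ 0 := by
  cases X <;> simp [cartan, CartanMatrix.A, CartanMatrix.B, CartanMatrix.C, h.symm] <;>
    split_ifs <;> simp

theorem cartan_eq_zero_symm {i j : Fin ℓ} (h : X.cartan ℓ i j = 0) : X.cartan ℓ j i = 0 := by
  revert h
  cases X <;> simp only [cartan, CartanMatrix.A, CartanMatrix.B, CartanMatrix.C,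
    Matrix.transpose_apply, Matrix.of_apply, Fin.ext_iff] <;> grind

theorem cartan_succ_ne_zero {i : ℕ} (h : i + 1 < ℓ) :
    X.cartan ℓ ⟨i, by omega⟩ ⟨i + 1, h⟩ ≠ 0 := by
  cases X <;> simp only [cartan, CartanMatrix.A, CartanMatrix.B, CartanMatrix.C,
    Matrix.transpose_apply, Matrix.of_apply, Fin.ext_iff] <;> grind

theorem extendedCartan_diag (i : Fin ℓ ⊕ Fin 2) : X.extendedCartan ℓ i i = 2 := by
  rcases i with i | i
  · exact X.cartan_diag i
  · fin_cases i <;> rfl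

theorem extendedCartan_inr_inr_ne {a b : Fin 2} (h : a ≠ b) :
    X.extendedCartan ℓ (.inr a) (.inr b) = 0 := by
  change (2 : Matrix (Fin 2) (Fin 2) ℤ) a b = 0
  rw [Matrix.ofNat_apply, if_neg h, Nat.cast_zero]

theorem extendedCartan_nonpos {i j : Fin ℓ ⊕ Fin 2} (h : i ≠ j) : X.extendedCartan ℓ i j ≤ 0 := by
  rcases i with i | i <;> rcases j with j | j
  · exact X.cartan_nonpos fun h1 => h (by rw [h1])
  · simp only [extendedCartan, Matrix.fromBlocks_apply₁₂, Matrix.of_apply]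
    split_ifs <;> simp
  · simp only [extendedCartan, Matrix.fromBlocks_apply₂₁, Matrix.of_apply]
    split_ifs <;> simp
  · have : i ≠ j := fun h1 => h (by rw [h1])
    rw [X.extendedCartan_inr_inr_ne this]

theorem extendedCartan_eq_zero_symm {i j : Fin ℓ ⊕ Fin 2} (h : X.extendedCartan ℓ i j = 0) :
    X.extendedCartan ℓ j i = 0 := by
  revert h
  rcases i with i | i <;> rcases j with j | j
  · exact X.cartan_eq_zero_symm
  · simp [extendedCartan]
  · simp [extendedCartan]
  · rcases eq_or_ne i j with rfl | hij
    · exact id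
    · exact fun _ => X.extendedCartan_inr_inr_ne hij.symm

@[simp]
theorem extendedCartan_inl_inl (i j : Fin ℓ) :
    X.extendedCartan ℓ (.inl i) (.inl j) = X.cartan ℓ i j := rfl

@[simp]
theorem extendedCartan_inl_inr (i : Fin ℓ) (a : Fin 2) :
    X.extendedCartan ℓ (.inl i) (.inr a) = if i.val = 0 then -1 else 0 := rfl

@[simp]
theorem extendedCartan_inr_inl (a : Fin 2) (j : Fin ℓ) :
    X.extendedCartan ℓ (.inr a) (.inl j) = if j.val = 0 then -1 else 0 := rfl

variable {X} (k : Type*) [Field k]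

theorem eps_one (hℓ : X.ValidRank ℓ) (h : 0 < ℓ) (i : Fin ℓ) :
    X.eps k ⟨0, h⟩ i = if i.val = 0 then 1 else 0 := by
  cases X <;> simp only [eps, Pi.single_apply, Fin.ext_iff]
  simp only [ValidRank] at hℓ
  rw [if_neg (show ¬ 0 + 1 = ℓ by omega)]

theorem eps_two (h : 1 < ℓ) (i : Fin ℓ) : X.eps k ⟨1, h⟩ i =
    (if i.val = 0 then 2 else 0) - (X.cartan ℓ i ⟨0, by omega⟩ : k) := by
  cases X <;> simp only [eps, Pi.single_apply, Fin.ext_iff, cartan, CartanMatrix.A, CartanMatrix.B,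
    CartanMatrix.C, Matrix.transpose_apply, Matrix.of_apply] <;> split_ifs <;>
    first | (exfalso; omega) | (simp; done) | grind

end ModelType

/-! ### Modules with a chain of weights -/

section Chain

open LieAlgebra

variable {k : Type*} [Field k] [CharZero k] {L : Type*} [LieRing L] [LieAlgebra k L]

/-- A locally nilpotent `f` of an `𝔰𝔩₂`-triple kills no highest weight vector but those of dominant
weight: an `e`-primitive vector of negative weight vanishes. -/
theorem eq_zero_of_primitive_of_neg {e f h y : L} {m : ℤ} (hm : m < 0) (hef : ⁅e, f⁆ = h)
    (hhf : ⁅h, f⁆ = (-2 : k) • f) (hey : ⁅e, y⁆ = 0) (hhy : ⁅h, y⁆ = (m : k) • y)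
    (hnil : ∃ n : ℕ, ((ad k L f) ^ n) y = 0) : y = 0 := by
  obtain ⟨n, hn⟩ := hnil
  induction n with
  | zero => exact hn
  | succ n ih =>
    refine ih ?_
    have h1 := lie_ad_pow_succ_of_primitive hef hhf hey hhy n
    rw [hn, lie_zero] at h1
    refine (smul_eq_zero.1 h1.symm).resolve_left
      (mul_ne_zero (by exact_mod_cast Nat.succ_ne_zero n) ?_)
    rw [sub_ne_zero]
    intro h2
    have : m = (n : ℤ) := by exact_mod_cast h2
    omega

/-- The vectors `w_0 = v` and `w_{m+1} = ⁅f_{c m}, w_m⁆`. -/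
def chainVec {J : Type*} (f : J → L) (c : ℕ → J) (v : L) : ℕ → L
  | 0 => v
  | m + 1 => ⁅f (c m), chainVec f c v m⁆

variable {ℓ : ℕ} {A : Matrix (Fin ℓ) (Fin ℓ) ℤ} (C : WeightChain A) {e f h : Fin ℓ → L} {v : L}

omit [CharZero k] in
theorem chainVec_h (hhf : ∀ i j, ⁅h i, f j⁆ = -((A i j : k) • f j))
    (hhv : ∀ i, ⁅h i, v⁆ = (C.weight 0 i : k) • v) {m : ℕ} (hm : m ≤ C.N) (i : Fin ℓ) :
    ⁅h i, chainVec f C.c v m⁆ = (C.weight m i : k) • chainVec f C.c v m := by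
  induction m with
  | zero => exact hhv i
  | succ m ih =>
    rw [chainVec, leibniz_lie, ih (by omega), hhf, C.weight_succ hm, neg_lie, smul_lie, lie_smul]
    push_cast
    module

/-- The `w_m` span a module in which the `e_i` and the `f_i` act as prescribed by the chain of
weights. -/
theorem chainVec_e_f (hA : ∀ i, A i i = 2) (hef : ∀ i j, i ≠ j → ⁅e i, f j⁆ = 0)
    (hefh : ∀ i, ⁅e i, f i⁆ = h i)
    (hhf : ∀ i j, ⁅h i, f j⁆ = -((A i j : k) • f j))
    (hhv : ∀ i, ⁅h i, v⁆ = (C.weight 0 i : k) • v) (hev : ∀ i, ⁅e i, v⁆ = 0)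
    (hnil : ∀ i x, ∃ n : ℕ, ((ad k L (f i)) ^ n) x = 0) {m : ℕ} (hm : m ≤ C.N) :
    (∀ i, ⁅e i, chainVec f C.c v m⁆ = if 0 < m ∧ C.c (m - 1) = i then
      (C.x (m - 1) : k) • chainVec f C.c v (m - 1) else 0) ∧
    ∀ i, ¬ (m < C.N ∧ C.c m = i) → ⁅f i, chainVec f C.c v m⁆ = 0 := by
  induction m using Nat.strong_induction_on with
  | _ m ih =>
  have hE : ∀ i, ⁅e i, chainVec f C.c v m⁆ = if 0 < m ∧ C.c (m - 1) = i then
      (C.x (m - 1) : k) • chainVec f C.c v (m - 1) else 0 := by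
    intro i
    cases m with
    | zero => simp [chainVec, hev]
    | succ m =>
      obtain ⟨ihe, ihf⟩ := ih m (by omega) (by omega)
      rw [chainVec, leibniz_lie, ihe]
      simp only [Nat.succ_pos, true_and, Nat.add_sub_cancel]
      by_cases hi : C.c m = i
      · subst hi
        rw [if_pos rfl, hefh, chainVec_h C hhf hhv (by omega), WeightChain.weight,
          if_pos ⟨by omega, rfl⟩]
        by_cases hm0 : 0 < m ∧ C.c (m - 1) = C.c m
        · obtain ⟨m, rfl⟩ : ∃ n, m = n + 1 := ⟨m - 1, by omega⟩
          rw [if_pos hm0, if_pos hm0, lie_smul, ← hm0.2]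
          simp only [Nat.add_sub_cancel, chainVec]
          push_cast
          module
        · rw [if_neg hm0, if_neg hm0]
          simp
      · rw [if_neg hi, hef _ _ (Ne.symm hi), zero_lie, zero_add]
        split_ifs with h1
        · rw [lie_smul, (ih (m - 1) (by omega) (by omega)).2, smul_zero]
          rintro ⟨-, h2⟩
          exact hi (h2.symm.trans h1.2)
        · exact lie_zero _
  refine ⟨hE, fun i hi => ?_⟩
  have hw : C.weight m i =
      -(if 0 < m ∧ C.c (m - 1) = i then (C.x (m - 1) : ℤ) else 0) := by
    rw [WeightChain.weight, if_neg hi, zero_sub]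
  refine eq_zero_of_primitive_of_neg (m := C.weight m i - 2) ?_ (hefh i) (by rw [hhf, hA]; simp) ?_
    ?_ (hnil i _)
  · rw [hw]
    split_ifs <;> omega
  · rw [leibniz_lie, hefh, chainVec_h C hhf hhv hm, hw, hE]
    split_ifs with h1
    · obtain ⟨m, rfl⟩ : ∃ n, m = n + 1 := ⟨m - 1, by omega⟩
      obtain ⟨-, rfl⟩ := h1
      rw [lie_smul]
      simp only [Nat.add_sub_cancel, chainVec]
      push_cast
      module
    · simp
  · rw [leibniz_lie, chainVec_h C hhf hhv hm, hhf, hA, lie_smul, neg_lie, smul_lie]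
    push_cast
    module

theorem isUnitarizable_span_chainVec (hA : ∀ i, A i i = 2) (hef : ∀ i j, i ≠ j → ⁅e i, f j⁆ = 0)
    (hefh : ∀ i, ⁅e i, f i⁆ = h i)
    (hhf : ∀ i j, ⁅h i, f j⁆ = -((A i j : k) • f j))
    (hhv : ∀ i, ⁅h i, v⁆ = (C.weight 0 i : k) • v) (hev : ∀ i, ⁅e i, v⁆ = 0)
    (hnil : ∀ i x, ∃ n : ℕ, ((ad k L (f i)) ^ n) x = 0) :
    IsUnitarizable (fun i => ad k L (e i)) (fun i => ad k L (f i))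
      (Submodule.span k (Set.range fun m : Fin (C.N + 1) => chainVec f C.c v m)) := by
  have key := fun (m : Fin (C.N + 1)) =>
    chainVec_e_f (k := k) C hA hef hefh hhf hhv hev hnil (Nat.lt_succ_iff.1 m.2)
  refine ⟨Fin (C.N + 1), inferInstance, fun m => chainVec f C.c v m,
    fun j n m => if n.val + 1 = m.val ∧ C.c n = j then C.x n else 0,
    fun j n m => if m.val + 1 = n.val ∧ C.c m = j then 1 else 0,
    fun n => ∏ i ∈ Finset.range n, (C.x i : ℚ), ?_, ?_, ?_, ?_, rfl⟩
  · exact fun n => Finset.prod_pos fun i _ => by exact_mod_cast C.x_pos i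
  · intro j n m
    beta_reduce
    by_cases h1 : n.val + 1 = m.val ∧ C.c n = j
    · rw [if_pos h1, if_pos h1, ← h1.1, Finset.prod_range_succ, mul_one]
    · rw [if_neg h1, if_neg h1, mul_zero, mul_zero]
  · intro j m
    beta_reduce
    rw [ad_apply, (key m).1 j]
    split_ifs with h1
    · rw [Finset.sum_eq_single ⟨m - 1, by omega⟩]
      · rw [if_pos ⟨by simp only; omega, h1.2⟩]
        simp
      · intro n _ hn
        rw [if_neg, Rat.cast_zero, zero_smul]
        rintro ⟨h2, -⟩
        exact hn (Fin.ext (by simp only; omega))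
      · simp
    · refine (Finset.sum_eq_zero fun n _ => ?_).symm
      rw [if_neg, Rat.cast_zero, zero_smul]
      rintro ⟨h2, h3⟩
      refine h1 ⟨by omega, ?_⟩
      rw [← h2, Nat.add_sub_cancel, h3]
  · intro j m
    beta_reduce
    rw [ad_apply]
    by_cases h1 : m.val < C.N ∧ C.c m = j
    · rw [Finset.sum_eq_single ⟨m + 1, by omega⟩]
      · rw [if_pos ⟨rfl, h1.2⟩]
        simp [chainVec, h1.2]
      · intro n _ hn
        rw [if_neg, Rat.cast_zero, zero_smul]
        rintro ⟨h2, -⟩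
        exact hn (Fin.ext h2.symm)
      · simp
    · rw [(key m).2 j h1]
      refine (Finset.sum_eq_zero fun n _ => ?_).symm
      rw [if_neg, Rat.cast_zero, zero_smul]
      rintro ⟨h2, h3⟩
      exact h1 ⟨by omega, h3⟩

omit [CharZero k] in
theorem IsUnitarizable.map_neg {J M : Type*} [AddCommGroup M] [Module k M]
    {E F : J → Module.End k M} {W : Submodule k M} (hW : IsUnitarizable E F W) (φ : M →ₗ[k] M)
    (hE : ∀ j y, φ (E j y) = -F j (φ y)) (hF : ∀ j y, φ (F j y) = -E j (φ y)) :
    IsUnitarizable E F (W.map φ) := by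
  obtain ⟨ι, _, w, a, b, D, hD, hab, hEw, hFw, rfl⟩ := hW
  refine ⟨ι, inferInstance, fun m => φ (w m), fun j n m => -b j n m, fun j n m => -a j n m, D, hD,
    fun j n m => by rw [mul_neg, mul_neg, hab], fun j m => ?_, fun j m => ?_, ?_⟩
  · rw [← neg_eq_iff_eq_neg.2 (hF j (w m)), hFw, map_sum, ← Finset.sum_neg_distrib]
    simp
  · rw [← neg_eq_iff_eq_neg.2 (hE j (w m)), hEw, map_sum, ← Finset.sum_neg_distrib]
    simp
  · rw [Submodule.map_span, ← Set.range_comp]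
    rfl

omit [CharZero k] in
theorem isUnitarizable_iSup {J M ι : Type*} [AddCommGroup M] [Module k M]
    {E F : J → Module.End k M} {W : ι → Submodule k M} {S : Set ι} (hS : S.Finite)
    (h : ∀ i ∈ S, IsUnitarizable E F (W i)) : IsUnitarizable E F (⨆ i ∈ S, W i) := by
  induction S, hS using Set.Finite.induction_on with
  | empty =>
    rw [iSup_emptyset]
    exact isUnitarizable_of_trivial (by simp) (by simp)
  | @insert i S _ _ ih =>
    rw [iSup_insert]
    exact (h i (.inl rfl)).sup (ih fun j hj => h j (.inr hj))

end Chain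

/-! ### Brackets of subspaces -/

section Bracket

variable {k : Type*} [Field k] {L : Type*} [LieRing L] [LieAlgebra k L]

/-- The Lie bracket as a bilinear map. -/
def lieBilin (k L : Type*) [Field k] [LieRing L] [LieAlgebra k L] : L →ₗ[k] L →ₗ[k] L :=
  (LieAlgebra.ad k L : L →ₗ[k] Module.End k L)

/-- The subspace spanned by the brackets `⁅x, y⁆` with `x ∈ V` and `y ∈ W`. -/
def bracketSpan (V W : Submodule k L) : Submodule k L := Submodule.map₂ (lieBilin k L) V W

theorem lie_mem_bracketSpan {V W : Submodule k L} {x y : L} (hx : x ∈ V) (hy : y ∈ W) :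
    ⁅x, y⁆ ∈ bracketSpan V W :=
  Submodule.apply_mem_map₂ (lieBilin k L) hx hy

theorem bracketSpan_le {V W U : Submodule k L} :
    bracketSpan V W ≤ U ↔ ∀ x ∈ V, ∀ y ∈ W, ⁅x, y⁆ ∈ U :=
  Submodule.map₂_le

/-- The subspace `W` is stable under `ad x`. -/
def AdStable (x : L) (W : Submodule k L) : Prop := ∀ y ∈ W, ⁅x, y⁆ ∈ W

theorem AdStable.bracketSpan {x : L} {V W : Submodule k L} (hV : AdStable x V)
    (hW : AdStable x W) : AdStable x (bracketSpan V W) := by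
  have : _root_.bracketSpan V W ≤ (_root_.bracketSpan V W).comap (LieAlgebra.ad k L x) :=
    bracketSpan_le.2 fun y hy z hz => by
      rw [Submodule.mem_comap, LieAlgebra.ad_apply, leibniz_lie]
      exact add_mem (lie_mem_bracketSpan (hV y hy) hz) (lie_mem_bracketSpan hy (hW z hz))
  exact this

theorem lie_mem_iSup {ι : Sort*} {x : L} {W : ι → Submodule k L} {U : Submodule k L}
    (h : ∀ i, ∀ y ∈ W i, ⁅x, y⁆ ∈ U) : ∀ y ∈ ⨆ i, W i, ⁅x, y⁆ ∈ U := by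
  have : ⨆ i, W i ≤ U.comap (LieAlgebra.ad k L x) := iSup_le fun i y hy => h i y hy
  exact this

theorem lie_mem_span {x : L} {S : Set L} {U : Submodule k L}
    (h : ∀ y ∈ S, ⁅x, y⁆ ∈ U) : ∀ y ∈ Submodule.span k S, ⁅x, y⁆ ∈ U := by
  have : Submodule.span k S ≤ U.comap (LieAlgebra.ad k L x) := Submodule.span_le.2 h
  exact this

theorem lie_mem_sup {x : L} {V W U : Submodule k L} (hV : ∀ y ∈ V, ⁅x, y⁆ ∈ U)
    (hW : ∀ y ∈ W, ⁅x, y⁆ ∈ U) : ∀ y ∈ V ⊔ W, ⁅x, y⁆ ∈ U := by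
  have : V ⊔ W ≤ U.comap (LieAlgebra.ad k L x) := sup_le hV hW
  exact this

theorem AdStable.iSup {ι : Sort*} {x : L} {W : ι → Submodule k L} (h : ∀ i, AdStable x (W i)) :
    AdStable x (⨆ i, W i) :=
  lie_mem_iSup fun i y hy => Submodule.mem_iSup_of_mem i (h i y hy)

theorem AdStable.sup {x : L} {V W : Submodule k L} (hV : AdStable x V) (hW : AdStable x W) :
    AdStable x (V ⊔ W) :=
  lie_mem_sup (fun y hy => Submodule.mem_sup_left (hV y hy))
    fun y hy => Submodule.mem_sup_right (hW y hy)

theorem adStable_of_mem_lieSpan {S : Set L} {W : Submodule k L} (h : ∀ x ∈ S, AdStable x W) :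
    ∀ x ∈ LieSubalgebra.lieSpan k L S, AdStable x W := by
  intro x hx
  induction hx using LieSubalgebra.lieSpan_induction with
  | mem x hx => exact h x hx
  | zero => exact fun y _ => by rw [zero_lie]; exact zero_mem W
  | add x x' _ _ hx hx' => exact fun y hy => by rw [add_lie]; exact add_mem (hx y hy) (hx' y hy)
  | smul c x _ hx => exact fun y hy => by rw [smul_lie]; exact W.smul_mem c (hx y hy)
  | lie x x' _ _ hx hx' =>
    exact fun y hy => by
      rw [lie_lie]
      exact sub_mem (hx _ (hx' y hy)) (hx' _ (hx y hy))

end Bracket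

/-! ### The decomposition of the Kac-Moody algebra under the Levi subalgebra -/

section Decomposition

open KacMoodyAlgebra

variable {k : Type*} [Field k] {X : ModelType} {ℓ : ℕ}
  {𝔥 : Type*} [AddCommGroup 𝔥] [Module k 𝔥] (R : Realization k (X.extendedCartan ℓ) 𝔥)

/-- The Levi subalgebra `𝔤 + 𝔱_K`, as a subspace. -/
noncomputable def levi : Submodule k (KacMoodyAlgebra R) :=
  (leviG R).toSubmodule ⊔ torus R

variable {R}

theorem e_mem_leviG (i : Fin ℓ) : e R (.inl i) ∈ leviG R :=
  LieSubalgebra.subset_lieSpan (.inl ⟨i, rfl⟩)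

theorem f_mem_leviG (i : Fin ℓ) : f R (.inl i) ∈ leviG R :=
  LieSubalgebra.subset_lieSpan (.inr ⟨i, rfl⟩)

theorem h_mem_levi (t : 𝔥) : h R t ∈ levi R := Submodule.mem_sup_right ⟨t, rfl⟩

theorem leviG_le_levi {x : KacMoodyAlgebra R} (hx : x ∈ leviG R) : x ∈ levi R :=
  Submodule.mem_sup_left hx

theorem adStable_leviG {W : Submodule k (KacMoodyAlgebra R)}
    (he : ∀ i : Fin ℓ, AdStable (e R (.inl i)) W) (hf : ∀ i : Fin ℓ, AdStable (f R (.inl i)) W) :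
    ∀ x ∈ leviG R, AdStable x W := by
  refine adStable_of_mem_lieSpan ?_
  rintro _ (⟨i, rfl⟩ | ⟨i, rfl⟩)
  · exact he i
  · exact hf i

theorem adStable_levi {W : Submodule k (KacMoodyAlgebra R)}
    (he : ∀ i : Fin ℓ, AdStable (e R (.inl i)) W) (hf : ∀ i : Fin ℓ, AdStable (f R (.inl i)) W)
    (hh : ∀ t, AdStable (h R t) W) : ∀ x ∈ levi R, AdStable x W := by
  intro x hx y hy
  obtain ⟨a, ha, _, ⟨t, rfl⟩, rfl⟩ := Submodule.mem_sup.1 hx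
  rw [add_lie]
  exact add_mem (adStable_leviG he hf a ha y hy) (hh t y hy)

theorem lie_h_mem_leviG (t : 𝔥) : ∀ x ∈ leviG R, ⁅h R t, x⁆ ∈ leviG R := by
  intro x hx
  induction hx using LieSubalgebra.lieSpan_induction with
  | mem x hx =>
    rcases hx with ⟨i, rfl⟩ | ⟨i, rfl⟩
    · rw [h_e]
      exact (leviG R).smul_mem _ (e_mem_leviG i)
    · rw [h_f]
      exact (leviG R).neg_mem_iff.2 ((leviG R).smul_mem _ (f_mem_leviG i))
  | zero => rw [lie_zero]; exact (leviG R).zero_mem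
  | add x y _ _ hx hy => rw [lie_add]; exact (leviG R).add_mem hx hy
  | smul c x _ hx => rw [lie_smul]; exact (leviG R).smul_mem c hx
  | lie x y hx' hy' hx hy =>
    rw [leibniz_lie]
    exact (leviG R).add_mem ((leviG R).lie_mem hx hy') ((leviG R).lie_mem hx' hy)

theorem adStable_levi_levi : ∀ x ∈ levi R, AdStable x (levi R) := by
  have hG : ∀ x ∈ leviG R, AdStable x (levi R) := fun x hx =>
    lie_mem_sup (fun y hy => leviG_le_levi ((leviG R).lie_mem hx hy)) (by
      rintro _ ⟨t, rfl⟩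
      rw [← lie_skew]
      exact neg_mem (leviG_le_levi (lie_h_mem_leviG t x hx)))
  refine adStable_levi (fun i => hG _ (e_mem_leviG i)) (fun i => hG _ (f_mem_leviG i)) fun t => ?_
  refine lie_mem_sup (fun y hy => leviG_le_levi (lie_h_mem_leviG t y hy)) ?_
  rintro _ ⟨s, rfl⟩
  rw [lie_h_h]
  exact zero_mem _

/-- The basis of weight vectors of the `𝔤`-module generated by the lowest root vector `f_{α_0}`
or `f_{β_0}`. -/
noncomputable def minusVec (R : Realization k (X.extendedCartan ℓ) 𝔥) (C : WeightChain (X.cartan ℓ))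
    (a : Fin 2) (m : ℕ) : KacMoodyAlgebra R :=
  chainVec (fun i : Fin ℓ => f R (.inl i)) C.c (f R (.inr a)) m

/-- The `𝔤`-module generated by `f_{α_0}` or `f_{β_0}`. -/
noncomputable def minusSpace (R : Realization k (X.extendedCartan ℓ) 𝔥)
    (C : WeightChain (X.cartan ℓ)) (a : Fin 2) : Submodule k (KacMoodyAlgebra R) :=
  Submodule.span k (Set.range fun m : Fin (C.N + 1) => minusVec R C a m)

/-- The span of the brackets `⁅x_1, ⁅x_2, … ⁅x_n, y⁆⁆⁆` with `x_i` in the module with lowest root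
vector given by the `i`-th letter of a word, and `y` in the one given by a last letter. -/
noncomputable def wordSpace (R : Realization k (X.extendedCartan ℓ) 𝔥)
    (C : WeightChain (X.cartan ℓ)) : List (Fin 2) → Fin 2 → Submodule k (KacMoodyAlgebra R)
  | [], a => minusSpace R C a
  | b :: w, a => bracketSpan (minusSpace R C b) (wordSpace R C w a)

variable (C : WeightChain (X.cartan ℓ))

theorem minusVec_h (a : Fin 2) (t : 𝔥) (m : ℕ) :
    ∃ s : k, ⁅h R t, minusVec R C a m⁆ = s • minusVec R C a m := by
  induction m with
  | zero => exact ⟨-R.root (.inr a) t, by rw [minusVec, chainVec, h_f, neg_smul]⟩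
  | succ m ih =>
    obtain ⟨s, hs⟩ := ih
    refine ⟨s - R.root (.inl (C.c m)) t, ?_⟩
    change ⁅h R t, ⁅f R (.inl (C.c m)), minusVec R C a m⁆⁆ = _ • ⁅_, minusVec R C a m⁆
    rw [leibniz_lie, hs, h_f, neg_lie, smul_lie, lie_smul]
    module

section

variable [CharZero k]

/-- The generators of `𝔤` act on the vectors `minusVec` as prescribed by the weight chain. -/
theorem minusVec_e_f (a : Fin 2) {m : ℕ} (hm : m ≤ C.N) :
    (∀ i : Fin ℓ, ⁅e R (.inl i), minusVec R C a m⁆ = if 0 < m ∧ C.c (m - 1) = i then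
      (C.x (m - 1) : k) • minusVec R C a (m - 1) else 0) ∧
    ∀ i : Fin ℓ, ¬ (m < C.N ∧ C.c m = i) → ⁅f R (.inl i), minusVec R C a m⁆ = 0 :=
  chainVec_e_f C X.cartan_diag (fun i j hij => lie_e_f_ne R (by simpa using hij))
    (fun i => lie_e_f_same R _) (fun i j => by rw [h_f, R.root_coroot]; rfl)
    (fun i => by
      rw [h_f, R.root_coroot, C.weight_zero_eq, X.extendedCartan_inl_inr, ← neg_smul]
      split_ifs <;> simp)
    (fun i => lie_e_f_ne R (by simp)) (fun i x => exists_ad_f_pow R _ x) hm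

theorem isUnitarizable_minusSpace (a : Fin 2) :
    IsUnitarizable (fun i : Fin ℓ => LieAlgebra.ad k _ (e R (.inl i)))
      (fun i : Fin ℓ => LieAlgebra.ad k _ (f R (.inl i))) (minusSpace R C a) :=
  isUnitarizable_span_chainVec C X.cartan_diag (fun i j hij => lie_e_f_ne R (by simpa using hij))
    (fun i => lie_e_f_same R _) (fun i j => by rw [h_f, R.root_coroot]; rfl)
    (fun i => by
      rw [h_f, R.root_coroot, C.weight_zero_eq, X.extendedCartan_inl_inr, ← neg_smul]
      split_ifs <;> simp)
    (fun i => lie_e_f_ne R (by simp)) (fun i x => exists_ad_f_pow R _ x)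

theorem adStable_levi_minusSpace (a : Fin 2) : ∀ x ∈ levi R, AdStable x (minusSpace R C a) := by
  have h1 := (isUnitarizable_minusSpace (R := R) C a).stable
  refine adStable_levi (fun i => (h1 i).1) (fun i => (h1 i).2) fun t => ?_
  refine lie_mem_span ?_
  rintro _ ⟨m, rfl⟩
  obtain ⟨s, hs⟩ := minusVec_h (R := R) C a t m
  rw [hs]
  exact Submodule.smul_mem _ _ (Submodule.subset_span ⟨m, rfl⟩)

theorem isUnitarizable_bracketSpan {V W : Submodule k (KacMoodyAlgebra R)}
    (hV : IsUnitarizable (fun i : Fin ℓ => LieAlgebra.ad k _ (e R (.inl i)))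
      (fun i : Fin ℓ => LieAlgebra.ad k _ (f R (.inl i))) V)
    (hW : IsUnitarizable (fun i : Fin ℓ => LieAlgebra.ad k _ (e R (.inl i)))
      (fun i : Fin ℓ => LieAlgebra.ad k _ (f R (.inl i))) W) :
    IsUnitarizable (fun i : Fin ℓ => LieAlgebra.ad k _ (e R (.inl i)))
      (fun i : Fin ℓ => LieAlgebra.ad k _ (f R (.inl i))) (bracketSpan V W) := by
  refine IsUnitarizable.map₂ (lieBilin k _) ?_ ?_ hV hW
  · exact fun j x y => leibniz_lie (e R (.inl j)) x y
  · exact fun j x y => leibniz_lie (f R (.inl j)) x y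

theorem isUnitarizable_wordSpace (w : List (Fin 2)) (a : Fin 2) :
    IsUnitarizable (fun i : Fin ℓ => LieAlgebra.ad k _ (e R (.inl i)))
      (fun i : Fin ℓ => LieAlgebra.ad k _ (f R (.inl i))) (wordSpace R C w a) := by
  induction w with
  | nil => exact isUnitarizable_minusSpace C a
  | cons b w ih => exact isUnitarizable_bracketSpan (isUnitarizable_minusSpace C b) ih

omit [CharZero k] in
theorem isUnitarizable_map_omega {W : Submodule k (KacMoodyAlgebra R)}
    (hW : IsUnitarizable (fun i : Fin ℓ => LieAlgebra.ad k _ (e R (.inl i)))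
      (fun i : Fin ℓ => LieAlgebra.ad k _ (f R (.inl i))) W) :
    IsUnitarizable (fun i : Fin ℓ => LieAlgebra.ad k _ (e R (.inl i)))
      (fun i : Fin ℓ => LieAlgebra.ad k _ (f R (.inl i)))
      (W.map (omega R : KacMoodyAlgebra R →ₗ[k] KacMoodyAlgebra R)) := by
  refine hW.map_neg _ ?_ ?_ <;> intro i y <;> simp [LieHom.map_lie]

theorem adStable_levi_wordSpace (w : List (Fin 2)) (a : Fin 2) :
    ∀ x ∈ levi R, AdStable x (wordSpace R C w a) := by
  intro x hx
  induction w with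
  | nil => exact adStable_levi_minusSpace C a x hx
  | cons b w ih => exact (adStable_levi_minusSpace C b x hx).bracketSpan ih

/-- The sum of all the subspaces of brackets. -/
noncomputable def minusSum (R : Realization k (X.extendedCartan ℓ) 𝔥)
    (C : WeightChain (X.cartan ℓ)) : Submodule k (KacMoodyAlgebra R) :=
  ⨆ (w : List (Fin 2)) (a : Fin 2), wordSpace R C w a

omit [CharZero k] in
theorem wordSpace_le_minusSum (w : List (Fin 2)) (a : Fin 2) :
    wordSpace R C w a ≤ minusSum R C :=
  le_iSup_of_le w (le_iSup_of_le a le_rfl)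

theorem adStable_levi_minusSum : ∀ x ∈ levi R, AdStable x (minusSum R C) := fun x hx =>
  AdStable.iSup fun w => AdStable.iSup fun a => adStable_levi_wordSpace C w a x hx

omit [CharZero k] in
theorem f_mem_minusSpace (a : Fin 2) : f R (.inr a) ∈ minusSpace R C a :=
  Submodule.subset_span ⟨⟨0, Nat.succ_pos _⟩, rfl⟩

omit [CharZero k] in
theorem lie_minusSpace_minusSum (a : Fin 2) {x : KacMoodyAlgebra R} (hx : x ∈ minusSpace R C a) :
    AdStable x (minusSum R C) :=
  lie_mem_iSup fun w => lie_mem_iSup fun b _ hy =>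
    (le_iSup_of_le (a :: w) (le_iSup_of_le b le_rfl) :
      wordSpace R C (a :: w) b ≤ minusSum R C) (lie_mem_bracketSpan hx hy)

theorem lie_levi_mem_minusSpace (a : Fin 2) {x y : KacMoodyAlgebra R} (hx : x ∈ minusSpace R C a)
    (hy : y ∈ levi R) : ⁅x, y⁆ ∈ minusSpace R C a := by
  rw [← lie_skew]
  exact neg_mem (adStable_levi_minusSpace C a y hy x hx)

omit [CharZero k] in
theorem lie_e_minusVec (a b : Fin 2) (m : ℕ) : ⁅e R (.inr a), minusVec R C b m⁆ ∈ levi R := by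
  induction m with
  | zero =>
    rcases eq_or_ne a b with rfl | hab
    · exact (lie_e_f_same R _).symm ▸ h_mem_levi _
    · have : ⁅e R (.inr a), minusVec R C b 0⁆ = 0 := lie_e_f_ne R (by simpa using hab)
      rw [this]
      exact zero_mem _
  | succ m ih =>
    change ⁅e R (.inr a), ⁅f R (.inl (C.c m)), minusVec R C b m⁆⁆ ∈ _
    rw [leibniz_lie, lie_e_f_ne R (by simp), zero_lie, zero_add]
    exact adStable_levi_levi _ (leviG_le_levi (f_mem_leviG _)) _ ih

omit [CharZero k] in
theorem lie_e_minusSpace (a b : Fin 2) : ∀ y ∈ minusSpace R C b, ⁅e R (.inr a), y⁆ ∈ levi R := by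
  refine lie_mem_span ?_
  rintro _ ⟨m, rfl⟩
  exact lie_e_minusVec C a b m

/-- Bracketing with `e_{α_0}` or `e_{β_0}` shortens the iterated brackets by one letter. -/
theorem lie_e_wordSpace (a : Fin 2) (w : List (Fin 2)) (b : Fin 2) :
    ∀ y ∈ wordSpace R C w b, ⁅e R (.inr a), y⁆ ∈ minusSum R C ⊔ levi R := by
  induction w with
  | nil => exact fun y hy => Submodule.mem_sup_right (lie_e_minusSpace C a b y hy)
  | cons c w ih =>
    have : wordSpace R C (c :: w) b ≤
        (minusSum R C ⊔ levi R).comap (LieAlgebra.ad k _ (e R (.inr a))) := by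
      refine bracketSpan_le.2 fun x hx y hy => ?_
      rw [Submodule.mem_comap, LieAlgebra.ad_apply, leibniz_lie]
      refine add_mem (Submodule.mem_sup_left ?_) ?_
      · exact wordSpace_le_minusSum C w b
          (adStable_levi_wordSpace C w b _ (lie_e_minusSpace C a c x hx) y hy)
      · refine lie_mem_sup (fun z hz => ?_) (fun z hz => ?_) _ (ih y hy)
        · exact Submodule.mem_sup_left (lie_minusSpace_minusSum C c hx z hz)
        · exact Submodule.mem_sup_left
            (wordSpace_le_minusSum C [] c (lie_levi_mem_minusSpace C c hx hz))
    exact this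

omit [CharZero k] in
theorem omega_mem_leviG {x : KacMoodyAlgebra R} (hx : x ∈ leviG R) : omega R x ∈ leviG R := by
  induction hx using LieSubalgebra.lieSpan_induction with
  | mem x hx =>
    rcases hx with ⟨i, rfl⟩ | ⟨i, rfl⟩
    · rw [omega_e]; exact (leviG R).neg_mem_iff.2 (f_mem_leviG i)
    · rw [omega_f]; exact (leviG R).neg_mem_iff.2 (e_mem_leviG i)
  | zero => rw [map_zero]; exact (leviG R).zero_mem
  | add x y _ _ hx hy => rw [map_add]; exact (leviG R).add_mem hx hy
  | smul c x _ hx => rw [map_smul]; exact (leviG R).smul_mem c hx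
  | lie x y _ _ hx hy => rw [LieHom.map_lie]; exact (leviG R).lie_mem hx hy

omit [CharZero k] in
theorem omega_mem_levi {x : KacMoodyAlgebra R} (hx : x ∈ levi R) : omega R x ∈ levi R := by
  obtain ⟨a, ha, _, ⟨t, rfl⟩, rfl⟩ := Submodule.mem_sup.1 hx
  rw [map_add, omega_h]
  exact add_mem (leviG_le_levi (omega_mem_leviG ha)) (neg_mem (h_mem_levi t))

/-- The triangular decomposition of `𝔨` with respect to the Levi subalgebra. -/
theorem minusSum_sup_levi_sup_eq_top : minusSum R C ⊔ levi R ⊔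
    (minusSum R C).map (omega R : KacMoodyAlgebra R →ₗ[k] KacMoodyAlgebra R) = ⊤ := by
  set T := minusSum R C ⊔ levi R ⊔
    (minusSum R C).map (omega R : KacMoodyAlgebra R →ₗ[k] KacMoodyAlgebra R) with hT
  have hTω : ∀ y ∈ T, omega R y ∈ T := by
    have : T ≤ T.comap (omega R : KacMoodyAlgebra R →ₗ[k] KacMoodyAlgebra R) := by
      refine sup_le (sup_le ?_ ?_) ?_
      · exact fun y hy => Submodule.mem_sup_right ⟨y, hy, rfl⟩
      · exact fun y hy => Submodule.mem_sup_left (Submodule.mem_sup_right (omega_mem_levi hy))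
      · rintro _ ⟨y, hy, rfl⟩
        refine Submodule.mem_sup_left (Submodule.mem_sup_left ?_)
        exact (omega_omega R y).symm ▸ hy
    exact this
  have hfl : ∀ a, AdStable (f R (.inr a)) T := by
    intro a
    refine lie_mem_sup (lie_mem_sup ?_ ?_) ?_
    · exact fun y hy => Submodule.mem_sup_left (Submodule.mem_sup_left
        (lie_minusSpace_minusSum C a (f_mem_minusSpace C a) y hy))
    · exact fun y hy => Submodule.mem_sup_left (Submodule.mem_sup_left
        (wordSpace_le_minusSum C [] a (lie_levi_mem_minusSpace C a (f_mem_minusSpace C a) hy)))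
    · rintro _ ⟨y, hy, rfl⟩
      have h1 : ⁅f R (.inr a), omega R y⁆ = omega R (-⁅e R (.inr a), y⁆) := by
        rw [map_neg, LieHom.map_lie, omega_e, neg_lie, neg_neg]
      change ⁅f R (.inr a), omega R y⁆ ∈ T
      rw [h1]
      refine hTω _ (neg_mem (Submodule.mem_sup_left ?_))
      exact lie_mem_iSup (fun w => lie_mem_iSup fun b => lie_e_wordSpace C a w b) y hy
  have hlevi : ∀ x ∈ levi R, AdStable x T := by
    intro x hx
    refine AdStable.sup ((adStable_levi_minusSum C x hx).sup (adStable_levi_levi x hx)) ?_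
    rintro _ ⟨y, hy, rfl⟩
    refine ⟨_, adStable_levi_minusSum C _ (omega_mem_levi hx) y hy, ?_⟩
    change omega R ⁅omega R x, y⁆ = ⁅x, omega R y⁆
    rw [LieHom.map_lie, omega_omega]
  have hf : ∀ i, AdStable (f R i) T := by
    rintro (i | a)
    · exact hlevi _ (leviG_le_levi (f_mem_leviG i))
    · exact hfl a
  have he : ∀ i, AdStable (e R i) T := by
    intro i y hy
    have h1 : ⁅e R i, y⁆ = omega R (-⁅f R i, omega R y⁆) := by
      rw [map_neg, LieHom.map_lie, omega_f, neg_lie, neg_neg, omega_omega]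
    rw [h1]
    exact hTω _ (neg_mem (hf i _ (hTω y hy)))
  have hfT : ∀ i, f R i ∈ T := by
    rintro (i | a)
    · exact Submodule.mem_sup_left (Submodule.mem_sup_right (leviG_le_levi (f_mem_leviG i)))
    · exact Submodule.mem_sup_left (Submodule.mem_sup_left
        (wordSpace_le_minusSum C [] a (f_mem_minusSpace C a)))
  have heT : ∀ i, e R i ∈ T := by
    intro i
    have := hTω _ (neg_mem (hfT i))
    rwa [map_neg, omega_f, neg_neg] at this
  have hhT : ∀ t, h R t ∈ T := fun t =>
    Submodule.mem_sup_left (Submodule.mem_sup_right (h_mem_levi t))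
  -- `T` is an ideal, because it is stable under the generators
  have hideal : ∀ x, AdStable x T := by
    let K : LieSubalgebra k (KacMoodyAlgebra R) :=
      LieSubalgebra.lieSpan k _ {x | AdStable x T}
    have hK : K = ⊤ := eq_top_of_generators (fun i => LieSubalgebra.subset_lieSpan (he i))
      (fun i => LieSubalgebra.subset_lieSpan (hf i))
      (fun t => LieSubalgebra.subset_lieSpan (hlevi _ (h_mem_levi t)))
    exact fun x => adStable_of_mem_lieSpan (fun x hx => hx) x (show x ∈ K by rw [hK]; trivial)
  let K : LieSubalgebra k (KacMoodyAlgebra R) :=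
    { T with lie_mem' := fun {x y} _ hy => hideal x y hy }
  have hK : K = ⊤ := eq_top_of_generators heT hfT hhT
  rw [eq_top_iff]
  intro x _
  have : x ∈ K := by rw [hK]; trivial
  exact this

end

end Decomposition

/-! ### The grading by the centre of the Levi subalgebra -/

section Grading

open KacMoodyAlgebra

variable {k : Type*} [Field k]

theorem Realization.exists_root_eq {I : Type*} [Fintype I] [DecidableEq I] {A : Matrix I I ℤ}
    {𝔥 : Type*} [AddCommGroup 𝔥] [Module k 𝔥] (R : Realization k A 𝔥) (b : I → k) :
    ∃ t, ∀ i, R.root i t = b i := by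
  let T : 𝔥 →ₗ[k] (I → k) := LinearMap.pi R.root
  have hT : Function.Surjective T := by
    rw [← LinearMap.dualMap_injective_iff, ← LinearMap.ker_eq_bot, LinearMap.ker_eq_bot']
    intro g hg
    have h1 : ∀ t, ∑ i, g (Pi.single i 1) * R.root i t = 0 := by
      intro t
      have h2 := LinearMap.congr_fun hg t
      rw [LinearMap.dualMap_apply, LinearMap.zero_apply, LinearMap.pi_apply_eq_sum_univ g] at h2
      rw [← h2]
      refine Finset.sum_congr rfl fun i _ => ?_
      rw [smul_eq_mul, mul_comm]
      congr 2
      funext j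
      simp [Pi.single_apply, eq_comm]
    have h3 := Fintype.linearIndependent_iff.1 R.linearIndependent_root
      (fun i => g (Pi.single i 1)) (LinearMap.ext fun t => by simpa using h1 t)
    refine LinearMap.pi_ext' fun i => LinearMap.ext_ring ?_
    simpa using h3 i
  obtain ⟨t, ht⟩ := hT b
  exact ⟨t, fun i => congrFun ht i⟩

variable {X : ModelType} {ℓ : ℕ}
  {𝔥 : Type*} [AddCommGroup 𝔥] [Module k 𝔥] {R : Realization k (X.extendedCartan ℓ) 𝔥}

theorem root_eq_zero_of_mem_centerC {t : 𝔥} (ht : t ∈ centerC R) (i : Fin ℓ) :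
    R.root (.inl i) t = 0 := by
  simp only [centerC, Submodule.mem_iInf, LinearMap.mem_ker] at ht
  exact ht i

theorem lie_mem_eigenspaceC {η η' : Fin 2 → ℤ} {x y : KacMoodyAlgebra R}
    (hx : x ∈ eigenspaceC R η) (hy : y ∈ eigenspaceC R η') : ⁅x, y⁆ ∈ eigenspaceC R (η + η') := by
  intro t ht
  rw [leibniz_lie, hx t ht, hy t ht, smul_lie, lie_smul, ← add_smul, ← Finset.sum_add_distrib]
  congr 1
  refine Finset.sum_congr rfl fun j _ => ?_
  rw [Pi.add_apply]
  push_cast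
  ring

theorem omega_mem_eigenspaceC {η : Fin 2 → ℤ} {x : KacMoodyAlgebra R}
    (hx : x ∈ eigenspaceC R η) : omega R x ∈ eigenspaceC R (-η) := by
  intro t ht
  have h1 : ⁅h R t, omega R x⁆ = omega R (-⁅h R t, x⁆) := by
    rw [map_neg, LieHom.map_lie, omega_h, neg_lie, neg_neg]
  rw [h1, hx t ht, ← neg_smul, map_smul, ← Finset.sum_neg_distrib]
  congr 1
  refine Finset.sum_congr rfl fun j _ => ?_
  rw [Pi.neg_apply]
  push_cast
  ring

theorem levi_le_eigenspaceC {x : KacMoodyAlgebra R} (hx : x ∈ levi R) : x ∈ eigenspaceC R 0 := by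
  obtain ⟨a, ha, _, ⟨s, rfl⟩, rfl⟩ := Submodule.mem_sup.1 hx
  intro t ht
  rw [lie_add, h_leviG R ht ha, lie_h_h]
  simp

theorem f_inr_mem_eigenspaceC (a : Fin 2) : f R (.inr a) ∈ eigenspaceC R (-Pi.single a 1) := by
  intro t _
  rw [h_f, ← neg_smul]
  congr 1
  rw [Finset.sum_eq_single a]
  · simp
  · intro j _ hj
    simp [hj]
  · simp

variable (C : WeightChain (X.cartan ℓ))

theorem minusSpace_le_eigenspaceC (a : Fin 2) :
    minusSpace R C a ≤ (eigenspaceC R (-Pi.single a 1)).toSubmodule := by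
  rw [minusSpace, Submodule.span_le]
  rintro _ ⟨⟨m, hm⟩, rfl⟩
  change minusVec R C a m ∈ eigenspaceC R _
  clear hm
  induction m with
  | zero => exact f_inr_mem_eigenspaceC a
  | succ m ih =>
    change ⁅f R (.inl (C.c m)), minusVec R C a m⁆ ∈ eigenspaceC R _
    rw [← zero_add (-Pi.single a 1)]
    exact lie_mem_eigenspaceC (levi_le_eigenspaceC (leviG_le_levi (f_mem_leviG _))) ih

/-- The degree of the iterated brackets belonging to a word: the numbers of its letters of either
kind. -/
def wordDeg : List (Fin 2) → Fin 2 → Fin 2 → ℤ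
  | [], a => Pi.single a 1
  | b :: w, a => Pi.single b 1 + wordDeg w a

theorem sum_wordDeg (w : List (Fin 2)) (a : Fin 2) : ∑ j, wordDeg w a j = w.length + 1 := by
  induction w with
  | nil => simp [wordDeg]
  | cons b w ih =>
    simp only [wordDeg, Pi.add_apply, Finset.sum_add_distrib, ih, List.length_cons]
    simp only [Finset.sum_pi_single', Finset.mem_univ, if_true]
    push_cast
    ring

theorem wordDeg_nonneg (w : List (Fin 2)) (a j : Fin 2) : 0 ≤ wordDeg w a j := by
  have h1 : ∀ b j : Fin 2, (0 : ℤ) ≤ (Pi.single b 1 : Fin 2 → ℤ) j := by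
    intro b j
    rw [Pi.single_apply]
    split_ifs <;> simp
  induction w with
  | nil => exact h1 a j
  | cons b w ih => exact add_nonneg (h1 b j) ih

theorem wordDeg_ne_zero (w : List (Fin 2)) (a : Fin 2) : wordDeg w a ≠ 0 := by
  intro h
  have h1 := sum_wordDeg w a
  rw [h] at h1
  simp only [Pi.zero_apply, Finset.sum_const_zero] at h1
  omega

theorem finite_wordDeg_eq (d : Fin 2 → ℤ) :
    {p : List (Fin 2) × Fin 2 | wordDeg p.1 p.2 = d}.Finite := by
  refine ((List.finite_length_eq (Fin 2) (∑ j, d j - 1).toNat).prod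
    (Set.finite_univ (α := Fin 2))).subset ?_
  rintro ⟨w, a⟩ h
  have h0 : wordDeg w a = d := h
  have h1 := sum_wordDeg w a
  rw [h0] at h1
  exact ⟨show w.length = _ by omega, trivial⟩

theorem wordSpace_le_eigenspaceC (w : List (Fin 2)) (a : Fin 2) :
    wordSpace R C w a ≤ (eigenspaceC R (-wordDeg w a)).toSubmodule := by
  induction w with
  | nil => exact minusSpace_le_eigenspaceC C a
  | cons b w ih =>
    refine bracketSpan_le.2 fun x hx y hy => ?_
    rw [wordDeg, neg_add]
    exact lie_mem_eigenspaceC (minusSpace_le_eigenspaceC C b hx) (ih hy)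

variable [CharZero k]

/-- The centre `𝔠` contains elements dual to `α_0` and `β_0`, which separate the degrees `η`. -/
theorem iSupIndep_eigenspaceC :
    iSupIndep fun η : Fin 2 → ℤ => (eigenspaceC R η).toSubmodule := by
  choose t ht using fun j : Fin 2 => R.exists_root_eq (Sum.elim 0 (Pi.single j 1))
  have htC : ∀ j, t j ∈ centerC R := by
    intro j
    simp only [centerC, Submodule.mem_iInf, LinearMap.mem_ker]
    exact fun i => ht j (.inl i)
  have hle : ∀ η : Fin 2 → ℤ, (eigenspaceC R η).toSubmodule ≤
      ⨅ j, (LieAlgebra.ad k _ (h R (t j))).maxGenEigenspace (η j : k) := by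
    intro η y hy
    rw [Submodule.mem_iInf]
    intro j
    rw [Module.End.mem_maxGenEigenspace]
    refine ⟨1, ?_⟩
    have h1 := hy (t j) (htC j)
    rw [Finset.sum_eq_single j (fun l _ hl => by rw [ht]; simp [hl]) (by simp), ht] at h1
    simp only [Sum.elim_inr, Pi.single_eq_same, mul_one] at h1
    rw [pow_one, LinearMap.sub_apply, LieAlgebra.ad_apply, h1]
    simp
  have h1 := Module.End.independent_iInf_maxGenEigenspace_of_forall_mapsTo
    (fun j : Fin 2 => LieAlgebra.ad k (KacMoodyAlgebra R) (h R (t j))) (fun i j φ =>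
      Module.End.mapsTo_maxGenEigenspace_of_comm (LinearMap.ext fun y => by
        rw [Module.End.mul_apply, Module.End.mul_apply, LieAlgebra.ad_apply, LieAlgebra.ad_apply,
          LieAlgebra.ad_apply, LieAlgebra.ad_apply, leibniz_lie, lie_h_h, zero_lie, zero_add]) φ)
  have h2 : Function.Injective fun (η : Fin 2 → ℤ) (j : Fin 2) => (η j : k) := fun η η' h =>
    funext fun j => Int.cast_injective (α := k) (congrFun h j)
  exact (h1.comp h2).mono hle

/-- The part of the triangular decomposition which has degree `η`. -/
noncomputable def gradedPiece (R : Realization k (X.extendedCartan ℓ) 𝔥)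
    (C : WeightChain (X.cartan ℓ)) (η : Fin 2 → ℤ) : Submodule k (KacMoodyAlgebra R) :=
  (⨆ p ∈ {p : List (Fin 2) × Fin 2 | wordDeg p.1 p.2 = -η}, wordSpace R C p.1 p.2) ⊔
    (⨆ _ : η = 0, levi R) ⊔
    ⨆ p ∈ {p : List (Fin 2) × Fin 2 | wordDeg p.1 p.2 = η},
      (wordSpace R C p.1 p.2).map (omega R : KacMoodyAlgebra R →ₗ[k] KacMoodyAlgebra R)

omit [CharZero k] in
theorem gradedPiece_le (η : Fin 2 → ℤ) :
    gradedPiece R C η ≤ (eigenspaceC R η).toSubmodule := by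
  refine sup_le (sup_le (iSup₂_le fun p hp => ?_) (iSup_le ?_)) (iSup₂_le fun p hp => ?_)
  · have hp' : wordDeg p.1 p.2 = -η := hp
    rw [← neg_neg η, ← hp']
    exact wordSpace_le_eigenspaceC C _ _
  · rintro rfl
    exact fun x hx => levi_le_eigenspaceC hx
  · have hp' : wordDeg p.1 p.2 = η := hp
    rintro _ ⟨y, hy, rfl⟩
    have := omega_mem_eigenspaceC (wordSpace_le_eigenspaceC C _ _ hy)
    rwa [neg_neg, hp'] at this

/-- The parts of the triangular decomposition lie in the independent subspaces `𝔨_η` and span `𝔨`, so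
that they exhaust the `𝔨_η`. -/
theorem eigenspaceC_eq_gradedPiece (η : Fin 2 → ℤ) :
    (eigenspaceC R η).toSubmodule = gradedPiece R C η := by
  refine le_antisymm (fun x hx => ?_) (gradedPiece_le C η)
  have htop : ⨆ η, gradedPiece R C η = ⊤ := by
    rw [eq_top_iff, ← minusSum_sup_levi_sup_eq_top (R := R) C]
    refine sup_le (sup_le (iSup₂_le fun w a => ?_) ?_) ?_
    · refine le_iSup_of_le (-wordDeg w a) (le_sup_of_le_left (le_sup_of_le_left ?_))
      exact le_iSup₂_of_le (w, a) (neg_neg _).symm le_rfl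
    · exact le_iSup_of_le 0 (le_sup_of_le_left (le_sup_of_le_right (le_iSup_of_le rfl le_rfl)))
    · rw [minusSum, Submodule.map_iSup]
      simp only [Submodule.map_iSup]
      refine iSup₂_le fun w a => le_iSup_of_le (wordDeg w a) (le_sup_of_le_right ?_)
      exact le_iSup₂_of_le (w, a) rfl le_rfl
  have hx' : x ∈ gradedPiece R C η ⊔ ⨆ (ξ) (_ : ξ ≠ η), gradedPiece R C ξ := by
    have : gradedPiece R C η ⊔ ⨆ (ξ) (_ : ξ ≠ η), gradedPiece R C ξ = ⊤ := by
      rw [eq_top_iff, ← htop]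
      refine iSup_le fun ξ => ?_
      rcases eq_or_ne ξ η with rfl | hξ
      · exact le_sup_left
      · exact le_sup_of_le_right (le_iSup₂_of_le ξ hξ le_rfl)
    rw [this]
    trivial
  obtain ⟨p, hp, q, hq, rfl⟩ := Submodule.mem_sup.1 hx'
  have h1 : q ∈ (eigenspaceC R η).toSubmodule := by
    have := sub_mem hx (gradedPiece_le C η hp)
    rwa [add_sub_cancel_left] at this
  have h2 : q ∈ ⨆ (ξ) (_ : ξ ≠ η), (eigenspaceC R ξ).toSubmodule :=
    (iSup₂_mono fun ξ _ => gradedPiece_le C ξ) hq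
  have h3 := (Submodule.disjoint_def.1 (iSupIndep_eigenspaceC (R := R) η)) q h1 h2
  rw [h3, add_zero]
  exact hp

include C in
theorem eigenspaceC_zero : (eigenspaceC R 0).toSubmodule = levi R := by
  rw [eigenspaceC_eq_gradedPiece C]
  refine le_antisymm (sup_le (sup_le (iSup₂_le fun p hp => ?_) (iSup_le fun _ => le_rfl))
    (iSup₂_le fun p hp => ?_)) (le_sup_of_le_left (le_sup_of_le_right (le_iSup_of_le rfl le_rfl)))
  · exact absurd ((Set.mem_ofPred_eq ▸ hp : _ = _).trans neg_zero) (wordDeg_ne_zero _ _)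
  · exact absurd hp (wordDeg_ne_zero _ _)

theorem eigenspaceC_neg {d : Fin 2 → ℤ} (hd : ∀ j, 0 ≤ d j) (hd0 : d ≠ 0) :
    (eigenspaceC R (-d)).toSubmodule =
      ⨆ p ∈ {p : List (Fin 2) × Fin 2 | wordDeg p.1 p.2 = d}, wordSpace R C p.1 p.2 := by
  rw [eigenspaceC_eq_gradedPiece C, gradedPiece, neg_neg]
  refine le_antisymm (sup_le (sup_le le_rfl (iSup_le fun h => ?_)) (iSup₂_le fun p hp => ?_))
    (le_sup_of_le_left le_sup_left)
  · exact absurd (neg_eq_zero.1 h) hd0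
  · have hp' : wordDeg p.1 p.2 = -d := hp
    refine absurd (funext fun j => ?_) (wordDeg_ne_zero p.1 p.2)
    have h1 := wordDeg_nonneg p.1 p.2 j
    have h2 := hd j
    rw [hp', Pi.neg_apply] at h1
    rw [hp', Pi.neg_apply, Pi.zero_apply]
    omega

theorem eigenspaceC_neg_single (a : Fin 2) :
    (eigenspaceC R (-Pi.single a 1)).toSubmodule = minusSpace R C a := by
  rw [eigenspaceC_neg C (d := Pi.single a 1) (wordDeg_nonneg [] a) (wordDeg_ne_zero [] a)]
  refine le_antisymm (iSup₂_le ?_) (le_iSup₂_of_le ([], a) rfl le_rfl)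
  rintro ⟨w, b⟩ hp
  have hp' : wordDeg w b = wordDeg [] a := hp
  have h1 := sum_wordDeg w b
  rw [hp', sum_wordDeg] at h1
  obtain rfl : w = [] := List.length_eq_zero_iff.1 (by simpa using h1.symm)
  have h2 := congrFun hp' b
  obtain rfl : b = a := by
    by_contra hab
    simp [wordDeg, hab] at h2
  exact le_rfl

theorem eigenspaceC_neg_one_neg_one : (eigenspaceC R ![-1, -1]).toSubmodule =
    bracketSpan (minusSpace R C 0) (minusSpace R C 1) := by
  have h0 : (![-1, -1] : Fin 2 → ℤ) = -wordDeg [0] 1 := by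
    funext j
    fin_cases j <;> simp [wordDeg]
  rw [h0, eigenspaceC_neg C (wordDeg_nonneg [0] 1) (wordDeg_ne_zero [0] 1)]
  refine le_antisymm (iSup₂_le ?_) (le_iSup₂_of_le ([0], 1) rfl le_rfl)
  rintro ⟨w, b⟩ hp
  have hp' : wordDeg w b = wordDeg [0] 1 := hp
  have h1 := sum_wordDeg w b
  rw [hp', sum_wordDeg] at h1
  obtain ⟨c, rfl⟩ : ∃ c, w = [c] := List.length_eq_one_iff.1 (by
    have h2 : (w.length : ℤ) + 1 = 2 := by simpa using h1.symm
    omega)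
  have h2 := congrFun hp' 0
  fin_cases c <;> fin_cases b
  · simp [wordDeg] at h2
  · exact le_rfl
  · refine bracketSpan_le.2 fun x hx y hy => ?_
    rw [← lie_skew]
    exact neg_mem (lie_mem_bracketSpan hy hx)
  · simp [wordDeg] at h2

end Grading

/-! ### The graded pieces are integrable -/

section Integrable

open KacMoodyAlgebra

variable {k : Type*} [Field k] [CharZero k] {X : ModelType} {ℓ : ℕ}
  {𝔥 : Type*} [AddCommGroup 𝔥] [Module k 𝔥] [FiniteDimensional k 𝔥]
  {R : Realization k (X.extendedCartan ℓ) 𝔥} (C : WeightChain (X.cartan ℓ))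

omit [FiniteDimensional k 𝔥] in
include C in
theorem exists_centerC_add_sum_coroot (t : 𝔥) :
    ∃ s ∈ centerC R, ∃ c : Fin ℓ → k, t = s + ∑ i, c i • R.coroot (.inl i) := by
  obtain ⟨c, hc⟩ := C.exists_sum_mul_eq fun j => R.root (.inl j) t
  refine ⟨t - ∑ i, c i • R.coroot (.inl i), ?_, c, by abel⟩
  simp only [centerC, Submodule.mem_iInf, LinearMap.mem_ker]
  intro j
  rw [map_sub, map_sum, ← hc j, sub_eq_zero]
  refine Finset.sum_congr rfl fun i _ => ?_
  rw [map_smul, R.root_coroot, smul_eq_mul, X.extendedCartan_inl_inl]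

/-- The brackets of the modules with highest root vector `e_{α_0}` and lowest root vector `f_{α_0}`.
They fill up the Levi subalgebra except for a central part. -/
noncomputable def leviBrackets (R : Realization k (X.extendedCartan ℓ) 𝔥)
    (C : WeightChain (X.cartan ℓ)) : Submodule k (KacMoodyAlgebra R) :=
  bracketSpan ((minusSpace R C 0).map (omega R : KacMoodyAlgebra R →ₗ[k] KacMoodyAlgebra R))
    (minusSpace R C 0)

omit [FiniteDimensional k 𝔥] in
theorem isUnitarizable_leviBrackets :
    IsUnitarizable (fun i : Fin ℓ => LieAlgebra.ad k _ (e R (.inl i)))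
      (fun i : Fin ℓ => LieAlgebra.ad k _ (f R (.inl i))) (leviBrackets R C) :=
  isUnitarizable_bracketSpan (isUnitarizable_map_omega (isUnitarizable_minusSpace C 0))
    (isUnitarizable_minusSpace C 0)

omit [FiniteDimensional k 𝔥] in
theorem leviBrackets_le : leviBrackets R C ≤ levi R := by
  rw [← eigenspaceC_zero C]
  refine bracketSpan_le.2 ?_
  rintro _ ⟨x, hx, rfl⟩ y hy
  have h1 := lie_mem_eigenspaceC (omega_mem_eigenspaceC (minusSpace_le_eigenspaceC C 0 hx))
    (minusSpace_le_eigenspaceC C 0 hy)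
  rwa [neg_add_cancel] at h1

omit [FiniteDimensional k 𝔥] in
/-- The coroot of `α_0` is a bracket, and acts nontrivially on the root vectors of `α_1`; from there
the root vectors of `𝔤` are reached along the Dynkin diagram. -/
theorem leviG_le_leviBrackets : ∀ x ∈ leviG R, x ∈ leviBrackets R C := by
  have hst := fun i => (isUnitarizable_leviBrackets (R := R) C).stable i
  have hG : ∀ x ∈ leviG R, AdStable x (leviBrackets R C) :=
    adStable_leviG (fun i => (hst i).1) fun i => (hst i).2
  -- a coroot which is not orthogonal to a simple root yields the root vectors of that root
  have hstep : ∀ (j : Fin ℓ ⊕ Fin 2) (i : Fin ℓ), h R (R.coroot j) ∈ leviBrackets R C →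
      X.extendedCartan ℓ j (.inl i) ≠ 0 → e R (.inl i) ∈ leviBrackets R C ∧
        f R (.inl i) ∈ leviBrackets R C ∧ h R (R.coroot (.inl i)) ∈ leviBrackets R C := by
    intro j i hj hji
    have hji' : (X.extendedCartan ℓ j (.inl i) : k) ≠ 0 := by exact_mod_cast hji
    have he : e R (.inl i) ∈ leviBrackets R C := by
      have h1 := hG _ (e_mem_leviG i) _ hj
      rw [← lie_skew, h_e, R.root_coroot, ← neg_smul] at h1
      exact ((leviBrackets R C).smul_mem_iff (neg_ne_zero.2 hji')).1 h1
    have hf : f R (.inl i) ∈ leviBrackets R C := by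
      have h1 := hG _ (f_mem_leviG i) _ hj
      rw [← lie_skew, h_f, R.root_coroot, neg_neg] at h1
      exact ((leviBrackets R C).smul_mem_iff hji').1 h1
    refine ⟨he, hf, ?_⟩
    rw [← lie_e_f_same]
    exact hG _ (e_mem_leviG i) _ hf
  have h0 : h R (R.coroot (.inr 0)) ∈ leviBrackets R C := by
    rw [← lie_e_f_same]
    refine lie_mem_bracketSpan ⟨-f R (.inr 0), neg_mem (f_mem_minusSpace C 0), ?_⟩
      (f_mem_minusSpace C 0)
    change omega R _ = _
    rw [map_neg, omega_f, neg_neg]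
  have hall : ∀ (n : ℕ) (hn : n < ℓ), e R (.inl ⟨n, hn⟩) ∈ leviBrackets R C ∧
      f R (.inl ⟨n, hn⟩) ∈ leviBrackets R C ∧
      h R (R.coroot (.inl ⟨n, hn⟩)) ∈ leviBrackets R C := by
    intro n
    induction n with
    | zero => exact fun hn => hstep (.inr 0) ⟨0, hn⟩ h0 (by simp)
    | succ n ih =>
      exact fun hn => hstep (.inl ⟨n, by omega⟩) ⟨n + 1, hn⟩ (ih (by omega)).2.2
        (X.cartan_succ_ne_zero hn)
  intro x hx
  induction hx using LieSubalgebra.lieSpan_induction with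
  | mem x hx =>
    rcases hx with ⟨i, rfl⟩ | ⟨i, rfl⟩
    · exact (hall i i.2).1
    · exact (hall i i.2).2.1
  | zero => exact zero_mem _
  | add x y _ _ hx hy => exact add_mem hx hy
  | smul c x _ hx => exact Submodule.smul_mem _ c hx
  | lie x y hx' _ _ hy => exact hG x hx' y hy

include C in
theorem isUnitarizable_levi :
    IsUnitarizable (fun i : Fin ℓ => LieAlgebra.ad k _ (e R (.inl i)))
      (fun i : Fin ℓ => LieAlgebra.ad k _ (f R (.inl i))) (levi R) := by
  have h1 : levi R = leviBrackets R C ⊔ (centerC R).map (h R) := by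
    refine le_antisymm (sup_le ?_ ?_) (sup_le (leviBrackets_le C) ?_)
    · exact fun x hx => Submodule.mem_sup_left (leviG_le_leviBrackets C x hx)
    · rintro _ ⟨t, rfl⟩
      obtain ⟨s, hs, c, rfl⟩ := exists_centerC_add_sum_coroot (R := R) C t
      rw [map_add, map_sum]
      refine add_mem (Submodule.mem_sup_right ⟨s, hs, rfl⟩)
        (sum_mem fun i _ => Submodule.mem_sup_left ?_)
      rw [map_smul, ← lie_e_f_same]
      exact Submodule.smul_mem _ _ (leviG_le_leviBrackets C _
        ((leviG R).lie_mem (e_mem_leviG i) (f_mem_leviG i)))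
    · rintro _ ⟨t, -, rfl⟩
      exact h_mem_levi t
  rw [h1]
  refine (isUnitarizable_leviBrackets C).sup (isUnitarizable_of_trivial ?_ ?_)
  · rintro j _ ⟨t, ht, rfl⟩
    rw [LieAlgebra.ad_apply, ← lie_skew, h_e, root_eq_zero_of_mem_centerC ht, zero_smul, neg_zero]
  · rintro j _ ⟨t, ht, rfl⟩
    rw [LieAlgebra.ad_apply, ← lie_skew, h_f, root_eq_zero_of_mem_centerC ht, zero_smul, neg_zero,
      neg_zero]

include C in
theorem isUnitarizable_eigenspaceC (η : Fin 2 → ℤ) :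
    IsUnitarizable (fun i : Fin ℓ => LieAlgebra.ad k _ (e R (.inl i)))
      (fun i : Fin ℓ => LieAlgebra.ad k _ (f R (.inl i))) (eigenspaceC R η).toSubmodule := by
  rw [eigenspaceC_eq_gradedPiece C]
  refine ((isUnitarizable_iSup (finite_wordDeg_eq _) fun p _ =>
    isUnitarizable_wordSpace C _ _).sup ?_).sup (isUnitarizable_iSup (finite_wordDeg_eq _)
      fun p _ => isUnitarizable_map_omega (isUnitarizable_wordSpace C _ _))
  rcases eq_or_ne η 0 with hη | hη
  · simp only [hη, iSup_pos]
    exact isUnitarizable_levi C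
  · simp only [hη, iSup_false]
    exact isUnitarizable_of_trivial (by simp) (by simp)

include C in
theorem finite_eigenspaceC (η : Fin 2 → ℤ) : Module.Finite k (eigenspaceC R η) :=
  (isUnitarizable_eigenspaceC C η).finite

omit [CharZero k] [FiniteDimensional k 𝔥] in
theorem coe_toEnd_eigenspaceC_pow {η : Fin 2 → ℤ} (x : leviG R) (n : ℕ) (y : eigenspaceC R η) :
    (((LieModule.toEnd k (leviG R) (eigenspaceC R η) x ^ n) y : eigenspaceC R η) :
      KacMoodyAlgebra R) = ((LieAlgebra.ad k _ (x : KacMoodyAlgebra R)) ^ n) y := by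
  induction n with
  | zero => rfl
  | succ n ih =>
    rw [ad_pow_succ_apply, ← ih, pow_succ', Module.End.mul_apply]
    rfl

include C in
theorem isIntegrableG_eigenspaceC (η : Fin 2 → ℤ) :
    IsIntegrableG R (LieModule.toEnd k (leviG R) (eigenspaceC R η)) := by
  have := finite_eigenspaceC (R := R) C η
  refine ⟨this, fun j => Module.End.isNilpotent_iff_of_finite.2 fun y => ?_⟩
  have key : ∃ n : ℕ, ((LieAlgebra.ad k _ (leviRootVectors R j : KacMoodyAlgebra R)) ^ n)
      (y : KacMoodyAlgebra R) = 0 := by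
    rcases j with i | i
    · exact exists_ad_e_pow R (.inl i) y
    · exact exists_ad_f_pow R (.inl i) y
  obtain ⟨n, hn⟩ := key
  exact ⟨n, Subtype.ext ((coe_toEnd_eigenspaceC_pow _ n y).trans hn)⟩

omit [FiniteDimensional k 𝔥] in
/-- The Lie algebra generated by `𝔨_{-α_0}` and `𝔨_{-β_0}` is the sum of all the pieces of negative
degree. -/
theorem lieSpan_eigenspaceC (hC : WeightChain (X.cartan ℓ)) :
    (LieSubalgebra.lieSpan k (KacMoodyAlgebra R)
        ((eigenspaceC R ![-1, 0] : Set (KacMoodyAlgebra R)) ∪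
          (eigenspaceC R ![0, -1] : Set (KacMoodyAlgebra R)))).toSubmodule =
      (⨆ (a : ℕ) (b : ℕ) (_ : (a, b) ≠ (0, 0)),
        (eigenspaceC R ![-(a : ℤ), -(b : ℤ)]).toSubmodule) := by
  have h0 : (![-1, 0] : Fin 2 → ℤ) = -Pi.single 0 1 := by
    funext j; fin_cases j <;> simp
  have h1 : (![0, -1] : Fin 2 → ℤ) = -Pi.single 1 1 := by
    funext j; fin_cases j <;> simp
  set S := ⨆ (a : ℕ) (b : ℕ) (_ : (a, b) ≠ (0, 0)),
    (eigenspaceC R ![-(a : ℤ), -(b : ℤ)]).toSubmodule with hS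
  have hle : ∀ a b : ℕ, (a, b) ≠ (0, 0) →
      (eigenspaceC R ![-(a : ℤ), -(b : ℤ)]).toSubmodule ≤ S := fun a b hab =>
    le_iSup_of_le a (le_iSup_of_le b (le_iSup_of_le hab le_rfl))
  refine le_antisymm (fun x hx => ?_) ?_
  · have hx' : x ∈ LieSubalgebra.lieSpan k (KacMoodyAlgebra R)
        ((eigenspaceC R ![-1, 0] : Set (KacMoodyAlgebra R)) ∪
          (eigenspaceC R ![0, -1] : Set (KacMoodyAlgebra R))) := hx
    clear hx
    induction hx' using LieSubalgebra.lieSpan_induction with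
    | mem x hx =>
      rcases hx with hx | hx
      · exact hle 1 0 (by simp) (by simpa using hx)
      · exact hle 0 1 (by simp) (by simpa using hx)
    | zero => exact zero_mem _
    | add x y _ _ hx hy => exact add_mem hx hy
    | smul c x _ hx => exact Submodule.smul_mem _ c hx
    | lie x y _ _ hx hy =>
      have h2 : bracketSpan S S ≤ S := by
        refine bracketSpan_le.2 fun x hx => ?_
        refine lie_mem_iSup fun a => lie_mem_iSup fun b => lie_mem_iSup fun hab y hy => ?_
        rw [← lie_skew]
        refine neg_mem ?_
        revert x
        refine lie_mem_iSup fun c => lie_mem_iSup fun d => lie_mem_iSup fun hcd x hx => ?_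
        refine hle (a + c) (b + d) (fun h => hab ?_) ?_
        · simp only [Prod.mk.injEq] at h ⊢
          omega
        · have h3 := lie_mem_eigenspaceC hy hx
          have h4 : (![-((a + c : ℕ) : ℤ), -((b + d : ℕ) : ℤ)] : Fin 2 → ℤ) =
              ![-(a : ℤ), -(b : ℤ)] + ![-(c : ℤ), -(d : ℤ)] := by
            funext j
            fin_cases j <;> simp <;> ring
          rw [h4]
          exact h3
      exact h2 (lie_mem_bracketSpan hx hy)
  · refine iSup_le fun a => iSup_le fun b => iSup_le fun hab => ?_
    have h2 : (![-(a : ℤ), -(b : ℤ)] : Fin 2 → ℤ) = -![(a : ℤ), (b : ℤ)] := by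
      funext j; fin_cases j <;> simp
    rw [h2, eigenspaceC_neg hC]
    · refine iSup₂_le fun p hp => ?_
      clear hp
      have hm : ∀ a, minusSpace R hC a ≤ (LieSubalgebra.lieSpan k (KacMoodyAlgebra R)
          ((eigenspaceC R ![-1, 0] : Set (KacMoodyAlgebra R)) ∪
          (eigenspaceC R ![0, -1] : Set (KacMoodyAlgebra R)))).toSubmodule := by
        intro a x hx
        rw [← eigenspaceC_neg_single hC] at hx
        refine LieSubalgebra.subset_lieSpan ?_
        fin_cases a
        · exact .inl (h0 ▸ hx)
        · exact .inr (h1 ▸ hx)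
      obtain ⟨w, c⟩ := p
      induction w with
      | nil => exact hm c
      | cons b w ih =>
        exact bracketSpan_le.2 fun x hx y hy => LieSubalgebra.lie_mem _ (hm b hx) (ih hy)
    · intro j; fin_cases j <;> simp
    · intro h
      apply hab
      have h3 := congrFun h 0
      have h4 := congrFun h 1
      simp at h3 h4
      simp [h3, h4]

end Integrable

/-! ### The graded pieces as modules of the Levi subalgebra -/

section Modules

open KacMoodyAlgebra

variable {k : Type*} [Field k] {X : ModelType} {ℓ : ℕ}
  {𝔥 : Type*} [AddCommGroup 𝔥] [Module k 𝔥] {R : Realization k (X.extendedCartan ℓ) 𝔥}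

theorem coe_lie_leviE_leviF (i : Fin ℓ) :
    ((⁅leviE R i, leviF R i⁆ : leviG R) : KacMoodyAlgebra R) = h R (R.coroot (.inl i)) :=
  lie_e_f_same R (.inl i)

theorem lieSpan_leviE_leviF : LieSubalgebra.lieSpan k (leviG R)
    (Set.range (leviE R) ∪ Set.range (leviF R)) = ⊤ := by
  rw [eq_top_iff]
  rintro ⟨x, hx⟩ -
  induction hx using LieSubalgebra.lieSpan_induction with
  | mem x hx =>
    rcases hx with ⟨i, rfl⟩ | ⟨i, rfl⟩
    · exact LieSubalgebra.subset_lieSpan (.inl ⟨i, rfl⟩)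
    · exact LieSubalgebra.subset_lieSpan (.inr ⟨i, rfl⟩)
  | zero => exact LieSubalgebra.zero_mem _
  | add x y _ _ hx hy => exact LieSubalgebra.add_mem _ hx hy
  | smul c x _ hx => exact LieSubalgebra.smul_mem _ c hx
  | lie x y _ _ hx hy => exact LieSubalgebra.lie_mem _ hx hy

theorem exists_chevalleySystem [CharZero k] (C : WeightChain (X.cartan ℓ)) :
    ∃ c : Fin ℓ → k, ChevalleySystem (leviE R) (leviF R) (fun i j => (X.cartan ℓ i j : k)) c := by
  obtain ⟨c, hc⟩ := C.exists_sum_mul_eq (k := k) fun _ => 1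
  refine ⟨c, ⟨fun i j hij => Subtype.ext (lie_e_f_ne R (by simpa using hij)), fun i j => ?_,
    fun i j => ?_, hc, lieSpan_leviE_leviF⟩⟩
  · refine Subtype.ext ?_
    change ⁅((⁅leviE R i, leviF R i⁆ : leviG R) : KacMoodyAlgebra R), e R (.inl j)⁆ =
      (X.cartan ℓ i j : k) • e R (.inl j)
    rw [coe_lie_leviE_leviF, h_e, R.root_coroot, X.extendedCartan_inl_inl]
  · refine Subtype.ext ?_
    change ⁅((⁅leviE R i, leviF R i⁆ : leviG R) : KacMoodyAlgebra R), f R (.inl j)⁆ =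
      -((X.cartan ℓ i j : k) • f R (.inl j))
    rw [coe_lie_leviE_leviF, h_f, R.root_coroot, X.extendedCartan_inl_inl]

/-- The restriction of the Chevalley involution to `𝔤`. -/
noncomputable def omegaG (R : Realization k (X.extendedCartan ℓ) 𝔥) : leviG R →ₗ⁅k⁆ leviG R where
  toFun x := ⟨omega R x, omega_mem_leviG x.2⟩
  map_add' _ _ := Subtype.ext (map_add (omega R) _ _)
  map_smul' c _ := Subtype.ext (map_smul (omega R) c _)
  map_lie' {x y} := Subtype.ext (LieHom.map_lie (omega R) x y)

/-- The Chevalley involution identifies `𝔨_{-η}` with `𝔨_η`. -/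
noncomputable def omegaEquiv (R : Realization k (X.extendedCartan ℓ) 𝔥) (η : Fin 2 → ℤ) :
    eigenspaceC R (-η) ≃ₗ[k] eigenspaceC R η where
  toFun x := ⟨omega R x, by simpa using omega_mem_eigenspaceC x.2⟩
  invFun x := ⟨omega R x, omega_mem_eigenspaceC x.2⟩
  map_add' _ _ := Subtype.ext (map_add (omega R) _ _)
  map_smul' c _ := Subtype.ext (map_smul (omega R) c _)
  left_inv x := Subtype.ext (omega_omega R x)
  right_inv x := Subtype.ext (omega_omega R x)

/-- The representation of `𝔤` on `𝔨_η`. -/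
noncomputable abbrev repC (R : Realization k (X.extendedCartan ℓ) 𝔥) (η : Fin 2 → ℤ) :
    leviG R →ₗ⁅k⁆ Module.End k (eigenspaceC R η) :=
  LieModule.toEnd k (leviG R) (eigenspaceC R η)

theorem coe_repC {η : Fin 2 → ℤ} (x : leviG R) (y : eigenspaceC R η) :
    (repC R η x y : KacMoodyAlgebra R) = ⁅(x : KacMoodyAlgebra R), (y : KacMoodyAlgebra R)⁆ := rfl

variable [CharZero k] [FiniteDimensional k 𝔥] (C : WeightChain (X.cartan ℓ))

include C in
theorem exists_isCompl_eigenspaceC {η : Fin 2 → ℤ} (N : Submodule k (eigenspaceC R η))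
    (hN : IsStable (repC R η) N) : ∃ N', IsStable (repC R η) N' ∧ IsCompl N N' := by
  let ι : eigenspaceC R η →ₗ[k] KacMoodyAlgebra R := (eigenspaceC R η).toSubmodule.subtype
  have hι : Function.Injective ι := Subtype.val_injective
  obtain ⟨N', hN'W, hE, hF, hinf, hsup⟩ := (isUnitarizable_eigenspaceC (R := R) C η).exists_compl
    (N := N.map ι) (by rintro _ ⟨y, -, rfl⟩; exact y.2)
    (by rintro j _ ⟨y, hy, rfl⟩; exact ⟨_, hN (leviE R j) y hy, rfl⟩)
    (by rintro j _ ⟨y, hy, rfl⟩; exact ⟨_, hN (leviF R j) y hy, rfl⟩)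
  refine ⟨N'.comap ι, isStable_of_gen lieSpan_leviE_leviF (fun i m hm => hE i _ hm)
    (fun i m hm => hF i _ hm), ?_, ?_⟩
  · rw [disjoint_iff, eq_bot_iff]
    intro y hy
    have h1 : ι y ∈ N.map ι ⊓ N' := ⟨⟨y, hy.1, rfl⟩, hy.2⟩
    rw [hinf, Submodule.mem_bot] at h1
    exact hι (h1.trans (map_zero ι).symm)
  · rw [codisjoint_iff, eq_top_iff]
    intro y _
    have h1 : ι y ∈ N.map ι ⊔ N' := by rw [hsup]; exact y.2
    obtain ⟨_, ⟨a, ha, rfl⟩, b, hb, hab⟩ := Submodule.mem_sup.1 h1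
    refine Submodule.mem_sup.2 ⟨a, ha, y - a, ?_, by abel⟩
    rw [Submodule.mem_comap, map_sub, ← hab, add_sub_cancel_left]
    exact hb

include C in
/-- Composing the Chevalley involution with a contravariant form on `𝔨_η` gives an invariant pairing
of `𝔨_{-η}` and `𝔨_η`. -/
theorem nonempty_equiv_dual_kG [IsAlgClosed k] (η : Fin 2 → ℤ) :
    Nonempty ((kG R (-η)).Equiv (kG R η).dual) := by
  have hfin := finite_eigenspaceC (R := R) C η
  obtain ⟨c, S⟩ := exists_chevalleySystem (R := R) C
  obtain ⟨B, hsymm, hB, hker⟩ := exists_contravariant (ρ := repC R η) (ω := omegaG R) S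
    (fun i => Subtype.ext (omega_e R _)) (fun i => Subtype.ext (omega_f R _))
    (exists_isCompl_eigenspaceC C)
  have hB' : ∀ i x y, B (repC R η (leviF R i) x) y = B x (repC R η (leviE R i) y) := by
    intro i x y
    rw [hsymm, ← hB, hsymm]
  have hωe : ∀ i x, omegaEquiv R η (repC R (-η) (leviE R i) x) =
      -repC R η (leviF R i) (omegaEquiv R η x) := by
    intro i x
    refine Subtype.ext ?_
    change omega R ⁅e R (.inl i), (x : KacMoodyAlgebra R)⁆ = -⁅f R (.inl i), omega R x⁆
    rw [LieHom.map_lie, omega_e, neg_lie]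
  have hωf : ∀ i x, omegaEquiv R η (repC R (-η) (leviF R i) x) =
      -repC R η (leviE R i) (omegaEquiv R η x) := by
    intro i x
    refine Subtype.ext ?_
    change omega R ⁅f R (.inl i), (x : KacMoodyAlgebra R)⁆ = -⁅e R (.inl i), omega R x⁆
    rw [LieHom.map_lie, omega_f, neg_lie]
  let β : eigenspaceC R (-η) ≃ₗ[k] Module.Dual k (eigenspaceC R η) :=
    (omegaEquiv R η).trans (B.linearEquivOfInjective (LinearMap.ker_eq_bot.1 hker)
      Subspace.dual_finrank_eq.symm)
  have hβ : ∀ x y, β x y = B (omegaEquiv R η x) y := fun x y => rfl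
  refine nonempty_equiv_dual (isIntegrableG_eigenspaceC C (-η)) (isIntegrableG_eigenspaceC C η) β ?_
  rintro (i | i) m y
  · rw [hβ, hβ]
    change B (omegaEquiv R η (repC R (-η) (leviE R i) m)) y =
      -B (omegaEquiv R η m) (repC R η (leviE R i) y)
    rw [hωe, map_neg, LinearMap.neg_apply, hB']
  · rw [hβ, hβ]
    change B (omegaEquiv R η (repC R (-η) (leviF R i) m)) y =
      -B (omegaEquiv R η m) (repC R η (leviF R i) y)
    rw [hωf, map_neg, LinearMap.neg_apply, hB]

omit [FiniteDimensional k 𝔥] in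
theorem coroot_ne_zero (j : Fin ℓ ⊕ Fin 2) : h R (R.coroot j) ≠ 0 := by
  intro h0
  have h1 : R.coroot j = 0 := by
    refine h_injective R X.extendedCartan_diag (fun i j => X.extendedCartan_nonpos)
      (fun i j => X.extendedCartan_eq_zero_symm) ?_
    rw [h0, map_zero]
  have h2 := R.root_coroot j j
  rw [h1, map_zero, X.extendedCartan_diag] at h2
  norm_num at h2

omit [FiniteDimensional k 𝔥] in
theorem f_ne_zero (j : Fin ℓ ⊕ Fin 2) : f R j ≠ 0 := fun h0 =>
  coroot_ne_zero (R := R) j (by rw [← lie_e_f_same, h0, lie_zero])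

omit [CharZero k] [FiniteDimensional k 𝔥] in
theorem IsIntegrable.of_injective {L : Type*} [LieRing L] [LieAlgebra k L] {J : Type*} {x : J → L}
    {M M' : Type*} [AddCommGroup M] [Module k M] [AddCommGroup M'] [Module k M']
    {ρ : L →ₗ⁅k⁆ Module.End k M} {ρ' : L →ₗ⁅k⁆ Module.End k M'} (hρ : IsIntegrable x ρ)
    {φ : M' →ₗ[k] M} (hφ : Function.Injective φ) (h : ∀ y m, φ (ρ' y m) = ρ y (φ m)) :
    IsIntegrable x ρ' := by
  have := hρ.1
  refine ⟨Module.Finite.of_injective φ hφ, fun j => ?_⟩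
  obtain ⟨n, hn⟩ := hρ.2 j
  refine ⟨n, LinearMap.ext fun m => hφ ?_⟩
  have h1 : ∀ n : ℕ, φ ((ρ' (x j) ^ n) m) = (ρ (x j) ^ n) (φ m) := by
    intro n
    induction n with
    | zero => rfl
    | succ n ih => rw [pow_succ', pow_succ', Module.End.mul_apply, Module.End.mul_apply, h, ih]
  rw [h1, hn, LinearMap.zero_apply, LinearMap.zero_apply, map_zero]

/-- The module `𝔨_{-α_0}`, or `𝔨_{-β_0}`, is generated by the highest weight vector `f_{α_0}`, or
`f_{β_0}`, of weight `ε_1`. -/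
theorem equiv_eps_one [IsAlgClosed k] (hℓ : X.ValidRank ℓ) (h1 : 0 < ℓ) (a : Fin 2) :
    IsIntegrableG R (irrAction (leviE R) (leviF R) (X.eps k ⟨0, h1⟩)) ∧
      Nonempty ((kG R (-Pi.single a 1)).Equiv (VG R (X.eps k ⟨0, h1⟩))) := by
  let C := X.weightChain ℓ hℓ
  obtain ⟨c, S⟩ := exists_chevalleySystem (R := R) C
  let v : eigenspaceC R (-Pi.single a 1) := ⟨f R (.inr a), f_inr_mem_eigenspaceC a⟩
  have hv0 : v ≠ 0 := fun h => f_ne_zero (R := R) (.inr a) (congrArg Subtype.val h)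
  have hv : IsHighest (repC R (-Pi.single a 1)) (leviE R) (leviF R) (X.eps k ⟨0, h1⟩) v := by
    refine ⟨fun i => Subtype.ext (lie_e_f_ne R (by simp)), fun i => Subtype.ext ?_⟩
    rw [coe_repC, coe_lie_leviE_leviF]
    change ⁅h R (R.coroot (.inl i)), f R (.inr a)⁆ = X.eps k ⟨0, h1⟩ i • f R (.inr a)
    rw [h_f, R.root_coroot, X.extendedCartan_inl_inr, ModelType.eps_one k hℓ, ← neg_smul]
    split_ifs <;> simp
  have hgen : ∀ N, IsStable (repC R (-Pi.single a 1)) N → v ∈ N → N = ⊤ := by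
    intro N hN hvN
    rw [eq_top_iff]
    rintro ⟨y, hy⟩ -
    have hle : minusSpace R C a ≤ N.map (eigenspaceC R (-Pi.single a 1)).toSubmodule.subtype := by
      rw [minusSpace, Submodule.span_le]
      rintro _ ⟨⟨m, hm⟩, rfl⟩
      change minusVec R C a m ∈ N.map (eigenspaceC R (-Pi.single a 1)).toSubmodule.subtype
      clear hm
      induction m with
      | zero => exact ⟨v, hvN, rfl⟩
      | succ m ih =>
        obtain ⟨z, hz, hzm⟩ := ih
        refine ⟨_, hN (leviF R (C.c m)) z hz, ?_⟩
        change ⁅f R (.inl (C.c m)), (z : KacMoodyAlgebra R)⁆ = ⁅_, minusVec R C a m⁆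
        rw [← hzm]
        rfl
    have hy' : y ∈ minusSpace R C a := by rw [← eigenspaceC_neg_single C]; exact hy
    obtain ⟨z, hz, rfl⟩ := hle hy'
    exact hz
  have hsimple := hv.isSimpleRep S hv0 hgen (exists_isCompl_eigenspaceC C)
  obtain ⟨φ, hφ, -⟩ := hv.exists_irrModule_equiv S hsimple hv0
  have hint := isIntegrableG_eigenspaceC (R := R) C (-Pi.single a 1)
  have hint' := hint.of_injective (φ := φ.toLinearMap) φ.injective hφ
  refine ⟨hint', nonempty_equiv_of_linearEquiv hint hint' φ.symm fun j m => ?_⟩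
  apply φ.injective
  rw [hφ]
  simp only [LinearEquiv.apply_symm_apply]

end Modules

/-! ### The submodule generated by a highest weight vector -/

section GeneratedSubmodule

variable {k : Type*} [Field k] {L : Type*} [LieRing L] [LieAlgebra k L] {J : Type*} [Fintype J]
  {e f : J → L} {A : J → J → k} {c : J → k} {M : Type*} [AddCommGroup M] [Module k M]
  {ρ : L →ₗ⁅k⁆ Module.End k M}

/-- Complete reducibility is inherited by submodules. -/
theorem exists_isCompl_subRep
    (hss : ∀ N : Submodule k M, IsStable ρ N → ∃ N', IsStable ρ N' ∧ IsCompl N N')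
    {W : Submodule k M} (hW : IsStable ρ W) (N : Submodule k W) (hN : IsStable (subRep ρ W hW) N) :
    ∃ N', IsStable (subRep ρ W hW) N' ∧ IsCompl N N' := by
  obtain ⟨N', hN', hc⟩ := hss _ (isStable_map_subRep hN)
  refine ⟨N'.comap W.subtype, fun x m hm => hN' x _ hm, ?_, ?_⟩
  · rw [Submodule.disjoint_def]
    intro y hy hy'
    exact Subtype.val_injective (Submodule.disjoint_def.1 hc.disjoint _ ⟨y, hy, rfl⟩ hy')
  · rw [codisjoint_iff, eq_top_iff]
    intro y _
    have h1 : (y : M) ∈ N.map W.subtype ⊔ N' := by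
      rw [codisjoint_iff.1 hc.codisjoint]
      trivial
    obtain ⟨_, ⟨a, ha, rfl⟩, b, hb, hab⟩ := Submodule.mem_sup.1 h1
    refine Submodule.mem_sup.2 ⟨a, ha, y - a, ?_, by abel⟩
    have h2 : W.subtype (y - a) = b := by
      rw [map_sub, sub_eq_iff_eq_add']
      exact hab.symm
    rwa [Submodule.mem_comap, h2]

/-- In a completely reducible module, the submodule generated by a highest weight vector is the
irreducible module of that highest weight. -/
theorem IsHighest.exists_irrModule_hom [CharZero k] (S : ChevalleySystem e f A c) {lam : J → k}
    {u : M} (hu : IsHighest ρ e f lam u) (hu0 : u ≠ 0)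
    (hss : ∀ N : Submodule k M, IsStable ρ N → ∃ N', IsStable ρ N' ∧ IsCompl N N') :
    ∃ ψ : IrrModule e f lam →ₗ[k] M, Function.Injective ψ ∧
      (∀ x m, ψ (irrAction e f lam x m) = ρ x (ψ m)) ∧ ψ (Submodule.Quotient.mk 1) = u ∧
      ∀ N : Submodule k (IrrModule e f lam), IsStable (irrAction e f lam) N →
        Submodule.Quotient.mk 1 ∈ N → N = ⊤ := by
  obtain ⟨P, hst, -, -, hPN, -, -⟩ := hu.exists_lower S
  set W := Submodule.span k {u} ⊔ P with hW
  have huW : u ∈ W := Submodule.mem_sup_left (Submodule.mem_span_singleton_self u)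
  let u' : W := ⟨u, huW⟩
  have hu' : IsHighest (subRep ρ W hst) e f lam u' :=
    ⟨fun i => Subtype.ext (hu.e_zero i), fun i => Subtype.ext (hu.h_eq i)⟩
  have hgen : ∀ N, IsStable (subRep ρ W hst) N → u' ∈ N → N = ⊤ := by
    intro N hN huN
    have hWN : W ≤ N.map W.subtype :=
      sup_le ((Submodule.span_singleton_le_iff_mem _ _).2 ⟨u', huN, rfl⟩)
        (hPN _ ⟨u', huN, rfl⟩ fun i y hy => isStable_map_subRep hN (f i) y hy)
    rw [eq_top_iff]
    rintro y -
    obtain ⟨z, hz, hzy⟩ := hWN y.2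
    rwa [← (Subtype.val_injective hzy : z = y)]
  have hu0' : u' ≠ 0 := fun h => hu0 (congrArg Subtype.val h)
  obtain ⟨φ, hφ, hφ1⟩ := hu'.exists_irrModule_equiv S
    (hu'.isSimpleRep S hu0' hgen (exists_isCompl_subRep hss hst)) hu0'
  refine ⟨W.subtype ∘ₗ φ.toLinearMap, Subtype.val_injective.comp φ.injective,
    fun x m => congrArg Subtype.val (hφ x m), congrArg Subtype.val hφ1, fun N hN h1 => ?_⟩
  have htop := hgen (N.map φ.toLinearMap) (by
    rintro x _ ⟨m, hm, rfl⟩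
    exact ⟨irrAction e f lam x m, hN x m hm, hφ x m⟩) ⟨_, h1, hφ1⟩
  rw [eq_top_iff]
  intro m _
  obtain ⟨m', hm', hmm⟩ : φ m ∈ N.map φ.toLinearMap := by
    rw [htop]
    trivial
  rwa [← (φ.injective hmm : m' = m)]

end GeneratedSubmodule

/-! ### The multiplicity of `V_{ε_2}` -/

section Multiplicity

open KacMoodyAlgebra

variable {k : Type*} [Field k] {X : ModelType} {ℓ : ℕ}
  {𝔥 : Type*} [AddCommGroup 𝔥] [Module k 𝔥] {R : Realization k (X.extendedCartan ℓ) 𝔥}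
  (C : WeightChain (X.cartan ℓ))

theorem lie_f_inr_f_inr : ⁅f R (.inr 0), f R (.inr 1)⁆ = 0 := by
  have h1 := serre_f R (i := .inr 0) (j := .inr 1) (by simp)
  rw [X.extendedCartan_inr_inr_ne (by decide)] at h1
  simpa using h1

/-- The vector `⁅f_{α_0}, ⁅f_{α_1}, f_{β_0}⁆⁆`. -/
noncomputable def topVec (R : Realization k (X.extendedCartan ℓ) 𝔥) (C : WeightChain (X.cartan ℓ)) :
    KacMoodyAlgebra R :=
  ⁅f R (.inr 0), minusVec R C 1 1⁆

theorem lie_minusVec_one_minusVec_zero : ⁅minusVec R C 0 1, minusVec R C 1 0⁆ = -topVec R C := by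
  change ⁅⁅f R (.inl (C.c 0)), f R (.inr 0)⁆, f R (.inr 1)⁆ =
    -⁅f R (.inr 0), ⁅f R (.inl (C.c 0)), f R (.inr 1)⁆⁆
  rw [lie_lie, lie_f_inr_f_inr, lie_zero, zero_sub]

theorem topVec_mem_eigenspaceC : topVec R C ∈ eigenspaceC R ![-1, -1] := by
  have h1 := lie_mem_eigenspaceC (f_inr_mem_eigenspaceC (R := R) 0)
    (lie_mem_eigenspaceC (levi_le_eigenspaceC (leviG_le_levi (f_mem_leviG (C.c 0))))
      (f_inr_mem_eigenspaceC (R := R) 1))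
  have h2 : (-Pi.single 0 1 + (0 + -Pi.single 1 1) : Fin 2 → ℤ) = ![-1, -1] := by
    funext j
    fin_cases j <;> simp
  rw [h2] at h1
  exact h1

theorem minusVec_h_of_root_eq_one {t : 𝔥} (ht : ∀ i, R.root (.inl i) t = 1) (a : Fin 2) (m : ℕ) :
    ⁅h R t, minusVec R C a m⁆ = (-R.root (.inr a) t - m) • minusVec R C a m := by
  induction m with
  | zero => rw [Nat.cast_zero, sub_zero, neg_smul]; exact h_f R t _
  | succ m ih =>
    change ⁅h R t, ⁅f R (.inl (C.c m)), minusVec R C a m⁆⁆ = _ • ⁅_, minusVec R C a m⁆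
    rw [leibniz_lie, ih, h_f, ht, neg_lie, smul_lie, lie_smul]
    push_cast
    module

variable [CharZero k]

/-- Among the weight vectors spanning `𝔨_{-α_0-β_0}`, those whose weight differs from the highest
possible one by a simple root are proportional to `topVec`. -/
theorem exists_smul_topVec_of_weight {t : 𝔥} (ht : ∀ i, R.root (.inl i) t = 1)
    {y : KacMoodyAlgebra R} (hy : y ∈ eigenspaceC R ![-1, -1])
    (hty : ⁅h R t, y⁆ = (-R.root (.inr 0) t - R.root (.inr 1) t - 1) • y) :
    y ∈ Submodule.span k {topVec R C} := by
  set T := LieAlgebra.ad k (KacMoodyAlgebra R) (h R t) with hT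
  set τ := -R.root (.inr 0) t - R.root (.inr 1) t with hτ
  let Q : Submodule k (KacMoodyAlgebra R) := ⨆ (μ : k) (_ : μ ≠ τ - 1), T.eigenspace μ
  have hy' : y ∈ bracketSpan (minusSpace R C 0) (minusSpace R C 1) := by
    rw [← eigenspaceC_neg_one_neg_one]
    exact hy
  have hT1 : ∀ a b m n, ⁅h R t, ⁅minusVec R C a m, minusVec R C b n⁆⁆ =
      (-R.root (.inr a) t - R.root (.inr b) t - (m + n : ℕ)) •
        ⁅minusVec R C a m, minusVec R C b n⁆ := by
    intro a b m n
    rw [leibniz_lie, minusVec_h_of_root_eq_one C ht, minusVec_h_of_root_eq_one C ht, smul_lie,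
      lie_smul]
    push_cast
    module
  have hle : bracketSpan (minusSpace R C 0) (minusSpace R C 1) ≤
      Submodule.span k {topVec R C} ⊔ Q := by
    rw [bracketSpan, minusSpace, minusSpace, Submodule.map₂_span_span, Submodule.span_le]
    rintro _ ⟨_, ⟨⟨m, hm⟩, rfl⟩, _, ⟨⟨n, hn⟩, rfl⟩, rfl⟩
    change ⁅minusVec R C 0 m, minusVec R C 1 n⁆ ∈ Submodule.span k {topVec R C} ⊔ Q
    by_cases hmn : m + n = 1
    · refine Submodule.mem_sup_left ?_
      obtain ⟨rfl, rfl⟩ | ⟨rfl, rfl⟩ : (m = 0 ∧ n = 1) ∨ (m = 1 ∧ n = 0) := by omega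
      · exact Submodule.mem_span_singleton_self _
      · rw [lie_minusVec_one_minusVec_zero]
        exact neg_mem (Submodule.mem_span_singleton_self _)
    · refine Submodule.mem_sup_right (Submodule.mem_iSup_of_mem (τ - (m + n : ℕ))
        (Submodule.mem_iSup_of_mem (fun h1 => hmn ?_) ?_))
      · have h2 : ((m + n : ℕ) : k) = 1 := by linear_combination -h1
        exact_mod_cast h2
      · rw [Module.End.mem_eigenspace_iff, hT, LieAlgebra.ad_apply, hT1]
  obtain ⟨p, hp, q, hq, rfl⟩ := Submodule.mem_sup.1 (hle hy')
  have hp' : p ∈ T.eigenspace (τ - 1) := by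
    obtain ⟨s, rfl⟩ := Submodule.mem_span_singleton.1 hp
    refine Submodule.smul_mem _ s ?_
    rw [Module.End.mem_eigenspace_iff, hT, LieAlgebra.ad_apply]
    have h1 := hT1 0 1 0 1
    rw [zero_add, Nat.cast_one] at h1
    exact h1
  have hq' : q ∈ T.eigenspace (τ - 1) := by
    have h1 : p + q ∈ T.eigenspace (τ - 1) := Module.End.mem_eigenspace_iff.2 hty
    have h2 := sub_mem h1 hp'
    rwa [add_sub_cancel_left] at h2
  have h3 := Submodule.disjoint_def.1 (T.eigenspaces_iSupIndep (τ - 1)) q hq' hq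
  rw [h3, add_zero]
  exact hp

theorem topVec_ne_zero (h1 : 0 < ℓ) : topVec R C ≠ 0 := by
  intro h0
  obtain ⟨hN, hc, hx⟩ := C.start h1
  have hv : minusVec R C 1 1 = ⁅f R (.inl (C.c 0)), f R (.inr 1)⁆ := rfl
  have h2 : ⁅e R (.inr 0), topVec R C⁆ = minusVec R C 1 1 := by
    have h3 : ⁅e R (.inr 0), minusVec R C 1 1⁆ = 0 := by
      rw [hv, leibniz_lie, lie_e_f_ne R (by simp), lie_e_f_ne R (by simp), zero_lie, lie_zero,
        add_zero]
    rw [topVec, leibniz_lie, h3, lie_zero, add_zero, lie_e_f_same, hv, leibniz_lie, h_f, h_f,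
      R.root_coroot, R.root_coroot, X.extendedCartan_inr_inr_ne (by decide), hc,
      X.extendedCartan_inr_inl, if_pos rfl]
    simp
  have h4 := (minusVec_e_f (R := R) C 1 (show 1 ≤ C.N from hN)).1 (C.c 0)
  rw [if_pos ⟨one_pos, rfl⟩, hx, ← h2, h0, lie_zero, lie_zero, Nat.cast_one, one_smul] at h4
  exact f_ne_zero (R := R) (.inr 1) h4.symm

theorem isHighest_topVec (h2 : 1 < ℓ) :
    IsHighest (repC R ![-1, -1]) (leviE R) (leviF R) (X.eps k ⟨1, h2⟩)
      ⟨topVec R C, topVec_mem_eigenspaceC C⟩ := by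
  obtain ⟨hN, hc, hx⟩ := C.start (show 0 < ℓ by omega)
  refine ⟨fun i => Subtype.ext ?_, fun i => Subtype.ext ?_⟩
  · change ⁅e R (.inl i), ⁅f R (.inr 0), minusVec R C 1 1⁆⁆ = 0
    rw [leibniz_lie, lie_e_f_ne R (by simp), zero_lie, zero_add,
      (minusVec_e_f (R := R) C 1 (show 1 ≤ C.N from hN)).1 i]
    split_ifs
    · rw [lie_smul]
      change _ • ⁅f R (.inr 0), f R (.inr 1)⁆ = 0
      rw [lie_f_inr_f_inr, smul_zero]
    · exact lie_zero _
  · rw [coe_repC, coe_lie_leviE_leviF]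
    change ⁅h R (R.coroot (.inl i)), ⁅f R (.inr 0), ⁅f R (.inl (C.c 0)), f R (.inr 1)⁆⁆⁆ =
      X.eps k ⟨1, h2⟩ i • ⁅f R (.inr 0), ⁅f R (.inl (C.c 0)), f R (.inr 1)⁆⁆
    rw [leibniz_lie, leibniz_lie (h R _) (f R (.inl (C.c 0))), h_f, h_f, h_f, R.root_coroot,
      R.root_coroot, R.root_coroot, hc, X.extendedCartan_inl_inr, X.extendedCartan_inl_inr,
      X.extendedCartan_inl_inl, ModelType.eps_two]
    simp only [neg_lie, lie_neg, smul_lie, lie_smul, lie_add]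
    split_ifs <;> push_cast <;> module

/-- A vector of `𝔨_{-α_0-β_0}` of the same weight as `topVec` is proportional to it. -/
theorem exists_smul_topVec (h1 : 0 < ℓ) {lam : Fin ℓ → k}
    (hu : ∀ i, ⁅h R (R.coroot (.inl i)), topVec R C⁆ = lam i • topVec R C)
    {y : KacMoodyAlgebra R} (hy : y ∈ eigenspaceC R ![-1, -1])
    (hyh : ∀ i, ⁅h R (R.coroot (.inl i)), y⁆ = lam i • y) : ∃ s : k, s • topVec R C = y := by
  obtain ⟨c, hc⟩ := C.exists_sum_mul_eq (k := k) fun _ => 1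
  let t : 𝔥 := ∑ i, c i • R.coroot (.inl i)
  have ht : ∀ i, R.root (.inl i) t = 1 := by
    intro j
    rw [map_sum, ← hc j]
    exact Finset.sum_congr rfl fun i _ => by
      rw [map_smul, R.root_coroot, smul_eq_mul, X.extendedCartan_inl_inl]
  have hth : ∀ y : KacMoodyAlgebra R, (∀ i, ⁅h R (R.coroot (.inl i)), y⁆ = lam i • y) →
      ⁅h R t, y⁆ = (∑ i, c i * lam i) • y := by
    intro y hy
    rw [map_sum, sum_lie, Finset.sum_smul]
    exact Finset.sum_congr rfl fun i _ => by rw [map_smul, smul_lie, hy, smul_smul]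
  have hτ : ∑ i, c i * lam i = -R.root (.inr 0) t - R.root (.inr 1) t - 1 := by
    have h3 : ⁅h R t, topVec R C⁆ =
        (-R.root (.inr 0) t - R.root (.inr 1) t - 1) • topVec R C := by
      have h4 : ⁅h R t, minusVec R C 0 0⁆ = _ := minusVec_h_of_root_eq_one C ht 0 0
      change ⁅h R t, ⁅minusVec R C 0 0, minusVec R C 1 1⁆⁆ =
        _ • ⁅minusVec R C 0 0, minusVec R C 1 1⁆
      rw [leibniz_lie, h4, minusVec_h_of_root_eq_one C ht, smul_lie, lie_smul]
      push_cast
      module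
    rw [hth _ hu] at h3
    exact smul_left_injective k (topVec_ne_zero (R := R) C h1) h3
  exact Submodule.mem_span_singleton.1 (exists_smul_topVec_of_weight C ht hy
    (by rw [hth _ hyh, hτ]))

variable [FiniteDimensional k 𝔥]

/-- An equivariant map `V_{ε_2} → 𝔨_{-α_0-β_0}` is determined by the image of the highest weight
vector, which is a multiple of `topVec`. -/
theorem multiplicity_eps_two (hℓ : X.ValidRank ℓ) (h2 : 1 < ℓ) :
    IsIntegrableG R (irrAction (leviE R) (leviF R) (X.eps k ⟨1, h2⟩)) ∧
      Module.finrank k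
        ((VG R (X.eps k ⟨1, h2⟩)).IntertwiningMap (kG R ![-1, -1])) = 1 := by
  let C := X.weightChain ℓ hℓ
  obtain ⟨c, S⟩ := exists_chevalleySystem (R := R) C
  generalize hη : (![-1, -1] : Fin 2 → ℤ) = η
  let u : eigenspaceC R η := ⟨topVec R C, hη ▸ topVec_mem_eigenspaceC C⟩
  have hu0 : u ≠ 0 := fun h => topVec_ne_zero (R := R) C (by omega) (congrArg Subtype.val h)
  have hu : IsHighest (repC R η) (leviE R) (leviF R) (X.eps k ⟨1, h2⟩) u := by
    subst hη
    exact isHighest_topVec C h2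
  generalize X.eps k ⟨1, h2⟩ = lam at hu ⊢
  obtain ⟨ψ, hψinj, hψ, hψ1, hgen⟩ :=
    hu.exists_irrModule_hom S hu0 (exists_isCompl_eigenspaceC C)
  have hint := isIntegrableG_eigenspaceC (R := R) C η
  have hint' : IsIntegrableG R (irrAction (leviE R) (leviF R) lam) :=
    hint.of_injective hψinj hψ
  refine ⟨hint', ?_⟩
  generalize (Submodule.Quotient.mk 1 : IrrModule (leviE R) (leviF R) lam) = v at hψ1 hgen
  let Ψ : (VG R lam).IntertwiningMap (kG R η) :=
    ψ.intertwiningMap_of_isIntertwiningMap _ _ fun g m =>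
      integrate_equivariant hint' hint (fun j m => hψ _ m) g m
  have hΨ : Ψ.toLinearMap = ψ := rfl
  have hΨ0 : Ψ ≠ 0 := by
    intro h
    apply hu0
    rw [← hψ1, ← hΨ, h]
    rfl
  refine (finrank_eq_one_iff_of_nonzero' Ψ hΨ0).2 fun F => ?_
  have hF : ∀ x m, F.toLinearMap (irrAction (leviE R) (leviF R) lam x m) =
      repC R η x (F.toLinearMap m) := by
    have h1 := equivariant_of_integrate hint' hint (φ := F.toLinearMap)
      (fun g m => LinearMap.congr_fun (F.isIntertwining' g) m)
    exact equivariant_of_gen S.gen F.toLinearMap (fun i => h1 (.inl i)) (fun i => h1 (.inr i))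
  have huh : ∀ i, ⁅h R (R.coroot (.inl i)), topVec R C⁆ = lam i • topVec R C := by
    intro i
    have h1 := congrArg Subtype.val (hu.h_eq i)
    rw [coe_repC, coe_lie_leviE_leviF] at h1
    exact h1
  have hyh : ∀ i, ⁅h R (R.coroot (.inl i)), (F.toLinearMap v : KacMoodyAlgebra R)⁆ =
      lam i • (F.toLinearMap v : KacMoodyAlgebra R) := by
    intro i
    have h0 : irrAction (leviE R) (leviF R) lam ⁅leviE R i, leviF R i⁆ v = lam i • v := by
      apply hψinj
      rw [hψ, hψ1, hu.h_eq, map_smul, hψ1]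
    have h1 := congrArg Subtype.val (hF ⁅leviE R i, leviF R i⁆ v)
    rw [h0, map_smul, coe_repC, coe_lie_leviE_leviF] at h1
    exact h1.symm
  obtain ⟨s, hs⟩ := exists_smul_topVec C (by omega) huh (hη ▸ (F.toLinearMap v).2) hyh
  refine ⟨s, Representation.IntertwiningMap.ext ?_⟩
  change s • ψ = F.toLinearMap
  -- two equivariant maps which agree on the highest weight vector are equal
  have hker : LinearMap.ker (s • ψ - F.toLinearMap) = ⊤ := by
    refine hgen _ (fun x m hm => ?_) ?_
    · rw [LinearMap.mem_ker, LinearMap.sub_apply, LinearMap.smul_apply] at hm ⊢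
      rw [hψ, hF, ← map_smul, ← map_sub, hm, map_zero]
    · rw [LinearMap.mem_ker, LinearMap.sub_apply, LinearMap.smul_apply, hψ1, sub_eq_zero]
      exact Subtype.ext hs
  exact sub_eq_zero.1 (LinearMap.ker_eq_top.1 hker)

end Multiplicity

theorem mainTheorem5 {k : Type*} [Field k] [IsAlgClosed k] [CharZero k]
    (X : ModelType) (ℓ : ℕ) (hℓ : X.ValidRank ℓ)
    {𝔥 : Type*} [AddCommGroup 𝔥] [Module k 𝔥] [FiniteDimensional k 𝔥]
    (R : Realization k (X.extendedCartan ℓ) 𝔥) :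
    -- the `𝔨_η` are (finite dimensional, integrable) `G`-modules
    (∀ η : Fin 2 → ℤ,
      IsIntegrableG R (LieModule.toEnd k (leviG R) (eigenspaceC R η))) ∧
    -- `𝔨_0 = 𝔤 + 𝔱_K`
    (eigenspaceC R 0).toSubmodule =
      (leviG R).toSubmodule ⊔ KacMoodyAlgebra.torus R ∧
    -- `𝔨^-` is the Lie algebra generated by `𝔨_{-α_0}` and `𝔨_{-β_0}`
    (LieSubalgebra.lieSpan k (KacMoodyAlgebra R)
        ((eigenspaceC R ![-1, 0] : Set (KacMoodyAlgebra R)) ∪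
          (eigenspaceC R ![0, -1] : Set (KacMoodyAlgebra R)))).toSubmodule =
      (⨆ (a : ℕ) (b : ℕ) (_ : (a, b) ≠ (0, 0)),
        (eigenspaceC R ![-(a : ℤ), -(b : ℤ)]).toSubmodule) ∧
    -- `𝔨_{-η} ≅ 𝔨_η^*`
    (∀ η : Fin 2 → ℤ, Nonempty ((kG R (-η)).Equiv (kG R η).dual)) ∧
    -- `𝔨_{-α_0} ≅ V_{ε_1}` and `𝔨_{-β_0} ≅ V_{ε_1}`
    (∀ h1 : 0 < ℓ,
      IsIntegrableG R (irrAction (leviE R) (leviF R) (X.eps k ⟨0, h1⟩)) ∧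
      Nonempty ((kG R ![-1, 0]).Equiv (VG R (X.eps k ⟨0, h1⟩))) ∧
      Nonempty ((kG R ![0, -1]).Equiv (VG R (X.eps k ⟨0, h1⟩)))) ∧
    -- `V_{ε_2}` has multiplicity one in `𝔨_{-α_0-β_0}`
    (∀ h2 : 1 < ℓ,
      IsIntegrableG R (irrAction (leviE R) (leviF R) (X.eps k ⟨1, h2⟩)) ∧
      Module.finrank k
        ((VG R (X.eps k ⟨1, h2⟩)).IntertwiningMap (kG R ![-1, -1])) = 1) := by
  let C := X.weightChain ℓ hℓ
  have h0 : (![-1, 0] : Fin 2 → ℤ) = -Pi.single 0 1 := by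
    funext j; fin_cases j <;> simp
  have h1 : (![0, -1] : Fin 2 → ℤ) = -Pi.single 1 1 := by
    funext j; fin_cases j <;> simp
  refine ⟨isIntegrableG_eigenspaceC C, eigenspaceC_zero C, lieSpan_eigenspaceC C,
    nonempty_equiv_dual_kG C, fun hl => ?_, multiplicity_eps_two hℓ⟩
  rw [h0, h1]
  exact ⟨(equiv_eps_one hℓ hl 0).1, (equiv_eps_one hℓ hl 0).2, (equiv_eps_one hℓ hl 1).2⟩
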